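/- Fix $n\ge 0$ and $\mathcal S\subseteq\{1,\dots,n\}$. All algebras are over $\mathbb F=\mathbb F_2$. **The algebras.** For $x\subseteq\{0,\dots,n\}$ and $1\le i\le n$ put $v_i^x=\#\{r\in x: r\ge i\}$. Let $\mathcal B_0(n)$ be the algebra with orthogonal idempotents $\mathbf I_x$, $x\subseteq\{0,\dots,n\}$, with sum $1$, such that $\mathbf I_x\mathcal B_0(n)\mathbf I_y$ is zero if $|x|\ne|y|$ and is the free $\mathbb F[U_1,\dots,U_n]$-module of rank one on a generator $\varphi^{x,y}$ if $|x|=|y|$. Its multiplication is $\mathbb F[U_1,\dots,U_n]$-bilinear and $$\varphi^{x,y}\varphi^{y,z}=\Big(\prod_{i}U_i^{\,w_i(x,y)+w_i(y,z)-w_i(x,z)}\Big)\varphi^{x,z},\qquad w_i(x,y)=\tfrac12\,|v_i^x-v_i^y| .$$ Let $R_i=\sum\varphi^{x,y}$ over all $x$ with $i-1\in x$, $i\notin x$ and $y=(x\setminus\{i-1\})\cup\{i\}$, and let $L_i=\sum\varphi^{x,y}$ over all $x$ with $i\in x$, $i-1\notin x$ and $y=(x\setminus\{i\})\cup\{i-1\}$.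 The dg algebra $\mathcal B(n,\mathcal S)$ is obtained from $\mathcal B_0(n)$ by adjoining central elements $C_i$ for $i\in\mathcal S$ (commuting with each other) and dividing by the two-sided ideal generated by $R_iR_{i+1}$ and $L_{i+1}L_i$ for $1\le i<n$, by $\mathbf I_xU_i$ whenever $x\cap\{i-1,i\}=\varnothing$, and by $C_i^2$ for $i\in\mathcal S$. The differential satisfies the Leibniz rule, $dC_i=U_i$, and $d=0$ on the image of $\mathcal B_0(n)$. It has a homological grading by $\mathbb Z$ and an intrinsic grading by $\frac12\mathbb Z$: the $\mathbf I_x$ have bidegree $(0,0)$; if $i\in\mathcal S$ then $C_i$ has bidegree $(1,-1)$; and a generator $\varphi^{x,y}\prod_i U_i^{a_i}$ has bidegree $\sum_i(w_i(x,y)+a_i)\,b_i$, where $b_i=(2,-1)$ if $i\in\mathcal S$ and $b_i=(0,1)$ if $i\notin\mathcal S$. The differential raises the homological degree by $1$ and preserves the intrinsic degree. Put $$\mathcal C_r(n,\mathcal S)=\Big(\sum_{x\subseteq\{1,\dots,n\}}\mathbf I_x\Big)\mathcal B(n,\mathcal S)\Big(\sum_{x\subseteq\{1,\dots,n\}}\mathbf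 I_x\Big),\qquad \mathcal C_l(n,\mathcal S)=\Big(\sum_{x\subseteq\{0,\dots,n-1\}}\mathbf I_x\Big)\mathcal B(n,\mathcal S)\Big(\sum_{x\subseteq\{0,\dots,n-1\}}\mathbf I_x\Big).$$ **The category.** Let $\mathcal A$ be one of these two algebras. A finitely generated Type D structure $X$ over $\mathcal A$ consists of finitely many generators, each with an idempotent $\mathbf I_x$ of $\mathcal A$ and a bidegree, and an operation $\delta^1\colon X\to\mathcal A\otimes X$ (tensor product over the ring spanned by the idempotents) which raises the homological degree by $1$, preserves the intrinsic degree, and satisfies $(\mu_1\otimes\mathrm{id})\delta^1+(\mu_2\otimes\mathrm{id})(\mathrm{id}\otimes\delta^1)\delta^1=0$, where $\mu_1=d$ and $\mu_2$ is the multiplication. It is operationally bounded if the iterated operations $\delta^k\colon X\to\mathcal A^{\otimes k}\otimes X$ vanish for all large $k$. Let $\mathcal D^b(\mathcal A)$ be the homotopy category of the finitely generated operationally bounded Type D structures: the morphisms are the bidegree-preserving closed maps $X\to\mathcal A\otimes Y$ up to homotopy. It is triangulated: the shift $[1]$ lowers the homological degree by $1$, and the distinguished triangles are those isomorphic to $X\xrightarrow{f}Y\to\mathrm{Cone}(f)\to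 X[1]$. Its Grothendieck group $K_0(\mathcal D^b(\mathcal A))$ is the free abelian group on the isomorphism classes $[X]$ of objects modulo $[X]+[Z]=[Y]$ for every distinguished triangle $X\to Y\to Z\to X[1]$. It is a $\mathbb Z[t^{\pm1/2}]$-module, where $t^{\pm1/2}[X]$ is the class of $X$ with all intrinsic degrees raised by $\pm\frac12$. For an idempotent $\mathbf I_x$ of $\mathcal A$, the elementary projective $Q_{\mathbf I_x}$ is the Type D structure with one generator, of idempotent $\mathbf I_x$ and bidegree $(0,0)$, and $\delta^1=0$. **Theorem.** The $2^n$ classes $[Q_{\mathbf I_x}]$, where $x$ ranges over the subsets of $\{1,\dots,n\}$, form a basis of $K_0(\mathcal D^b(\mathcal C_r(n,\mathcal S)))$ over $\mathbb Z[t^{\pm1/2}]$. Likewise, the $2^n$ classes $[Q_{\mathbf I_x}]$, where $x$ ranges over the subsets of $\{0,\dots,n-1\}$, form a basis of $K_0(\mathcal D^b(\mathcal C_l(n,\mathcal S)))$ over $\mathbb Z[t^{\pm1/2}]$. -/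

import Mathlib

noncomputable section

open CategoryTheory CategoryTheory.Limits CategoryTheory.Pretriangulated

namespace BorderedK0

/-- A dg algebra over `𝔽₂` with a finite complete system of orthogonal idempotents, a homological
grading by `ℤ` and an intrinsic grading by `½ℤ`. The bidegree `(h, j)` stands for homological degree
`h` and intrinsic degree `j / 2`. The differential raises the homological degree by one. -/
structure BigradedDGAlgebra where
  carrier : Type
  [ring : Ring carrier]
  [algebra : Algebra (ZMod 2) carrier]
  Idx : Type
  [fintypeIdx : Fintype Idx]
  idem : Idx → carrier
  complete_orthogonal : CompleteOrthogonalIdempotents idem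
  gr : ℤ × ℤ → Submodule (ZMod 2) carrier
  isInternal : DirectSum.IsInternal gr
  idem_mem : ∀ x, idem x ∈ gr 0
  mul_mem : ∀ {p q : ℤ × ℤ} {a b : carrier}, a ∈ gr p → b ∈ gr q → a * b ∈ gr (p + q)
  d : carrier →ₗ[ZMod 2] carrier
  d_mem : ∀ {p : ℤ × ℤ} {a : carrier}, a ∈ gr p → d a ∈ gr (p + (1, 0))
  d_d : ∀ a, d (d a) = 0
  d_mul : ∀ a b, d (a * b) = d a * b + a * d b
  d_idem : ∀ x, d (idem x) = 0

namespace BigradedDGAlgebra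

attribute [instance] ring algebra fintypeIdx

/-- A direct sum decomposition from a family of projections. -/
theorem isInternal_of_proj {V : Type} [AddCommGroup V] [Module (ZMod 2) V]
    (gr : ℤ × ℤ → Submodule (ZMod 2) V) (π : ℤ × ℤ → V →ₗ[ZMod 2] V)
    (hmem : ∀ p a, π p a ∈ gr p) (hself : ∀ p a, a ∈ gr p → π p a = a)
    (hne : ∀ p q a, p ≠ q → a ∈ gr q → π p a = 0)
    (hsum : ∀ a, ∃ s : Finset (ℤ × ℤ), a = ∑ p ∈ s, π p a) :
    DirectSum.IsInternal gr := by
  apply DirectSum.isInternal_submodule_of_iSupIndep_of_iSup_eq_top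
  · rw [iSupIndep_def]
    intro p
    rw [Submodule.disjoint_def]
    intro a ha hb
    rw [← hself p a ha]
    have : (⨆ j, ⨆ (_ : j ≠ p), gr j) ≤ LinearMap.ker (π p) :=
      iSup₂_le fun q hq b hb => LinearMap.mem_ker.2 (hne p q b hq.symm hb)
    exact LinearMap.mem_ker.1 (this hb)
  · rw [eq_top_iff]
    intro a _
    obtain ⟨s, hs⟩ := hsum a
    rw [hs]
    exact Submodule.sum_mem _ fun p _ => Submodule.mem_iSup_of_mem p (hmem p a)

variable (A : BigradedDGAlgebra)

open Classical in
/-- The idempotent `∑_{x : P x} I_x`. -/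
def idemSum (P : A.Idx → Prop) : A.carrier := ∑ x : {x // P x}, A.idem x

theorem idem_mul_idem (x y : A.Idx) [Decidable (x = y)] :
    A.idem x * A.idem y = if x = y then A.idem x else 0 := by
  split_ifs with h
  · subst h; exact A.complete_orthogonal.idem x
  · exact A.complete_orthogonal.ortho h

open Classical in
theorem idem_mul_idemSum (P : A.Idx → Prop) (x : {x // P x}) :
    A.idem x * A.idemSum P = A.idem x := by
  simp only [idemSum, Finset.mul_sum, idem_mul_idem, Subtype.coe_inj]
  simp

open Classical in
theorem idemSum_mul_idem (P : A.Idx → Prop) (x : {x // P x}) :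
    A.idemSum P * A.idem x = A.idem x := by
  simp only [idemSum, Finset.sum_mul, idem_mul_idem, Subtype.coe_inj]
  simp

theorem idemSum_idem (P : A.Idx → Prop) : IsIdempotentElem (A.idemSum P) := by
  exact (Finset.sum_mul ..).trans (Finset.sum_congr rfl fun x _ => A.idem_mul_idemSum P x)

theorem idemSum_mem (P : A.Idx → Prop) : A.idemSum P ∈ A.gr 0 :=
  Submodule.sum_mem _ fun x _ => A.idem_mem x

theorem d_idemSum (P : A.Idx → Prop) : A.d (A.idemSum P) = 0 := by
  simp [idemSum, d_idem]

instance cornerModule {R : Type} [Ring R] [Algebra (ZMod 2) R] {e : R}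
    (he : IsIdempotentElem e) : Module (ZMod 2) he.Corner :=
  AddCommGroup.zmodModule fun x => by
    rw [two_nsmul]; exact Subtype.ext (ZModModule.add_self x.1)

instance cornerAlgebra {R : Type} [Ring R] [Algebra (ZMod 2) R] {e : R}
    (he : IsIdempotentElem e) : Algebra (ZMod 2) he.Corner :=
  Algebra.ofModule
    (fun r x y => by
      rcases (by decide : ∀ r : ZMod 2, r = 0 ∨ r = 1) r with rfl | rfl <;> simp)
    (fun r x y => by
      rcases (by decide : ∀ r : ZMod 2, r = 0 ∨ r = 1) r with rfl | rfl <;> simp)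

/-- The inclusion of the corner. -/
def cornerVal {R : Type} [Ring R] [Algebra (ZMod 2) R] {e : R}
    (he : IsIdempotentElem e) : he.Corner →ₗ[ZMod 2] R :=
  AddMonoidHom.toZModLinearMap 2
    { toFun := fun x => x.1, map_zero' := rfl, map_add' := fun _ _ => rfl }

theorem cornerVal_injective {R : Type} [Ring R] [Algebra (ZMod 2) R] {e : R}
    (he : IsIdempotentElem e) : Function.Injective (cornerVal he) := Subtype.val_injective

theorem cornerVal_mul {R : Type} [Ring R] [Algebra (ZMod 2) R] {e : R}
    (he : IsIdempotentElem e) (x y : he.Corner) :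
    cornerVal he (x * y) = cornerVal he x * cornerVal he y := rfl

theorem mul_cornerVal {R : Type} [Ring R] [Algebra (ZMod 2) R] {e : R}
    (he : IsIdempotentElem e) (x : he.Corner) : e * cornerVal he x = cornerVal he x :=
  ((Subsemigroup.mem_corner_iff he).1 x.2).1

theorem cornerVal_mul_self {R : Type} [Ring R] [Algebra (ZMod 2) R] {e : R}
    (he : IsIdempotentElem e) (x : he.Corner) : cornerVal he x * e = cornerVal he x :=
  ((Subsemigroup.mem_corner_iff he).1 x.2).2

/-- A linear endomorphism commuting with multiplication by `e` on both sides, on the corner. -/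
def cornerMap {R : Type} [Ring R] [Algebra (ZMod 2) R] {e : R} (he : IsIdempotentElem e)
    (f : R →ₗ[ZMod 2] R) (hl : ∀ a, f (e * a) = e * f a) (hr : ∀ a, f (a * e) = f a * e) :
    he.Corner →ₗ[ZMod 2] he.Corner :=
  AddMonoidHom.toZModLinearMap 2
    { toFun := fun x => ⟨f x.1, (Subsemigroup.mem_corner_iff he).2
        ⟨by rw [← hl]; exact congrArg f (mul_cornerVal he x),
         by rw [← hr]; exact congrArg f (cornerVal_mul_self he x)⟩⟩
      map_zero' := Subtype.ext (map_zero f)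
      map_add' := fun _ _ => Subtype.ext (map_add f _ _) }

theorem cornerVal_cornerMap {R : Type} [Ring R] [Algebra (ZMod 2) R] {e : R}
    (he : IsIdempotentElem e) (f : R →ₗ[ZMod 2] R) (hl hr) (x : he.Corner) :
    cornerVal he (cornerMap he f hl hr x) = f (cornerVal he x) := rfl

theorem d_idemSum_mul (P : A.Idx → Prop) (a : A.carrier) :
    A.d (A.idemSum P * a) = A.idemSum P * A.d a := by simp [d_mul, d_idemSum]

theorem d_mul_idemSum (P : A.Idx → Prop) (a : A.carrier) :
    A.d (a * A.idemSum P) = A.d a * A.idemSum P := by simp [d_mul, d_idemSum]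

theorem one_mem : (1 : A.carrier) ∈ A.gr 0 := by
  rw [← A.complete_orthogonal.complete]
  exact Submodule.sum_mem _ fun x _ => A.idem_mem x

theorem corner_isInternal (P : A.Idx → Prop) :
    DirectSum.IsInternal fun p => (A.gr p).comap (cornerVal (A.idemSum_idem P)) := by
  classical
  let : DirectSum.Decomposition A.gr := A.isInternal.chooseDecomposition
  let : GradedRing A.gr :=
    { one_mem := A.one_mem
      mul_mem := fun _ _ _ _ ha hb => A.mul_mem ha hb }
  have hl : ∀ p a, GradedRing.proj A.gr p (A.idemSum P * a)
      = A.idemSum P * GradedRing.proj A.gr p a := fun p a => by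
    simpa using DirectSum.coe_decompose_mul_of_left_mem_zero A.gr (A.idemSum_mem P)
  have hr : ∀ p a, GradedRing.proj A.gr p (a * A.idemSum P)
      = GradedRing.proj A.gr p a * A.idemSum P := fun p a => by
    simpa using DirectSum.coe_decompose_mul_of_right_mem_zero A.gr (A.idemSum_mem P)
  refine isInternal_of_proj _ (fun p => cornerMap (A.idemSum_idem P)
    ((GradedRing.proj A.gr p).toZModLinearMap 2) (hl p) (hr p)) ?_ ?_ ?_ ?_
  · intro p a
    exact (DirectSum.decompose A.gr (cornerVal _ a) p).2
  · intro p a ha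
    apply cornerVal_injective
    exact DirectSum.decompose_of_mem_same A.gr ha
  · intro p q a hpq ha
    apply cornerVal_injective
    exact DirectSum.decompose_of_mem_ne A.gr ha hpq.symm
  · intro a
    refine ⟨(DirectSum.decompose A.gr (cornerVal _ a)).support, ?_⟩
    apply cornerVal_injective
    rw [map_sum]
    exact (DirectSum.sum_support_decompose A.gr (cornerVal _ a)).symm

/-- The idempotent `I_x`, where `P x`, as an element of the corner. -/
def cornerIdem (P : A.Idx → Prop) (x : {x // P x}) : (A.idemSum_idem P).Corner :=
  ⟨A.idem x, (Subsemigroup.mem_corner_iff (A.idemSum_idem P)).2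
    ⟨A.idemSum_mul_idem P x, A.idem_mul_idemSum P x⟩⟩

/-- The truncation `(∑_{P x} I_x) · A · (∑_{P x} I_x)`. -/
def truncate (P : A.Idx → Prop) : BigradedDGAlgebra where
  carrier := (A.idemSum_idem P).Corner
  Idx := {x // P x}
  fintypeIdx := by classical exact inferInstance
  idem := A.cornerIdem P
  complete_orthogonal := by
    classical
    refine ⟨⟨fun x => Subtype.ext (A.complete_orthogonal.idem x), fun x y h =>
      Subtype.ext (A.complete_orthogonal.ortho (Subtype.coe_ne_coe.2 h))⟩, ?_⟩
    apply cornerVal_injective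
    rw [map_sum]
    rfl
  gr p := (A.gr p).comap (cornerVal (A.idemSum_idem P))
  isInternal := A.corner_isInternal P
  idem_mem x := A.idem_mem x
  mul_mem ha hb := A.mul_mem ha hb
  d := cornerMap (A.idemSum_idem P) A.d (A.d_idemSum_mul P) (A.d_mul_idemSum P)
  d_mem ha := A.d_mem ha
  d_d a := Subtype.ext (A.d_d a.1)
  d_mul a b := Subtype.ext (A.d_mul a.1 b.1)
  d_idem x := Subtype.ext (A.d_idem x)

end BigradedDGAlgebra

open Matrix

namespace BigradedDGAlgebra
variable (A : BigradedDGAlgebra)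

/-- The homogeneous elements of bidegree `p` in `I_x · A · I_y`. -/
def hom (x y : A.Idx) (p : ℤ × ℤ) : Submodule (ZMod 2) A.carrier where
  carrier := {a | a ∈ A.gr p ∧ A.idem x * a = a ∧ a * A.idem y = a}
  add_mem' ha hb := ⟨add_mem ha.1 hb.1, by rw [mul_add, ha.2.1, hb.2.1],
    by rw [add_mul, ha.2.2, hb.2.2]⟩
  zero_mem' := ⟨zero_mem _, by simp, by simp⟩
  smul_mem' c a ha := ⟨Submodule.smul_mem _ c ha.1, by rw [mul_smul_comm, ha.2.1],
    by rw [smul_mul_assoc, ha.2.2]⟩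

variable {A}

theorem hom_mul {x y z : A.Idx} {p q r : ℤ × ℤ} {a b : A.carrier} (ha : a ∈ A.hom x y p)
    (hb : b ∈ A.hom y z q) (h : p + q = r) : a * b ∈ A.hom x z r :=
  ⟨h ▸ A.mul_mem ha.1 hb.1, by rw [← mul_assoc, ha.2.1], by rw [mul_assoc, hb.2.2]⟩

theorem hom_d {x y : A.Idx} {p q : ℤ × ℤ} {a : A.carrier} (ha : a ∈ A.hom x y p)
    (h : p + (1, 0) = q) : A.d a ∈ A.hom x y q := by
  refine ⟨h ▸ A.d_mem ha.1, ?_, ?_⟩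
  · conv_rhs => rw [← ha.2.1, A.d_mul, A.d_idem, zero_mul, zero_add]
  · conv_rhs => rw [← ha.2.2, A.d_mul, A.d_idem, mul_zero, add_zero]

theorem idem_mem_hom (x : A.Idx) : A.idem x ∈ A.hom x x 0 :=
  ⟨A.idem_mem x, A.complete_orthogonal.idem x, A.complete_orthogonal.idem x⟩

end BigradedDGAlgebra

open BigradedDGAlgebra

/-- A finitely generated (left) Type D structure over `A`: a bigraded free module on finitely many
generators, each homogeneous and with its idempotent, and an operation
`δ¹ x = ∑ y, δ x y ⊗ y` of bidegree `(1, 0)`, satisfying the structure equation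
`(μ₁ ⊗ id) ∘ δ¹ + (μ₂ ⊗ id) ∘ (id ⊗ δ¹) ∘ δ¹ = 0`. -/
structure TypeD (A : BigradedDGAlgebra) where
  gen : Type
  [fintypeGen : Fintype gen]
  idem : gen → A.Idx
  deg : gen → ℤ × ℤ
  δ : Matrix gen gen A.carrier
  δ_mem : ∀ x y, δ x y ∈ A.hom (idem x) (idem y) (deg x + (1, 0) - deg y)
  δ_δ : δ.map A.d + δ * δ = 0

namespace TypeD

attribute [instance] fintypeGen

variable {A : BigradedDGAlgebra}

/-- The matrix of the iterated operation `δ^(k+1) : X → A ⊗ ⋯ ⊗ A ⊗ X` with `k + 1` factors `A`: its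
entries are elements of degree `k + 1` of the tensor algebra of `A` over `𝔽₂`. -/
def iterate {G R : Type} [Fintype G] [Ring R] [Algebra (ZMod 2) R] (δ : Matrix G G R) :
    ℕ → Matrix G G (TensorAlgebra (ZMod 2) R)
  | 0 => δ.map (TensorAlgebra.ι (ZMod 2))
  | k + 1 => δ.map (TensorAlgebra.ι (ZMod 2)) * iterate δ k

/-- The iterated operations `δ^k` vanish for all large `k`. -/
def IsOperationallyBounded (X : TypeD A) : Prop := ∃ k, iterate X.δ k = 0

/-- The morphisms of homological degree `k` and intrinsic degree zero: a matrix `f` stands for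
`x ↦ ∑ y, f x y ⊗ y`. Composition `X → Y → Z` is the matrix product. -/
def homSub (X Y : TypeD A) (k : ℤ) : Submodule (ZMod 2) (Matrix X.gen Y.gen A.carrier) where
  carrier := {f | ∀ x y, f x y ∈ A.hom (X.idem x) (Y.idem y) (X.deg x + (k, 0) - Y.deg y)}
  add_mem' hf hg x y := add_mem (hf x y) (hg x y)
  zero_mem' _ _ := zero_mem _
  smul_mem' c _ hf x y := Submodule.smul_mem _ c (hf x y)

/-- The differential `D f = d f + δ_X f + f δ_Y` on the morphism complex. -/
def diff (X Y : TypeD A) :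
    Matrix X.gen Y.gen A.carrier →ₗ[ZMod 2] Matrix X.gen Y.gen A.carrier where
  toFun f := f.map A.d + X.δ * f + f * Y.δ
  map_add' f g := by
    rw [Matrix.map_add _ (map_add A.d), Matrix.mul_add, Matrix.add_mul]; abel
  map_smul' c f := by
    ext x y
    simp [Matrix.map_apply, smul_add]

/-- The homomorphisms of Type D structures: closed morphisms of bidegree zero. -/
def cycles (X Y : TypeD A) : Submodule (ZMod 2) (Matrix X.gen Y.gen A.carrier) :=
  homSub X Y 0 ⊓ LinearMap.ker (diff X Y)

theorem mem_cycles_iff {X Y : TypeD A} {f : Matrix X.gen Y.gen A.carrier} :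
    f ∈ cycles X Y ↔ f ∈ homSub X Y 0 ∧ diff X Y f = 0 := Iff.rfl

theorem diff_apply (X Y : TypeD A) (f : Matrix X.gen Y.gen A.carrier) :
    diff X Y f = f.map A.d + X.δ * f + f * Y.δ := rfl

/-- The null-homotopic morphisms of bidegree zero. -/
def boundaries (X Y : TypeD A) : Submodule (ZMod 2) (Matrix X.gen Y.gen A.carrier) :=
  (homSub X Y (-1)).map (diff X Y)

/-- Homomorphisms of Type D structures up to homotopy. -/
def HoHom (X Y : TypeD A) : Type := cycles X Y ⧸ (boundaries X Y).submoduleOf (cycles X Y)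

instance (X Y : TypeD A) : AddCommGroup (HoHom X Y) :=
  inferInstanceAs (AddCommGroup (cycles X Y ⧸ (boundaries X Y).submoduleOf (cycles X Y)))

instance (X Y : TypeD A) : Module (ZMod 2) (HoHom X Y) :=
  inferInstanceAs (Module (ZMod 2) (cycles X Y ⧸ (boundaries X Y).submoduleOf (cycles X Y)))

/-- The homotopy class of a homomorphism. -/
def cls {X Y : TypeD A} (f : Matrix X.gen Y.gen A.carrier) (hf : f ∈ cycles X Y) : HoHom X Y :=
  Submodule.Quotient.mk (⟨f, hf⟩ : cycles X Y)

theorem exists_cls {X Y : TypeD A} (φ : HoHom X Y) : ∃ f hf, φ = cls f hf := by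
  obtain ⟨⟨f, hf⟩, rfl⟩ := Submodule.Quotient.mk_surjective _ φ
  exact ⟨f, hf, rfl⟩

theorem cls_eq_iff {X Y : TypeD A} {f g : Matrix X.gen Y.gen A.carrier} {hf : f ∈ cycles X Y}
    {hg : g ∈ cycles X Y} :
    cls f hf = cls g hg ↔ ∃ h ∈ homSub X Y (-1), diff X Y h = f + g := by
  have : cls f hf = cls g hg ↔ f - g ∈ boundaries X Y :=
    Submodule.Quotient.eq _
  rw [this, ZModModule.sub_eq_add]
  rfl

theorem cls_congr {X Y : TypeD A} {f g : Matrix X.gen Y.gen A.carrier} {hf : f ∈ cycles X Y}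
    {hg : g ∈ cycles X Y} (h : f = g) : cls f hf = cls g hg := by subst h; rfl

theorem cls_add {X Y : TypeD A} {f g : Matrix X.gen Y.gen A.carrier} (hf : f ∈ cycles X Y)
    (hg : g ∈ cycles X Y) : cls f hf + cls g hg = cls (f + g) (add_mem hf hg) := rfl

theorem cls_zero {X Y : TypeD A} : cls (0 : Matrix X.gen Y.gen A.carrier) (zero_mem _) = 0 := rfl

theorem homSub_mul {X Y Z : TypeD A} {k l m : ℤ} {f : Matrix X.gen Y.gen A.carrier}
    {g : Matrix Y.gen Z.gen A.carrier} (hf : f ∈ homSub X Y k) (hg : g ∈ homSub Y Z l)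
    (h : k + l = m) : f * g ∈ homSub X Z m := by
  intro x z
  rw [Matrix.mul_apply]
  refine Submodule.sum_mem _ fun y _ => hom_mul (hf x y) (hg y z) ?_
  subst h
  ext
  · simp; ring
  · simp

theorem diff_mul {X Y Z : TypeD A} (f : Matrix X.gen Y.gen A.carrier)
    (g : Matrix Y.gen Z.gen A.carrier) :
    diff X Z (f * g) = diff X Y f * g + f * diff Y Z g := by
  have h1 : (f * g).map A.d = f.map A.d * g + f * g.map A.d := by
    ext x z
    simp [Matrix.mul_apply, A.d_mul, Finset.sum_add_distrib]
  have h2 : f * Y.δ * g + f * (Y.δ * g) = 0 := by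
    rw [Matrix.mul_assoc]; exact ZModModule.add_self _
  simp only [diff, LinearMap.coe_mk, AddHom.coe_mk, h1, Matrix.add_mul, Matrix.mul_add,
    Matrix.mul_assoc] at h2 ⊢
  rw [← add_zero (f.map A.d * g + f * g.map A.d + _ + _), ← h2]
  abel

theorem cycles_mul {X Y Z : TypeD A} {f : Matrix X.gen Y.gen A.carrier}
    {g : Matrix Y.gen Z.gen A.carrier} (hf : f ∈ cycles X Y) (hg : g ∈ cycles Y Z) :
    f * g ∈ cycles X Z := by
  refine mem_cycles_iff.2 ⟨homSub_mul hf.1 hg.1 (add_zero 0), ?_⟩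
  rw [diff_mul, LinearMap.mem_ker.1 hf.2, LinearMap.mem_ker.1 hg.2]
  simp

/-- Composition of homotopy classes, in diagrammatic order. -/
def HoHom.comp {X Y Z : TypeD A} (φ : HoHom X Y) (ψ : HoHom Y Z) : HoHom X Z :=
  Quotient.liftOn₂ φ ψ (fun f g => cls (f.1 * g.1) (cycles_mul f.2 g.2)) (by
    intro f g f' g' hf hg
    obtain ⟨h, hh, e⟩ := cls_eq_iff.1 (show cls f.1 f.2 = cls f'.1 f'.2 from Quotient.sound hf)
    obtain ⟨k, hk, e'⟩ := cls_eq_iff.1 (show cls g.1 g.2 = cls g'.1 g'.2 from Quotient.sound hg)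
    refine cls_eq_iff.2 ⟨h * g.1 + f'.1 * k, add_mem (homSub_mul hh g.2.1 (by simp))
      (homSub_mul f'.2.1 hk (by simp)), ?_⟩
    rw [map_add, diff_mul, diff_mul, e, e', LinearMap.mem_ker.1 g.2.2,
      LinearMap.mem_ker.1 f'.2.2, Matrix.add_mul, Matrix.mul_add, Matrix.mul_zero,
      Matrix.zero_mul, add_zero, zero_add, add_assoc, ← add_assoc (f'.1 * g.1),
      ZModModule.add_self, zero_add])

theorem cls_comp {X Y Z : TypeD A} {f : Matrix X.gen Y.gen A.carrier}
    {g : Matrix Y.gen Z.gen A.carrier} (hf : f ∈ cycles X Y) (hg : g ∈ cycles Y Z) :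
    (cls f hf).comp (cls g hg) = cls (f * g) (cycles_mul hf hg) := rfl

open Classical in
/-- The identity morphism `x ↦ I_x ⊗ x`. -/
def idm (X : TypeD A) : Matrix X.gen X.gen A.carrier := Matrix.diagonal fun x => A.idem (X.idem x)

theorem idm_mul {X Y : TypeD A} {k : ℤ} {f : Matrix X.gen Y.gen A.carrier}
    (hf : f ∈ homSub X Y k) : X.idm * f = f := by
  ext x y; simp [idm, (hf x y).2.1]

theorem mul_idm {X Y : TypeD A} {k : ℤ} {f : Matrix X.gen Y.gen A.carrier}
    (hf : f ∈ homSub X Y k) : f * Y.idm = f := by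
  ext x y; simp [idm, (hf x y).2.2]

theorem δ_mem_homSub (X : TypeD A) : X.δ ∈ homSub X X 1 := X.δ_mem

theorem idm_map_d (X : TypeD A) : X.idm.map A.d = 0 := by
  classical
  ext x y
  by_cases h : x = y
  · subst h; simp [idm, A.d_idem]
  · simp [idm, h]

theorem idm_mem_of_deg {X : TypeD A} {g : X.gen → X.gen → ℤ × ℤ} (hg : ∀ x, g x x = 0) (x y) :
    X.idm x y ∈ A.hom (X.idem x) (X.idem y) (g x y) := by
  classical
  by_cases h : x = y
  · subst h; simpa [idm, hg] using idem_mem_hom (X.idem x)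
  · simp [idm, h]

theorem idm_mem_cycles (X : TypeD A) : X.idm ∈ cycles X X := by
  refine mem_cycles_iff.2 ⟨idm_mem_of_deg (fun x => by simp), ?_⟩
  simp [diff, idm_map_d, idm_mul X.δ_mem_homSub, mul_idm X.δ_mem_homSub, ZModModule.add_self]

end TypeD

/-- The objects of `D^b(A)`: finitely generated operationally bounded Type D structures over `A`. -/
structure Db (A : BigradedDGAlgebra) extends TypeD A where
  bounded : toTypeD.IsOperationallyBounded

namespace Db
open TypeD
variable {A : BigradedDGAlgebra}

/-- The homotopy category of finitely generated operationally bounded Type D structures. -/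
instance : Category (Db A) where
  Hom X Y := HoHom X.toTypeD Y.toTypeD
  id X := cls X.idm X.idm_mem_cycles
  comp φ ψ := HoHom.comp φ ψ
  id_comp φ := by
    obtain ⟨f, hf, rfl⟩ := exists_cls φ
    exact cls_congr (idm_mul hf.1)
  comp_id φ := by
    obtain ⟨f, hf, rfl⟩ := exists_cls φ
    exact cls_congr (mul_idm hf.1)
  assoc φ ψ χ := by
    obtain ⟨f, hf, rfl⟩ := exists_cls φ
    obtain ⟨g, hg, rfl⟩ := exists_cls ψ
    obtain ⟨h, hh, rfl⟩ := exists_cls χ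
    exact cls_congr (Matrix.mul_assoc f g h)

/-- The morphism represented by a cycle. -/
def mor {X Y : Db A} (f : Matrix X.gen Y.gen A.carrier)
    (hf : f ∈ cycles X.toTypeD Y.toTypeD) : X ⟶ Y := cls f hf

theorem exists_mor {X Y : Db A} (φ : X ⟶ Y) : ∃ f hf, φ = mor f hf := exists_cls φ

theorem mor_congr {X Y : Db A} {f g : Matrix X.gen Y.gen A.carrier}
    {hf : f ∈ cycles X.toTypeD Y.toTypeD} {hg : g ∈ cycles X.toTypeD Y.toTypeD} (h : f = g) :
    mor f hf = mor g hg := cls_congr h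

theorem mor_eq_iff {X Y : Db A} {f g : Matrix X.gen Y.gen A.carrier}
    {hf : f ∈ cycles X.toTypeD Y.toTypeD} {hg : g ∈ cycles X.toTypeD Y.toTypeD} :
    mor f hf = mor g hg ↔
      ∃ h ∈ homSub X.toTypeD Y.toTypeD (-1), diff X.toTypeD Y.toTypeD h = f + g := cls_eq_iff

theorem mor_comp {X Y Z : Db A} {f : Matrix X.gen Y.gen A.carrier}
    {g : Matrix Y.gen Z.gen A.carrier} (hf : f ∈ cycles X.toTypeD Y.toTypeD)
    (hg : g ∈ cycles Y.toTypeD Z.toTypeD) :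
    mor f hf ≫ mor g hg = mor (f * g) (cycles_mul hf hg) := rfl

theorem mor_idm (X : Db A) : mor X.idm X.idm_mem_cycles = 𝟙 X := rfl

instance : Preadditive (Db A) where
  homGroup X Y := inferInstanceAs (AddCommGroup (HoHom X.toTypeD Y.toTypeD))
  add_comp X Y Z φ φ' ψ := by
    obtain ⟨f, hf, rfl⟩ := exists_mor φ
    obtain ⟨f', hf', rfl⟩ := exists_mor φ'
    obtain ⟨g, hg, rfl⟩ := exists_mor ψ
    exact cls_congr (Matrix.add_mul f f' g)
  comp_add X Y Z φ ψ ψ' := by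
    obtain ⟨f, hf, rfl⟩ := exists_mor φ
    obtain ⟨g, hg, rfl⟩ := exists_mor ψ
    obtain ⟨g', hg', rfl⟩ := exists_mor ψ'
    exact cls_congr (Matrix.mul_add f g g')

theorem mor_add {X Y : Db A} {f g : Matrix X.gen Y.gen A.carrier}
    (hf : f ∈ cycles X.toTypeD Y.toTypeD) (hg : g ∈ cycles X.toTypeD Y.toTypeD) :
    mor f hf + mor g hg = mor (f + g) (add_mem hf hg) := rfl

theorem mor_zero {X Y : Db A} :
    mor (0 : Matrix X.gen Y.gen A.carrier) (zero_mem _) = (0 : X ⟶ Y) := rfl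

theorem neg_eq {X Y : Db A} (φ : X ⟶ Y) : -φ = φ := by
  obtain ⟨f, hf, rfl⟩ := exists_mor φ
  rw [neg_eq_iff_add_eq_zero, mor_add]
  exact mor_congr (ZModModule.add_self f)

end Db

namespace TypeD
variable {A : BigradedDGAlgebra}

/-- The bigrading shift of `X` downwards by `s`. -/
abbrev regrade (X : TypeD A) (s : ℤ × ℤ) : TypeD A where
  gen := X.gen
  idem := X.idem
  deg x := X.deg x - s
  δ := X.δ
  δ_mem x y := by
    have h : X.deg x - s + (1, 0) - (X.deg y - s) = X.deg x + (1, 0) - X.deg y := by abel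
    rw [h]; exact X.δ_mem x y
  δ_δ := X.δ_δ

theorem homSub_regrade (X Y : TypeD A) (s : ℤ × ℤ) (k : ℤ) :
    homSub (X.regrade s) (Y.regrade s) k = homSub X Y k := by
  have h : ∀ (x : X.gen) (y : Y.gen),
      X.deg x - s + (k, 0) - (Y.deg y - s) = X.deg x + (k, 0) - Y.deg y := by intros; abel
  ext f
  exact forall₂_congr fun x y =>
    Iff.of_eq (congrArg (f x y ∈ A.hom (X.idem x) (Y.idem y) ·) (h x y))

theorem cycles_regrade (X Y : TypeD A) (s : ℤ × ℤ) :
    cycles (X.regrade s) (Y.regrade s) = cycles X Y := by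
  unfold cycles
  rw [homSub_regrade]; rfl

/-- The same generators and operation, with the same bidegrees up to propositional equality. -/
theorem idm_mem_cycles_of_regrade (X : TypeD A) {s t u : ℤ × ℤ} (h : u = s + t) :
    X.idm ∈ cycles (X.regrade u) ((X.regrade s).regrade t) ∧
      X.idm ∈ cycles ((X.regrade s).regrade t) (X.regrade u) := by
  subst h
  constructor
  · refine mem_cycles_iff.2 ⟨?_, (mem_cycles_iff.1 X.idm_mem_cycles).2⟩
    refine idm_mem_of_deg (g := fun x y => X.deg x - (s + t) + (0, 0) - (X.deg y - s - t))
      fun x => ?_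
    simp [sub_sub]
  · refine mem_cycles_iff.2 ⟨?_, (mem_cycles_iff.1 X.idm_mem_cycles).2⟩
    refine idm_mem_of_deg (g := fun x y => X.deg x - s - t + (0, 0) - (X.deg y - (s + t)))
      fun x => ?_
    simp [sub_sub]

theorem idm_mem_cycles_of_eq (X : TypeD A) {s t : ℤ × ℤ} (h : s = t) :
    X.idm ∈ cycles (X.regrade s) (X.regrade t) := by
  subst h; exact (X.regrade s).idm_mem_cycles

theorem idm_mem_cycles_zero (X : TypeD A) :
    X.idm ∈ cycles (X.regrade 0) X ∧ X.idm ∈ cycles X (X.regrade 0) := by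
  constructor
  · refine mem_cycles_iff.2 ⟨?_, (mem_cycles_iff.1 X.idm_mem_cycles).2⟩
    exact idm_mem_of_deg (g := fun x y => X.deg x - 0 + (0, 0) - X.deg y) fun x => by simp
  · refine mem_cycles_iff.2 ⟨?_, (mem_cycles_iff.1 X.idm_mem_cycles).2⟩
    exact idm_mem_of_deg (g := fun x y => X.deg x + (0, 0) - (X.deg y - 0)) fun x => by simp

theorem idm_mul_idm (X : TypeD A) : X.idm * X.idm = X.idm := idm_mul X.idm_mem_cycles.1

theorem iterate_mul {G R : Type} [Fintype G] [Ring R] [Algebra (ZMod 2) R] (δ : Matrix G G R)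
    (j k : ℕ) : iterate δ j * iterate δ k = iterate δ (j + k + 1) := by
  induction j with
  | zero => simp [iterate]
  | succ j ih =>
    rw [show j + 1 + k + 1 = (j + k + 1) + 1 by omega, iterate, iterate, Matrix.mul_assoc, ih]

theorem iterate_eq_zero_of_le {G R : Type} [Fintype G] [Ring R] [Algebra (ZMod 2) R]
    {δ : Matrix G G R} {j k : ℕ} (h : iterate δ j = 0) (hjk : j ≤ k) : iterate δ k = 0 := by
  rcases hjk.eq_or_lt with rfl | h'
  · exact h
  · obtain ⟨l, rfl⟩ := Nat.exists_eq_add_of_lt h'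
    rw [← iterate_mul, h, Matrix.zero_mul]

theorem iterate_fromBlocks {G H R : Type} [Fintype G] [Fintype H] [Ring R] [Algebra (ZMod 2) R]
    (a : Matrix G G R) (f : Matrix G H R) (b : Matrix H H R) (k : ℕ) :
    ∃ g, iterate (fromBlocks a f 0 b) k = fromBlocks (iterate a k) g 0 (iterate b k) := by
  induction k with
  | zero =>
    refine ⟨f.map (TensorAlgebra.ι (ZMod 2)), ?_⟩
    simp [iterate, fromBlocks_map]
  | succ k ih =>
    obtain ⟨g, hg⟩ := ih
    rw [iterate, hg, fromBlocks_map, fromBlocks_multiply]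
    simp [iterate]

theorem exists_iterate_fromBlocks {G H R : Type} [Fintype G] [Fintype H] [Ring R]
    [Algebra (ZMod 2) R] {a : Matrix G G R} (f : Matrix G H R) {b : Matrix H H R}
    (ha : ∃ k, iterate a k = 0) (hb : ∃ k, iterate b k = 0) :
    ∃ k, iterate (fromBlocks a f 0 b) k = 0 := by
  obtain ⟨j, hj⟩ := ha
  obtain ⟨k, hk⟩ := hb
  obtain ⟨g, hg⟩ := iterate_fromBlocks a f b (max j k)
  refine ⟨max j k + max j k + 1, ?_⟩
  rw [← iterate_mul, hg, iterate_eq_zero_of_le hj (le_max_left _ _),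
    iterate_eq_zero_of_le hk (le_max_right _ _), fromBlocks_multiply]
  simp

/-- The mapping cone of `f : X → Y`: the generators of `X[1]` and of `Y`, with
`δ¹ = δ_X + f + δ_Y`. -/
abbrev cone {X Y : TypeD A} (f : Matrix X.gen Y.gen A.carrier) (hf : f ∈ cycles X Y) : TypeD A where
  gen := X.gen ⊕ Y.gen
  idem := Sum.elim X.idem Y.idem
  deg := Sum.elim (fun x => X.deg x - (1, 0)) Y.deg
  δ := fromBlocks X.δ f 0 Y.δ
  δ_mem := by
    rintro (x | x) (y | y)
    · exact (X.regrade (1, 0)).δ_mem x y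
    · have h : X.deg x - (1, 0) + (1, 0) - Y.deg y = X.deg x + (0, 0) - Y.deg y := by
        rw [sub_add_cancel, Prod.mk_zero_zero, add_zero]
      simp only [Sum.elim_inl, Sum.elim_inr, fromBlocks_apply₁₂]
      rw [h]; exact hf.1 x y
    · exact zero_mem _
    · exact Y.δ_mem x y
  δ_δ := by
    have h := (mem_cycles_iff.1 hf).2
    rw [diff_apply, add_assoc] at h
    rw [fromBlocks_map, fromBlocks_multiply, fromBlocks_add]
    simp only [Matrix.mul_zero, Matrix.zero_mul, add_zero, zero_add, X.δ_δ, Y.δ_δ, h]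
    rw [Matrix.map_zero _ (map_zero A.d), fromBlocks_zero]

end TypeD

namespace Db
open TypeD
variable {A : BigradedDGAlgebra}

/-- The bigrading shift downwards by `s`. -/
abbrev regrade (s : ℤ × ℤ) (X : Db A) : Db A := ⟨X.toTypeD.regrade s, X.bounded⟩

theorem mem_regrade {X Y : Db A} (s : ℤ × ℤ) {f : Matrix X.gen Y.gen A.carrier}
    (hf : f ∈ cycles X.toTypeD Y.toTypeD) :
    f ∈ cycles (X.regrade s).toTypeD (Y.regrade s).toTypeD :=
  (cycles_regrade X.toTypeD Y.toTypeD s).symm ▸ hf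

/-- The bigrading shift downwards by `s`, as a functor. -/
def regradeFunctor (s : ℤ × ℤ) : Db A ⥤ Db A where
  obj := regrade s
  map {X Y} φ := Quotient.liftOn φ
    (fun f => mor (X := X.regrade s) (Y := Y.regrade s) f.1 (mem_regrade s f.2)) (by
      intro f g hfg
      obtain ⟨h, hh, e⟩ := cls_eq_iff.1 (show cls f.1 f.2 = cls g.1 g.2 from Quotient.sound hfg)
      exact mor_eq_iff.2 ⟨h, (homSub_regrade X.toTypeD Y.toTypeD s (-1)).symm ▸ hh, e⟩)
  map_id X := rfl
  map_comp φ ψ := by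
    obtain ⟨f, hf, rfl⟩ := exists_mor φ
    obtain ⟨g, hg, rfl⟩ := exists_mor ψ
    rfl

theorem regradeFunctor_map (s : ℤ × ℤ) {X Y : Db A} {f : Matrix X.gen Y.gen A.carrier}
    (hf : f ∈ cycles X.toTypeD Y.toTypeD) : (regradeFunctor s).map (mor f hf) =
      mor (X := X.regrade s) (Y := Y.regrade s) f (mem_regrade s hf) := rfl

instance (s : ℤ × ℤ) : (regradeFunctor (A := A) s).Additive where
  map_add {X Y φ ψ} := by
    obtain ⟨f, hf, rfl⟩ := exists_mor φ
    obtain ⟨g, hg, rfl⟩ := exists_mor ψ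
    rfl

/-- `X` and `X` with all bidegrees lowered by zero. -/
def regradeZero : regradeFunctor (A := A) 0 ≅ 𝟭 (Db A) :=
  NatIso.ofComponents (fun X =>
    { hom := mor (X := X.regrade 0) X.idm X.idm_mem_cycles_zero.1
      inv := mor (Y := X.regrade 0) X.idm X.idm_mem_cycles_zero.2
      hom_inv_id := mor_congr X.idm_mul_idm
      inv_hom_id := mor_congr X.idm_mul_idm }) (by
    intro X Y φ
    obtain ⟨f, hf, rfl⟩ := exists_mor φ
    exact mor_congr ((mul_idm hf.1).trans (idm_mul hf.1).symm))

/-- Successive bigrading shifts. -/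
def regradeAdd {s t u : ℤ × ℤ} (h : u = s + t) :
    regradeFunctor (A := A) u ≅ regradeFunctor s ⋙ regradeFunctor t :=
  NatIso.ofComponents (fun X =>
    { hom := mor (X := X.regrade u) (Y := (X.regrade s).regrade t) X.idm
        (X.idm_mem_cycles_of_regrade h).1
      inv := mor (Y := X.regrade u) (X := (X.regrade s).regrade t) X.idm
        (X.idm_mem_cycles_of_regrade h).2
      hom_inv_id := mor_congr X.idm_mul_idm
      inv_hom_id := mor_congr X.idm_mul_idm }) (by
    intro X Y φ
    obtain ⟨f, hf, rfl⟩ := exists_mor φ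
    exact mor_congr ((mul_idm hf.1).trans (idm_mul hf.1).symm))

theorem eqToHom_regrade (X : Db A) {s t : ℤ × ℤ} (h : s = t) (h' : X.regrade s = X.regrade t) :
    eqToHom h' = mor (X := X.regrade s) (Y := X.regrade t) X.idm (X.idm_mem_cycles_of_eq h) := by
  subst h; rfl

/-- The homological shift: `X[n]` is `X` with homological degrees lowered by `n`. -/
def shiftMkCore : ShiftMkCore (Db A) ℤ where
  F n := regradeFunctor (n, 0)
  zero := regradeZero
  add n m := regradeAdd (by simp)
  assoc_hom_app a b c X := by
    have h := eqToHom_regrade X (s := (a + b + c, 0)) (t := (a + (b + c), 0))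
      (by rw [add_assoc]) (by rw [add_assoc])
    refine Eq.trans ?_ (congrArg (· ≫ _) h.symm)
    refine mor_congr ?_
    exact X.idm_mul_idm.trans ((congrArg (X.idm * ·) X.idm_mul_idm).trans X.idm_mul_idm).symm
  zero_add_hom_app n X := by
    have h := eqToHom_regrade X (s := (0 + n, 0)) (t := (n, 0))
      (by rw [zero_add]) (by rw [zero_add])
    refine Eq.trans ?_ (congrArg (· ≫ _) h.symm)
    exact mor_congr X.idm_mul_idm.symm
  add_zero_hom_app n X := by
    have h := eqToHom_regrade X (s := (n + 0, 0)) (t := (n, 0))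
      (by rw [add_zero]) (by rw [add_zero])
    refine Eq.trans ?_ (congrArg (· ≫ _) h.symm)
    exact mor_congr X.idm_mul_idm.symm

instance : HasShift (Db A) ℤ := hasShiftMk _ _ shiftMkCore

theorem shiftFunctor_eq (n : ℤ) : shiftFunctor (Db A) n = regradeFunctor (n, 0) := rfl

instance (n : ℤ) : (shiftFunctor (Db A) n).Additive :=
  inferInstanceAs (regradeFunctor (n, 0)).Additive

end Db

namespace TypeD
variable {A : BigradedDGAlgebra}

/-- The Type D structure with no generators. -/
def empty (A : BigradedDGAlgebra) : TypeD A where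
  gen := Empty
  idem := Empty.elim
  deg := Empty.elim
  δ := 0
  δ_mem x := x.elim
  δ_δ := by ext x; exact x.elim

section blocks
variable {X Y Z W : TypeD A} {f : Matrix X.gen Y.gen A.carrier} {hf : f ∈ cycles X Y}
  {g : Matrix Z.gen W.gen A.carrier} {hg : g ∈ cycles Z W}

theorem mem_homSub_to_cone {k : ℤ} {a : Matrix Z.gen X.gen A.carrier}
    {b : Matrix Z.gen Y.gen A.carrier} (ha : a ∈ homSub Z X (k + 1)) (hb : b ∈ homSub Z Y k) :
    fromCols a b ∈ homSub Z (cone f hf) k := by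
  rintro x (y | y)
  · have := ha x y
    have h : Z.deg x + (k + 1, 0) - X.deg y = Z.deg x + (k, 0) - (X.deg y - (1, 0)) := by
      exact Prod.ext (by simp; ring) (by simp)
    rw [h] at this
    exact this
  · exact hb x y

theorem mem_homSub_from_cone {k : ℤ} {a : Matrix X.gen Z.gen A.carrier}
    {b : Matrix Y.gen Z.gen A.carrier} (ha : a ∈ homSub X Z (k - 1)) (hb : b ∈ homSub Y Z k) :
    fromRows a b ∈ homSub (cone f hf) Z k := by
  rintro (x | x) y
  · have := ha x y
    have h : X.deg x + (k - 1, 0) - Z.deg y = X.deg x - (1, 0) + (k, 0) - Z.deg y := by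
      exact Prod.ext (by simp; ring) (by simp)
    rw [h] at this
    exact this
  · exact hb x y

theorem mem_homSub_cone_cone {k : ℤ} {a : Matrix X.gen Z.gen A.carrier}
    {b : Matrix X.gen W.gen A.carrier} {c : Matrix Y.gen Z.gen A.carrier}
    {e : Matrix Y.gen W.gen A.carrier}
    (ha : a ∈ homSub X Z k) (hb : b ∈ homSub X W (k - 1)) (hc : c ∈ homSub Y Z (k + 1))
    (he : e ∈ homSub Y W k) :
    fromBlocks a b c e ∈ homSub (cone f hf) (cone g hg) k := by
  rw [← fromRows_fromCols_eq_fromBlocks]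
  exact mem_homSub_from_cone
    (mem_homSub_to_cone (by rwa [sub_add_cancel]) hb) (mem_homSub_to_cone hc he)

theorem diff_to_cone (a : Matrix Z.gen X.gen A.carrier) (b : Matrix Z.gen Y.gen A.carrier) :
    diff Z (cone f hf) (fromCols a b) = fromCols (diff Z X a) (diff Z Y b + a * f) := by
  have h1 : (fromCols a b).map A.d = fromCols (a.map A.d) (b.map A.d) := by
    ext x (y | y) <;> rfl
  have h2 : fromCols a b * fromBlocks X.δ f 0 Y.δ = fromCols (a * X.δ) (a * f + b * Y.δ) := by
    refine (fromCols_mul_fromBlocks ..).trans ?_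
    rw [Matrix.mul_zero, add_zero]
  have h3 : Z.δ * fromCols a b = fromCols (Z.δ * a) (Z.δ * b) := mul_fromCols ..
  refine (congrArg₂ (· + ·) (congrArg₂ (· + ·) h1 h3) h2).trans ?_
  rw [diff_apply, diff_apply]
  ext x (y | y)
  · rfl
  · simp only [Matrix.add_apply, fromCols_apply_inr]
    abel

theorem diff_from_cone (a : Matrix X.gen Z.gen A.carrier) (b : Matrix Y.gen Z.gen A.carrier) :
    diff (cone f hf) Z (fromRows a b) = fromRows (diff X Z a + f * b) (diff Y Z b) := by
  have h1 : (fromRows a b).map A.d = fromRows (a.map A.d) (b.map A.d) := by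
    ext (x | x) y <;> rfl
  have h2 : fromBlocks X.δ f 0 Y.δ * fromRows a b = fromRows (X.δ * a + f * b) (Y.δ * b) := by
    refine (fromBlocks_mul_fromRows ..).trans ?_
    rw [Matrix.zero_mul, zero_add]
  have h3 : fromRows a b * Z.δ = fromRows (a * Z.δ) (b * Z.δ) := fromRows_mul ..
  refine (congrArg₂ (· + ·) (congrArg₂ (· + ·) h1 h2) h3).trans ?_
  rw [diff_apply, diff_apply]
  ext (x | x) y
  · simp only [Matrix.add_apply, fromRows_apply_inl]
    abel
  · rfl

theorem diff_cone_cone (a : Matrix X.gen Z.gen A.carrier) (b : Matrix X.gen W.gen A.carrier)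
    (c : Matrix Y.gen Z.gen A.carrier) (e : Matrix Y.gen W.gen A.carrier) :
    diff (cone f hf) (cone g hg) (fromBlocks a b c e) =
      fromBlocks (diff X Z a + f * c) (diff X W b + a * g + f * e)
        (diff Y Z c) (diff Y W e + c * g) := by
  have h := diff_from_cone (hf := hf) (Z := cone g hg) (fromCols a b) (fromCols c e)
  rw [diff_to_cone, diff_to_cone] at h
  rw [← fromRows_fromCols_eq_fromBlocks, ← fromRows_fromCols_eq_fromBlocks]
  refine h.trans ?_
  congr 1
  refine (congrArg (fromCols _ _ + ·) (mul_fromCols f c e)).trans ?_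
  ext x (y | y) <;> rfl

theorem idm_mem_homSub (X : TypeD A) : X.idm ∈ homSub X X 0 := X.idm_mem_cycles.1

theorem diff_idm (X : TypeD A) : diff X X X.idm = 0 := (mem_cycles_iff.1 X.idm_mem_cycles).2

theorem idm_self (X : TypeD A) (x : X.gen) : X.idm x x = A.idem (X.idem x) := by
  classical
  simp [idm]

theorem idm_ne (X : TypeD A) {x y : X.gen} (h : x ≠ y) : X.idm x y = 0 := by
  classical
  simp [idm, h]

theorem idm_cone : (cone f hf).idm = fromBlocks X.idm 0 0 Y.idm := by
  ext (x | x) (y | y)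
  · by_cases h : x = y
    · subst h; exact (idm_self _ _).trans (idm_self X x).symm
    · exact (idm_ne _ (fun e => h (Sum.inl_injective e))).trans (idm_ne X h).symm
  · exact idm_ne _ Sum.inl_ne_inr
  · exact idm_ne _ Sum.inr_ne_inl
  · by_cases h : x = y
    · subst h; exact (idm_self _ _).trans (idm_self Y x).symm
    · exact (idm_ne _ (fun e => h (Sum.inr_injective e))).trans (idm_ne Y h).symm

theorem homSub_regrade_left {k l : ℤ} {a : Matrix Z.gen W.gen A.carrier}
    (ha : a ∈ homSub Z W (k - l)) : a ∈ homSub (Z.regrade (l, 0)) W k := fun x y => by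
  have h : ∀ p q : ℤ × ℤ, p + (k - l, 0) - q = p - (l, 0) + (k, 0) - q := fun p q =>
    Prod.ext (by simp; ring) (by simp)
  exact (congrArg (a x y ∈ A.hom (Z.idem x) (W.idem y) ·) (h (Z.deg x) (W.deg y))).mp (ha x y)

theorem homSub_regrade_right {k l : ℤ} {a : Matrix Z.gen W.gen A.carrier}
    (ha : a ∈ homSub Z W (k + l)) : a ∈ homSub Z (W.regrade (l, 0)) k := fun x y => by
  have h : ∀ p q : ℤ × ℤ, p + (k + l, 0) - q = p + (k, 0) - (q - (l, 0)) := fun p q =>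
    Prod.ext (by simp; ring) (by simp)
  exact (congrArg (a x y ∈ A.hom (Z.idem x) (W.idem y) ·) (h (Z.deg x) (W.deg y))).mp (ha x y)

theorem diff_regrade_left (s : ℤ × ℤ) (a : Matrix Z.gen W.gen A.carrier) :
    diff (Z.regrade s) W a = diff Z W a := rfl

theorem diff_regrade_right (s : ℤ × ℤ) (a : Matrix Z.gen W.gen A.carrier) :
    diff Z (W.regrade s) a = diff Z W a := rfl

variable (f hf) in
/-- The inclusion `Y → Cone(f)`. -/
abbrev coneIncl : Matrix Y.gen (cone f hf).gen A.carrier := fromCols 0 Y.idm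

variable (f hf) in
/-- The projection `Cone(f) → X[1]`. -/
abbrev coneProj : Matrix (cone f hf).gen X.gen A.carrier := fromRows X.idm 0

variable (f hf) in
theorem coneIncl_mem : coneIncl f hf ∈ cycles Y (cone f hf) := by
  refine mem_cycles_iff.2 ⟨mem_homSub_to_cone (zero_mem _) Y.idm_mem_homSub, ?_⟩
  refine (diff_to_cone ..).trans ?_
  rw [map_zero, diff_idm, Matrix.zero_mul, add_zero, fromCols_zero]

variable (f hf) in
theorem coneProj_mem_homSub : coneProj f hf ∈ homSub (cone f hf) X 1 :=
  mem_homSub_from_cone X.idm_mem_homSub (zero_mem _)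

variable (f hf) in
theorem diff_coneProj : diff (cone f hf) X (coneProj f hf) = 0 := by
  refine (diff_from_cone ..).trans ?_
  rw [map_zero, diff_idm, Matrix.mul_zero, add_zero, fromRows_zero]

variable (f hf) in
theorem coneProj_mem : coneProj f hf ∈ cycles (cone f hf) (X.regrade (1, 0)) :=
  mem_cycles_iff.2 ⟨homSub_regrade_right (coneProj_mem_homSub f hf), diff_coneProj f hf⟩

end blocks
end TypeD

namespace Db
open TypeD
variable {A : BigradedDGAlgebra}

/-- The zero object. -/
def zero (A : BigradedDGAlgebra) : Db A := ⟨TypeD.empty A, 0, by ext x; exact x.elim⟩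

theorem isZero_zero : IsZero (zero A) := by
  rw [IsZero.iff_id_eq_zero]
  exact mor_congr (by ext x; exact x.elim)

instance : HasZeroObject (Db A) := ⟨⟨zero A, isZero_zero⟩⟩

variable {X Y Z W : Db A} (f : Matrix X.gen Y.gen A.carrier)
  (hf : f ∈ cycles X.toTypeD Y.toTypeD)

/-- The mapping cone of a cycle. -/
abbrev cone : Db A := ⟨TypeD.cone f hf, exists_iterate_fromBlocks f X.bounded Y.bounded⟩

/-- The inclusion into the cone. -/
def incl : Y ⟶ cone f hf := mor (Y := cone f hf) (coneIncl f hf) (coneIncl_mem f hf)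

/-- The projection from the cone. -/
def proj : cone f hf ⟶ X⟦(1 : ℤ)⟧ :=
  mor (X := cone f hf) (Y := X.regrade (1, 0)) (coneProj f hf) (coneProj_mem f hf)

/-- The standard triangle `X → Y → Cone(f) → X[1]`. -/
def standardTriangle : Triangle (Db A) := Triangle.mk (mor f hf) (incl f hf) (proj f hf)

/-- The map `X[1] → Cone(Y → Cone(f))`. -/
def rotU : Matrix X.gen (TypeD.cone (coneIncl f hf) (coneIncl_mem f hf)).gen A.carrier :=
  fromCols f (fromCols X.idm 0)

/-- The map `Cone(Y → Cone(f)) → X[1]`. -/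
def rotV : Matrix (TypeD.cone (coneIncl f hf) (coneIncl_mem f hf)).gen X.gen A.carrier :=
  fromRows 0 (fromRows X.idm 0)

theorem rotU_mem : rotU f hf ∈ cycles (X.toTypeD.regrade (1, 0))
    (TypeD.cone (coneIncl f hf) (coneIncl_mem f hf)) := by
  refine mem_cycles_iff.2 ⟨homSub_regrade_left (mem_homSub_to_cone hf.1
    (mem_homSub_to_cone X.idm_mem_homSub (zero_mem _))), ?_⟩
  have h0 : diff X.toTypeD (TypeD.cone f hf) (fromCols X.idm 0) = fromCols 0 f :=
    (diff_to_cone ..).trans (by rw [diff_idm, map_zero, idm_mul hf.1, zero_add])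
  have h1 : f * coneIncl f hf = fromCols 0 f :=
    (mul_fromCols ..).trans (by rw [Matrix.mul_zero, mul_idm hf.1])
  refine (diff_to_cone ..).trans ?_
  refine (congrArg₂ fromCols (mem_cycles_iff.1 hf).2
    (congrArg₂ (· + ·) h0 h1)).trans ?_
  rw [ZModModule.add_self, fromCols_zero]

theorem rotV_mem : rotV f hf ∈ cycles (TypeD.cone (coneIncl f hf) (coneIncl_mem f hf))
    (X.toTypeD.regrade (1, 0)) := by
  refine mem_cycles_iff.2 ⟨homSub_regrade_right (mem_homSub_from_cone (zero_mem _)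
    (mem_homSub_from_cone X.idm_mem_homSub (zero_mem _))), ?_⟩
  have h0 : diff (TypeD.cone f hf) X.toTypeD (fromRows X.idm 0) = 0 := diff_coneProj f hf
  have h1 : coneIncl f hf * fromRows X.idm (0 : Matrix Y.gen X.gen A.carrier) = 0 :=
    (fromCols_mul_fromRows ..).trans (by rw [Matrix.zero_mul, Matrix.mul_zero, add_zero])
  refine (diff_from_cone ..).trans ?_
  refine (congrArg₂ fromRows (congrArg₂ (· + ·) (map_zero _) h1) h0).trans ?_
  rw [add_zero]
  exact fromRows_zero

theorem rotU_mul_rotV : rotU f hf * rotV f hf = X.idm := by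
  refine (fromCols_mul_fromRows ..).trans ?_
  rw [Matrix.mul_zero, zero_add]
  refine (fromCols_mul_fromRows ..).trans ?_
  rw [Matrix.mul_zero, add_zero, idm_mul_idm]

theorem rotV_mul_rotU : ∃ h ∈ homSub (TypeD.cone (coneIncl f hf) (coneIncl_mem f hf))
    (TypeD.cone (coneIncl f hf) (coneIncl_mem f hf)) (-1),
    diff _ _ h = rotV f hf * rotU f hf +
      (TypeD.cone (coneIncl f hf) (coneIncl_mem f hf)).idm := by
  refine ⟨fromBlocks 0 0 (fromRows 0 Y.idm) 0,
    mem_homSub_cone_cone (zero_mem _) (zero_mem _)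
      (mem_homSub_from_cone (zero_mem _) Y.idm_mem_homSub) (zero_mem _), ?_⟩
  refine (diff_cone_cone ..).trans ?_
  have h1 : coneIncl f hf * fromRows 0 Y.idm = Y.idm :=
    (fromCols_mul_fromRows ..).trans (by rw [Matrix.mul_zero, zero_add, idm_mul_idm])
  have h2 : diff (TypeD.cone f hf) Y.toTypeD (fromRows 0 Y.idm) = fromRows f 0 :=
    (diff_from_cone ..).trans (by rw [diff_idm, map_zero, mul_idm hf.1, zero_add])
  have h3 : fromRows (0 : Matrix X.gen Y.gen A.carrier) Y.idm * coneIncl f hf = fromBlocks 0 0 0 Y.idm := by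
    refine (fromRows_mul_fromCols ..).trans ?_
    rw [Matrix.mul_zero, Matrix.mul_zero, Matrix.zero_mul, idm_mul_idm]
  have h4 : rotV f hf * rotU f hf
      = fromBlocks 0 0 (fromRows f 0) (fromBlocks X.idm 0 0 0) := by
    refine (fromRows_mul_fromCols ..).trans ?_
    rw [Matrix.zero_mul, Matrix.zero_mul]
    refine congrArg₂ (fromBlocks 0 0) ?_ ?_
    · refine (fromRows_mul ..).trans ?_
      rw [Matrix.zero_mul, idm_mul hf.1]
    · refine (fromRows_mul_fromCols ..).trans ?_
      rw [Matrix.mul_zero, Matrix.zero_mul, Matrix.zero_mul, idm_mul_idm]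
  rw [h4, idm_cone, idm_cone]
  refine Eq.trans ?_ (fromBlocks_add ..).symm
  refine congr (congr (congrArg₂ fromBlocks ?_ ?_) ?_) ?_
  · rw [map_zero]; exact congrArg (0 + ·) h1
  · rw [map_zero, Matrix.mul_zero, Matrix.zero_mul, add_zero]
  · exact h2.trans (add_zero _).symm
  · refine (congrArg₂ (· + ·) (map_zero _) h3).trans ?_
    rw [fromBlocks_add, zero_add, zero_add, zero_add, ZModModule.add_self, zero_add]

/-- `Cone(f)[-1]`. -/
abbrev fib : Db A := (cone f hf).regrade (-1, 0)

theorem fibProj_mem : coneProj f hf ∈ cycles (fib f hf).toTypeD X.toTypeD :=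
  mem_cycles_iff.2 ⟨homSub_regrade_left (Z := TypeD.cone f hf) (W := X.toTypeD) (k := 0) (l := -1)
    (coneProj_mem_homSub f hf), diff_coneProj f hf⟩

/-- The map `Y → Cone(Cone(f)[-1] → X)`. -/
def invV : Matrix Y.gen (cone (X := fib f hf) (coneProj f hf) (fibProj_mem f hf)).gen A.carrier :=
  fromCols (coneIncl f hf) 0

/-- The map `Cone(Cone(f)[-1] → X) → Y`. -/
def invU : Matrix (cone (X := fib f hf) (coneProj f hf) (fibProj_mem f hf)).gen Y.gen A.carrier :=
  fromRows (fromRows 0 Y.idm) f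

theorem invV_mem : invV f hf ∈ cycles Y.toTypeD
    (cone (X := fib f hf) (coneProj f hf) (fibProj_mem f hf)).toTypeD := by
  refine mem_cycles_iff.2 ⟨mem_homSub_to_cone (hf := fibProj_mem f hf) ?_ (zero_mem _), ?_⟩
  · exact homSub_regrade_right (Z := Y.toTypeD) (W := TypeD.cone f hf) (k := 0 + 1) (l := -1)
      (coneIncl_mem f hf).1
  · refine (diff_to_cone (hf := fibProj_mem f hf) ..).trans ?_
    have h1 : coneIncl f hf * coneProj f hf = 0 :=
      (fromCols_mul_fromRows ..).trans (by rw [Matrix.zero_mul, Matrix.mul_zero, add_zero])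
    refine (congrArg₂ fromCols (mem_cycles_iff.1 (coneIncl_mem f hf)).2
      (congrArg₂ (· + ·) (map_zero _) h1)).trans ?_
    rw [add_zero]
    exact fromCols_zero

theorem invU_mem : invU f hf ∈ cycles
    (cone (X := fib f hf) (coneProj f hf) (fibProj_mem f hf)).toTypeD Y.toTypeD := by
  have h2 : fromRows (0 : Matrix X.gen Y.gen A.carrier) Y.idm ∈
      homSub (TypeD.cone f hf) Y.toTypeD 0 :=
    mem_homSub_from_cone (zero_mem _) Y.idm_mem_homSub
  refine mem_cycles_iff.2 ⟨mem_homSub_from_cone (hf := fibProj_mem f hf) ?_ hf.1, ?_⟩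
  · exact homSub_regrade_left (Z := TypeD.cone f hf) (W := Y.toTypeD) (k := 0 - 1) (l := -1) h2
  · refine (diff_from_cone (hf := fibProj_mem f hf) ..).trans ?_
    have h1 : coneProj f hf * f = fromRows f 0 :=
      (fromRows_mul ..).trans (by rw [Matrix.zero_mul, idm_mul hf.1])
    have h3 : diff (TypeD.cone f hf) Y.toTypeD (fromRows 0 Y.idm) = fromRows f 0 :=
      (diff_from_cone ..).trans (by rw [diff_idm, map_zero, mul_idm hf.1, zero_add])
    refine (congrArg₂ fromRows (congrArg₂ (· + ·) h3 h1) (mem_cycles_iff.1 hf).2).trans ?_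
    rw [ZModModule.add_self]
    exact fromRows_zero

theorem invV_mul_invU : invV f hf * invU f hf = Y.idm := by
  refine (fromCols_mul_fromRows ..).trans ?_
  rw [Matrix.zero_mul, add_zero]
  refine (fromCols_mul_fromRows ..).trans ?_
  rw [Matrix.mul_zero, zero_add, idm_mul_idm]

theorem invU_mul_invV : ∃ h ∈ homSub
    (cone (X := fib f hf) (coneProj f hf) (fibProj_mem f hf)).toTypeD
    (cone (X := fib f hf) (coneProj f hf) (fibProj_mem f hf)).toTypeD (-1),
    diff _ _ h = invU f hf * invV f hf +
      (cone (X := fib f hf) (coneProj f hf) (fibProj_mem f hf)).toTypeD.idm := by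
  have h0 : fromCols X.idm (0 : Matrix X.gen Y.gen A.carrier) ∈
      homSub X.toTypeD (TypeD.cone f hf) (-1) :=
    mem_homSub_to_cone X.idm_mem_homSub (zero_mem _)
  refine ⟨fromBlocks 0 0 (fromCols X.idm 0) 0,
    mem_homSub_cone_cone (hf := fibProj_mem f hf) (hg := fibProj_mem f hf) (zero_mem _) (zero_mem _)
      (homSub_regrade_right (Z := X.toTypeD) (W := TypeD.cone f hf) (k := -1 + 1) (l := -1) h0)
      (zero_mem _), ?_⟩
  refine (diff_cone_cone (hf := fibProj_mem f hf) (hg := fibProj_mem f hf) ..).trans ?_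
  have h1 : coneProj f hf * fromCols X.idm (0 : Matrix X.gen Y.gen A.carrier)
      = fromBlocks X.idm 0 0 0 := by
    refine (fromRows_mul_fromCols ..).trans ?_
    rw [Matrix.zero_mul, Matrix.zero_mul, Matrix.mul_zero, idm_mul_idm]
  have h2 : diff X.toTypeD (TypeD.cone f hf) (fromCols X.idm 0) = fromCols 0 f :=
    (diff_to_cone ..).trans (by rw [diff_idm, map_zero, idm_mul hf.1, zero_add])
  have h3 : fromCols X.idm (0 : Matrix X.gen Y.gen A.carrier) * coneProj f hf = X.idm :=
    (fromCols_mul_fromRows ..).trans (by rw [Matrix.mul_zero, add_zero, idm_mul_idm])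
  have h4 : invU f hf * invV f hf
      = fromBlocks (fromBlocks 0 0 0 Y.idm) 0 (fromCols 0 f) 0 := by
    refine (fromRows_mul_fromCols ..).trans ?_
    rw [Matrix.mul_zero, Matrix.mul_zero]
    refine congrArg₂ (fromBlocks · 0 · 0) ?_ ?_
    · refine (fromRows_mul_fromCols ..).trans ?_
      rw [Matrix.mul_zero, Matrix.mul_zero, Matrix.zero_mul, idm_mul_idm]
    · refine (mul_fromCols ..).trans ?_
      rw [Matrix.mul_zero, mul_idm hf.1]
  have h5 : (fib f hf).toTypeD.idm = fromBlocks X.idm 0 0 Y.idm := idm_cone (hf := hf)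
  have h6 : (cone (X := fib f hf) (coneProj f hf) (fibProj_mem f hf)).toTypeD.idm
      = fromBlocks (fromBlocks X.idm 0 0 Y.idm) 0 0 X.idm :=
    (idm_cone (hf := fibProj_mem f hf)).trans
      (congrArg (fromBlocks · 0 0 X.idm) h5)
  rw [h4]
  refine Eq.trans ?_ (congrArg (_ + ·) h6.symm)
  refine Eq.trans ?_ (fromBlocks_add ..).symm
  refine congr (congr (congrArg₂ fromBlocks ?_ ?_) ?_) ?_
  · rw [map_zero, fromBlocks_add, add_zero, add_zero, zero_add, ZModModule.add_self, zero_add]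
    exact h1
  · rw [map_zero, Matrix.mul_zero, Matrix.zero_mul, add_zero]
  · exact h2.trans (add_zero _).symm
  · exact congrArg₂ (· + ·) (map_zero _) h3

end Db

namespace Db
open TypeD
variable {A : BigradedDGAlgebra}

/-- An isomorphism of a triangle with a rotated triangle, from its components. -/
def isoRotate {C : Type 1} [Category.{0} C] [Preadditive C] [HasShift C ℤ] {X Y Z W V : C}
    {f : X ⟶ Y} {g : Y ⟶ Z} {h : Z ⟶ X⟦(1 : ℤ)⟧} {f' : W ⟶ X} {g' : X ⟶ V} {h' : V ⟶ W⟦(1 : ℤ)⟧}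
    (u : Y ≅ V) (v : Z ≅ W⟦(1 : ℤ)⟧) (h₁ : f ≫ u.hom = g') (h₂ : g ≫ v.hom = u.hom ≫ h')
    (h₃ : h = v.hom ≫ (-f'⟦(1 : ℤ)⟧')) : Triangle.mk f g h ≅ (Triangle.mk f' g' h').rotate :=
  Triangle.isoMk _ _ (Iso.refl _) u v
    (h₁.trans (Category.id_comp _).symm) h₂
    ((congrArg (h ≫ ·) (CategoryTheory.Functor.map_id _ _)).trans ((Category.comp_id h).trans h₃))

theorem idm_mem_unshift (W : TypeD A) :
    W.idm ∈ cycles ((W.regrade (-1, 0)).regrade (1, 0)) W ∧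
    W.idm ∈ cycles W ((W.regrade (-1, 0)).regrade (1, 0)) := by
  constructor
  · refine mem_cycles_iff.2 ⟨?_, W.diff_idm⟩
    exact idm_mem_of_deg
      (g := fun x y => W.deg x - (-1, 0) - (1, 0) + (0, 0) - W.deg y)
      fun x => by simp [sub_sub]
  · refine mem_cycles_iff.2 ⟨?_, W.diff_idm⟩
    exact idm_mem_of_deg
      (g := fun x y => W.deg x + (0, 0) - (W.deg y - (-1, 0) - (1, 0)))
      fun x => by simp [sub_sub]

/-- `W[-1][1]` is `W`. -/
def unshiftIso (W : Db A) : W ≅ (W.regrade (-1, 0))⟦(1 : ℤ)⟧ where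
  hom := mor (Y := (W.regrade (-1, 0)).regrade (1, 0)) W.idm (idm_mem_unshift W.toTypeD).2
  inv := mor (X := (W.regrade (-1, 0)).regrade (1, 0)) W.idm (idm_mem_unshift W.toTypeD).1
  hom_inv_id := mor_congr W.idm_mul_idm
  inv_hom_id := mor_congr W.idm_mul_idm

theorem shift_map_mor {X Y : Db A} {f : Matrix X.gen Y.gen A.carrier}
    (hf : f ∈ cycles X.toTypeD Y.toTypeD) : (mor f hf)⟦(1 : ℤ)⟧' =
      mor (X := X.regrade (1, 0)) (Y := Y.regrade (1, 0)) f (mem_regrade (1, 0) hf) := rfl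

theorem unshiftIso_comp (W X : Db A) (q : Matrix W.gen X.gen A.carrier)
    (hq : q ∈ cycles (W.regrade (-1, 0)).toTypeD X.toTypeD)
    (hq' : q ∈ cycles W.toTypeD (X.regrade (1, 0)).toTypeD) :
    (unshiftIso W).hom ≫ (mor (X := W.regrade (-1, 0)) q hq)⟦(1 : ℤ)⟧' =
      mor (Y := X.regrade (1, 0)) q hq' :=
  (congrArg ((unshiftIso W).hom ≫ ·) (shift_map_mor hq)).trans
    (mor_congr (Y := X.regrade (1, 0)) (idm_mul hq'.1))

section
variable {X Y : Db A} (f : Matrix X.gen Y.gen A.carrier)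
  (hf : f ∈ cycles X.toTypeD Y.toTypeD)

/-- `X[1]` is the cone of `Y → Cone(f)`. -/
def rotIso : X⟦(1 : ℤ)⟧ ≅ cone (Y := cone f hf) (coneIncl f hf) (coneIncl_mem f hf) where
  hom := mor (X := X.regrade (1, 0))
    (Y := cone (Y := cone f hf) (coneIncl f hf) (coneIncl_mem f hf)) (rotU f hf) (rotU_mem f hf)
  inv := mor (Y := X.regrade (1, 0))
    (X := cone (Y := cone f hf) (coneIncl f hf) (coneIncl_mem f hf)) (rotV f hf) (rotV_mem f hf)
  hom_inv_id := mor_congr (rotU_mul_rotV f hf)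
  inv_hom_id := mor_eq_iff.2 (rotV_mul_rotU f hf)

/-- `Y` is the cone of `Cone(f)[-1] → X`. -/
def invIso : Y ≅ cone (X := fib f hf) (coneProj f hf) (fibProj_mem f hf) where
  hom := mor (invV f hf) (invV_mem f hf)
  inv := mor (invU f hf) (invU_mem f hf)
  hom_inv_id := mor_congr (invV_mul_invU f hf)
  inv_hom_id := mor_eq_iff.2 (invU_mul_invV f hf)

theorem incl_rotIso : incl (Y := cone f hf) (coneIncl f hf) (coneIncl_mem f hf) ≫
    (rotIso f hf).inv = proj f hf := by
  refine mor_congr ?_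
  refine (fromCols_mul_fromRows ..).trans ?_
  rw [Matrix.zero_mul, zero_add]
  exact idm_mul (coneProj_mem_homSub f hf)

theorem rotIso_proj : (rotIso f hf).hom ≫
    proj (Y := cone f hf) (coneIncl f hf) (coneIncl_mem f hf) = (mor f hf)⟦(1 : ℤ)⟧' := by
  refine mor_congr ?_
  refine (fromCols_mul_fromRows ..).trans ?_
  rw [Matrix.mul_zero, add_zero]
  exact mul_idm hf.1

/-- The rotation of the standard triangle of `f` is the standard triangle of `Y → Cone(f)`. -/
def rotateIso : (standardTriangle f hf).rotate ≅
    standardTriangle (Y := cone f hf) (coneIncl f hf) (coneIncl_mem f hf) :=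
  Triangle.isoMk _ _ (Iso.refl _) (Iso.refl _) (rotIso f hf)
    (by exact (Category.comp_id _).trans (Category.id_comp _).symm)
    (by
      refine Eq.trans ?_ (Category.id_comp _).symm
      exact ((Iso.eq_comp_inv _).1 (incl_rotIso f hf).symm))
    (by
      refine Eq.trans ?_ (rotIso_proj f hf).symm
      refine (congrArg (_ ≫ ·) (CategoryTheory.Functor.map_id _ _)).trans ((Category.comp_id _).trans ?_)
      exact neg_eq _)

/-- `Cone(f)[-1][1]` is `Cone(f)`. -/
def fibIso : cone f hf ≅ (fib f hf)⟦(1 : ℤ)⟧ := unshiftIso (cone f hf)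

theorem incl_invIso : incl (X := fib f hf) (coneProj f hf) (fibProj_mem f hf) ≫
    (invIso f hf).inv = mor f hf := by
  refine mor_congr ?_
  refine (fromCols_mul_fromRows ..).trans ?_
  rw [Matrix.zero_mul, zero_add]
  exact idm_mul hf.1

theorem invIso_proj : (invIso f hf).hom ≫ proj (X := fib f hf) (coneProj f hf)
    (fibProj_mem f hf) = incl f hf ≫ (fibIso f hf).hom := by
  refine mor_congr ?_
  refine (fromCols_mul_fromRows ..).trans ?_
  rw [Matrix.mul_zero, add_zero]
  rfl

theorem fibIso_proj : (fibIso f hf).hom ≫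
    (mor (X := fib f hf) (coneProj f hf) (fibProj_mem f hf))⟦(1 : ℤ)⟧' = proj f hf :=
  unshiftIso_comp (cone f hf) X (coneProj f hf) (fibProj_mem f hf) (coneProj_mem f hf)

/-- The standard triangle of `f` is the rotation of that of `Cone(f)[-1] → X`. -/
def invRotateIso : standardTriangle f hf ≅
    (standardTriangle (X := fib f hf) (coneProj f hf) (fibProj_mem f hf)).rotate :=
  isoRotate (invIso f hf) (fibIso f hf)
    ((Iso.eq_comp_inv _).1 (incl_invIso f hf).symm)
    (invIso_proj f hf).symm
    ((fibIso_proj f hf).symm.trans (congrArg (_ ≫ ·) (neg_eq _).symm))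

end

theorem isZero_cone_idm (X : Db A) : IsZero (cone (X := X) (Y := X) X.idm X.idm_mem_cycles) := by
  rw [IsZero.iff_id_eq_zero]
  refine mor_eq_iff.2 ⟨fromBlocks 0 0 X.idm 0,
    mem_homSub_cone_cone (hf := X.idm_mem_cycles) (hg := X.idm_mem_cycles)
      (zero_mem _) (zero_mem _) X.idm_mem_homSub (zero_mem _), ?_⟩
  refine (diff_cone_cone (hf := X.idm_mem_cycles) (hg := X.idm_mem_cycles) ..).trans ?_
  rw [map_zero, idm_cone (hf := X.idm_mem_cycles), diff_idm, Matrix.zero_mul, Matrix.mul_zero, idm_mul_idm,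
    add_zero, zero_add, zero_add, add_zero]

/-- The distinguished triangles: those isomorphic to a standard triangle. -/
def distTriangles (A : BigradedDGAlgebra) : Set (Triangle (Db A)) :=
  {T | ∃ (X Y : Db A) (f : Matrix X.gen Y.gen A.carrier)
    (hf : f ∈ cycles X.toTypeD Y.toTypeD), Nonempty (T ≅ standardTriangle f hf)}

theorem complete_standard {X Y X' Y' : Db A} {f : Matrix X.gen Y.gen A.carrier}
    (hf : f ∈ cycles X.toTypeD Y.toTypeD) {g : Matrix X'.gen Y'.gen A.carrier}
    (hg : g ∈ cycles X'.toTypeD Y'.toTypeD) (α : X ⟶ X') (β : Y ⟶ Y')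
    (h : mor f hf ≫ β = α ≫ mor g hg) :
    ∃ γ : cone f hf ⟶ cone g hg, incl f hf ≫ γ = β ≫ incl g hg ∧
      proj f hf ≫ α⟦(1 : ℤ)⟧' = γ ≫ proj g hg := by
  obtain ⟨a, ha, rfl⟩ := exists_mor α
  obtain ⟨b, hb, rfl⟩ := exists_mor β
  obtain ⟨k, hk, e⟩ := mor_eq_iff.1 h
  have hc : fromBlocks a k 0 b ∈ cycles (cone f hf).toTypeD (cone g hg).toTypeD := by
    refine mem_cycles_iff.2 ⟨mem_homSub_cone_cone (hf := hf) (hg := hg) ha.1 hk (zero_mem _) hb.1, ?_⟩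
    refine (diff_cone_cone (hf := hf) (hg := hg) ..).trans ?_
    have h1 : diff X.toTypeD Y'.toTypeD k + a * g + f * b = 0 := by
      rw [e, add_assoc, add_comm (a * g), ZModModule.add_self]
    rw [h1, (mem_cycles_iff.1 ha).2, (mem_cycles_iff.1 hb).2, map_zero, Matrix.mul_zero,
      Matrix.zero_mul, add_zero, add_zero, fromBlocks_zero]
  have h2 : coneIncl f hf * fromBlocks a k 0 b = b * coneIncl g hg := by
    refine (fromCols_mul_fromBlocks ..).trans ?_
    refine Eq.trans ?_ (mul_fromCols ..).symm
    rw [Matrix.zero_mul, Matrix.zero_mul, Matrix.mul_zero, Matrix.mul_zero, zero_add, zero_add,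
      idm_mul hb.1, mul_idm hb.1]
  have h3 : coneProj f hf * a = fromBlocks a k 0 b * coneProj g hg := by
    refine (fromRows_mul ..).trans ?_
    refine Eq.trans ?_ (fromBlocks_mul_fromRows ..).symm
    rw [Matrix.mul_zero, Matrix.mul_zero, Matrix.zero_mul, Matrix.zero_mul, add_zero, add_zero,
      idm_mul ha.1, mul_idm ha.1]
  refine ⟨mor _ hc, mor_congr h2, ?_⟩
  exact (congrArg (proj f hf ≫ ·) (shift_map_mor ha)).trans
    (mor_congr (X := cone f hf) (Y := X'.regrade (1, 0)) h3)

/-- The completion axiom is invariant under isomorphism of triangles. -/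
theorem complete_of_iso {C : Type 1} [Category.{0} C] [HasShift C ℤ] {T₁ T₂ S₁ S₂ : Triangle C}
    (e : T₁ ≅ S₁) (e' : T₂ ≅ S₂)
    (H : ∀ (a : S₁.obj₁ ⟶ S₂.obj₁) (b : S₁.obj₂ ⟶ S₂.obj₂), S₁.mor₁ ≫ b = a ≫ S₂.mor₁ →
      ∃ c : S₁.obj₃ ⟶ S₂.obj₃, S₁.mor₂ ≫ c = b ≫ S₂.mor₂ ∧
        S₁.mor₃ ≫ a⟦(1 : ℤ)⟧' = c ≫ S₂.mor₃)
    (a : T₁.obj₁ ⟶ T₂.obj₁) (b : T₁.obj₂ ⟶ T₂.obj₂) (h : T₁.mor₁ ≫ b = a ≫ T₂.mor₁) :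
    ∃ c : T₁.obj₃ ⟶ T₂.obj₃, T₁.mor₂ ≫ c = b ≫ T₂.mor₂ ∧
      T₁.mor₃ ≫ a⟦(1 : ℤ)⟧' = c ≫ T₂.mor₃ := by
  obtain ⟨c, hc, hc'⟩ := H (e.inv.hom₁ ≫ a ≫ e'.hom.hom₁) (e.inv.hom₂ ≫ b ≫ e'.hom.hom₂) (by
    rw [← Category.assoc, e.inv.comm₁, Category.assoc, ← Category.assoc T₁.mor₁, h,
      Category.assoc, e'.hom.comm₁]
    simp only [Category.assoc])
  refine ⟨e.hom.hom₃ ≫ c ≫ e'.inv.hom₃, ?_, ?_⟩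
  · rw [← Category.assoc, e.hom.comm₂, Category.assoc, ← Category.assoc S₁.mor₂, hc]
    simp only [Category.assoc]
    rw [e'.inv.comm₂, ← Category.assoc e.hom.hom₂, e.hom_inv_id_triangle_hom₂, Category.id_comp,
      ← Category.assoc e'.hom.hom₂, e'.hom_inv_id_triangle_hom₂, Category.id_comp]
  · have w1 : a = e.hom.hom₁ ≫ (e.inv.hom₁ ≫ a ≫ e'.hom.hom₁) ≫ e'.inv.hom₁ := by
      simp only [Category.assoc]
      rw [e'.hom_inv_id_triangle_hom₁, Category.comp_id, ← Category.assoc,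
        e.hom_inv_id_triangle_hom₁, Category.id_comp]
    rw [w1, Functor.map_comp, Functor.map_comp _ _ e'.inv.hom₁, ← Category.assoc, e.hom.comm₃,
      Category.assoc, ← Category.assoc S₁.mor₃, hc']
    simp only [Category.assoc]
    rw [← e'.inv.comm₃]

theorem complete_distTriangles (T₁ T₂ : Triangle (Db A)) (h₁ : T₁ ∈ distTriangles A)
    (h₂ : T₂ ∈ distTriangles A) (a : T₁.obj₁ ⟶ T₂.obj₁) (b : T₁.obj₂ ⟶ T₂.obj₂)
    (h : T₁.mor₁ ≫ b = a ≫ T₂.mor₁) :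
    ∃ c : T₁.obj₃ ⟶ T₂.obj₃, T₁.mor₂ ≫ c = b ≫ T₂.mor₂ ∧
      T₁.mor₃ ≫ a⟦(1 : ℤ)⟧' = c ≫ T₂.mor₃ := by
  obtain ⟨X, Y, f, hf, ⟨e⟩⟩ := h₁
  obtain ⟨X', Y', g, hg, ⟨e'⟩⟩ := h₂
  exact complete_of_iso e e' (fun a b => complete_standard hf hg a b) a b h

/-- The triangulated structure of `D^b(A)`: the distinguished triangles are those isomorphic to
`X → Y → Cone(f) → X[1]` for some `f`. -/
instance : Pretriangulated (Db A) where
  distinguishedTriangles := distTriangles A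
  isomorphic_distinguished := by
    rintro T₁ ⟨X, Y, f, hf, ⟨e⟩⟩ T₂ e'
    exact ⟨X, Y, f, hf, ⟨e' ≪≫ e⟩⟩
  contractible_distinguished X := by
    refine ⟨X, X, X.idm, X.idm_mem_cycles, ⟨?_⟩⟩
    refine Triangle.isoMk _ _ (Iso.refl _) (Iso.refl _)
      ((Limits.isZero_zero (Db A)).iso (isZero_cone_idm X)) ?_ ?_ ?_
    · rfl
    · exact (isZero_cone_idm X).eq_of_tgt _ _
    · exact (Limits.isZero_zero (Db A)).eq_of_src _ _
  distinguished_cocone_triangle φ := by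
    obtain ⟨f, hf, rfl⟩ := exists_mor φ
    exact ⟨cone f hf, incl f hf, proj f hf, _, _, f, hf, ⟨Iso.refl _⟩⟩
  rotate_distinguished_triangle T := by
    constructor
    · rintro ⟨X, Y, f, hf, ⟨e⟩⟩
      exact ⟨_, _, _, _, ⟨(rotate (Db A)).mapIso e ≪≫ rotateIso f hf⟩⟩
    · rintro ⟨X, Y, f, hf, ⟨e⟩⟩
      exact ⟨_, _, _, _, ⟨(rotate (Db A)).preimageIso (e ≪≫ invRotateIso f hf)⟩⟩
  complete_distinguished_triangle_morphism := complete_distTriangles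

end Db

section
variable (C : Type 1) [Category.{0} C] [HasZeroObject C] [HasShift C ℤ] [Preadditive C]
  [∀ n : ℤ, (shiftFunctor C n).Additive] [Pretriangulated C]

/-- The subgroup generated by `[X] + [Z] - [Y]` for the distinguished triangles `X → Y → Z → X[1]`. -/
def K0Rel : AddSubgroup (FreeAbelianGroup (Quotient (isIsomorphicSetoid C))) :=
  AddSubgroup.closure {a | ∃ T ∈ distTriang C,
    a = FreeAbelianGroup.of ⟦T.obj₁⟧ + FreeAbelianGroup.of ⟦T.obj₃⟧ - FreeAbelianGroup.of ⟦T.obj₂⟧}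

/-- The Grothendieck group: the free abelian group on the isomorphism classes of objects, modulo
`[X] + [Z] = [Y]` for every distinguished triangle `X → Y → Z → X[1]`. -/
def K0 : Type 1 := FreeAbelianGroup (Quotient (isIsomorphicSetoid C)) ⧸ K0Rel C

instance : AddCommGroup (K0 C) :=
  inferInstanceAs (AddCommGroup (FreeAbelianGroup (Quotient (isIsomorphicSetoid C)) ⧸ K0Rel C))

variable {C}

/-- The class `[X]` of an object. -/
def K0.mk (X : C) : K0 C := QuotientAddGroup.mk (FreeAbelianGroup.of ⟦X⟧)

theorem K0.mk_eq_of_iso {X Y : C} (e : X ≅ Y) : K0.mk X = K0.mk Y := by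
  unfold K0.mk
  rw [Quotient.sound (s := isIsomorphicSetoid C) ⟨e⟩]

theorem K0.mk_triangle {T : Triangle C} (hT : T ∈ distTriang C) :
    K0.mk T.obj₁ + K0.mk T.obj₃ = K0.mk T.obj₂ := by
  have h := (QuotientAddGroup.eq_zero_iff _).2
    (AddSubgroup.subset_closure (show _ ∈ {a | ∃ T ∈ distTriang C, a =
      FreeAbelianGroup.of (⟦T.obj₁⟧ : Quotient (isIsomorphicSetoid C)) +
        FreeAbelianGroup.of ⟦T.obj₃⟧ - FreeAbelianGroup.of ⟦T.obj₂⟧} from ⟨T, hT, rfl⟩))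
  exact sub_eq_zero.1 h

theorem K0.hom_ext {M : Type*} [AddCommGroup M] {f g : K0 C →+ M}
    (h : ∀ X : C, f (K0.mk X) = g (K0.mk X)) : f = g := by
  refine QuotientAddGroup.addMonoidHom_ext _ (FreeAbelianGroup.lift_ext _ _ ?_)
  rintro ⟨X⟩
  exact h X

/-- The homomorphism given by a function that is additive on distinguished triangles. -/
def K0.lift {M : Type*} [AddCommGroup M] (φ : C → M) (hφ : ∀ {X Y : C}, (X ≅ Y) → φ X = φ Y)
    (hT : ∀ T ∈ distTriang C, φ T.obj₁ + φ T.obj₃ = φ T.obj₂) : K0 C →+ M :=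
  QuotientAddGroup.lift (K0Rel C)
    (FreeAbelianGroup.lift (Quotient.lift φ fun _ _ ⟨e⟩ => hφ e)) (by
      refine (AddSubgroup.closure_le _).2 ?_
      rintro _ ⟨T, h, rfl⟩
      refine AddMonoidHom.mem_ker.2 ?_
      rw [map_sub, map_add, FreeAbelianGroup.lift_apply_of, FreeAbelianGroup.lift_apply_of,
        FreeAbelianGroup.lift_apply_of]
      exact sub_eq_zero.2 (hT T h))

theorem K0.lift_mk {M : Type*} [AddCommGroup M] (φ : C → M)
    (hφ : ∀ {X Y : C}, (X ≅ Y) → φ X = φ Y)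
    (hT : ∀ T ∈ distTriang C, φ T.obj₁ + φ T.obj₃ = φ T.obj₂) (X : C) :
    K0.lift φ hφ hT (K0.mk X) = φ X :=
  FreeAbelianGroup.lift_apply_of _ _

end

namespace Db
open TypeD
variable {A : BigradedDGAlgebra}

theorem regrade_cone_idm {X Y : Db A} {f : Matrix X.gen Y.gen A.carrier}
    (hf : f ∈ cycles X.toTypeD Y.toTypeD) (s : ℤ × ℤ) :
    (TypeD.cone f hf).idm ∈ cycles ((cone f hf).regrade s).toTypeD
      (cone (X := X.regrade s) (Y := Y.regrade s) f (mem_regrade s hf)).toTypeD ∧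
    (TypeD.cone f hf).idm ∈ cycles
      (cone (X := X.regrade s) (Y := Y.regrade s) f (mem_regrade s hf)).toTypeD
      ((cone f hf).regrade s).toTypeD := by
  constructor
  · refine mem_cycles_iff.2 ⟨?_, (TypeD.cone f hf).diff_idm⟩
    exact idm_mem_of_deg (X := TypeD.cone f hf)
      (g := fun x y => (TypeD.cone f hf).deg x - s + (0, 0) -
        Sum.elim (fun x => X.deg x - s - (1, 0)) (fun y => Y.deg y - s) y)
      (by
        rintro (x | x)
        · simp only [Sum.elim_inl, Prod.mk_zero_zero]; abel
        · simp)
  · refine mem_cycles_iff.2 ⟨?_, (TypeD.cone f hf).diff_idm⟩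
    exact idm_mem_of_deg (X := TypeD.cone f hf)
      (g := fun x y => Sum.elim (fun x => X.deg x - s - (1, 0)) (fun y => Y.deg y - s) x + (0, 0) -
        ((TypeD.cone f hf).deg y - s))
      (by
        rintro (x | x)
        · simp only [Sum.elim_inl, Prod.mk_zero_zero]; abel
        · simp)

/-- Shifts commute with cones. -/
def regradeConeIso {X Y : Db A} {f : Matrix X.gen Y.gen A.carrier}
    (hf : f ∈ cycles X.toTypeD Y.toTypeD) (s : ℤ × ℤ) : (cone f hf).regrade s ≅
      cone (X := X.regrade s) (Y := Y.regrade s) f (mem_regrade s hf) where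
  hom := mor (X := (cone f hf).regrade s)
    (Y := cone (X := X.regrade s) (Y := Y.regrade s) f (mem_regrade s hf))
    (TypeD.cone f hf).idm (regrade_cone_idm hf s).1
  inv := mor (Y := (cone f hf).regrade s)
    (X := cone (X := X.regrade s) (Y := Y.regrade s) f (mem_regrade s hf))
    (TypeD.cone f hf).idm (regrade_cone_idm hf s).2
  hom_inv_id := mor_congr (TypeD.cone f hf).idm_mul_idm
  inv_hom_id := mor_congr (TypeD.cone f hf).idm_mul_idm

theorem K0_mk_cone {X Y : Db A} {f : Matrix X.gen Y.gen A.carrier}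
    (hf : f ∈ cycles X.toTypeD Y.toTypeD) : K0.mk X + K0.mk (cone f hf) = K0.mk Y :=
  K0.mk_triangle (T := standardTriangle f hf) ⟨X, Y, f, hf, ⟨Iso.refl _⟩⟩

/-- The endomorphism `[X] ↦ [X lowered by s]` of `K₀`. -/
def K0Regrade (s : ℤ × ℤ) : K0 (Db A) →+ K0 (Db A) :=
  K0.lift (fun X => K0.mk (X.regrade s))
    (fun e => K0.mk_eq_of_iso ((regradeFunctor s).mapIso e)) (by
      rintro T ⟨X, Y, f, hf, ⟨e⟩⟩
      have h1 := K0.mk_eq_of_iso ((regradeFunctor s).mapIso (Triangle.π₁.mapIso e))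
      have h2 := K0.mk_eq_of_iso ((regradeFunctor s).mapIso (Triangle.π₂.mapIso e))
      have h3 := K0.mk_eq_of_iso ((regradeFunctor s).mapIso (Triangle.π₃.mapIso e))
      have h4 := K0_mk_cone (X := X.regrade s) (Y := Y.regrade s) (mem_regrade s hf)
      rw [← K0.mk_eq_of_iso (regradeConeIso hf s)] at h4
      exact (congrArg₂ (· + ·) h1 h3).trans (h4.trans h2.symm))

theorem K0Regrade_mk (s : ℤ × ℤ) (X : Db A) : K0Regrade s (K0.mk X) = K0.mk (X.regrade s) :=
  FreeAbelianGroup.lift_apply_of _ _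

theorem K0Regrade_zero : K0Regrade (A := A) 0 = AddMonoidHom.id _ :=
  K0.hom_ext fun X => (K0Regrade_mk 0 X).trans (K0.mk_eq_of_iso (regradeZero.app X))

theorem K0Regrade_add (s t : ℤ × ℤ) :
    K0Regrade (A := A) (s + t) = (K0Regrade t).comp (K0Regrade s) :=
  K0.hom_ext fun X => (K0Regrade_mk _ X).trans
    ((K0.mk_eq_of_iso ((regradeAdd rfl).app X)).trans
      ((congrArg (K0Regrade t) (K0Regrade_mk s X)).trans (K0Regrade_mk t _)).symm)

/-- The action of `T ^ j`, where `T = t^{1/2}`: `T ^ j • [X]` is the class of `X` with intrinsic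
degrees raised by `j/2`. -/
def K0Action : Multiplicative ℤ →* Module.End ℤ (K0 (Db A)) where
  toFun j := (K0Regrade (0, -j.toAdd)).toIntLinearMap
  map_one' := by
    ext a
    exact DFunLike.congr_fun K0Regrade_zero a
  map_mul' i j := by
    ext a
    have h : ((0, -(i * j).toAdd) : ℤ × ℤ) = (0, -j.toAdd) + (0, -i.toAdd) := by
      simp [add_comm]
    have := DFunLike.congr_fun (K0Regrade_add (A := A) (0, -j.toAdd) (0, -i.toAdd)) a
    rw [← h] at this
    exact this

/-- The module structure of `K₀(D^b(A))` over `ℤ[t^{±1/2}]`, the Laurent polynomials in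
`T 1 = t^{1/2}`: `t^{±1/2} [X]` is the class of `X` with intrinsic degrees raised by `±1/2`. -/
instance : Module (LaurentPolynomial ℤ) (K0 (Db A)) :=
  Module.compHom (K0 (Db A))
    (AddMonoidAlgebra.lift ℤ (Module.End ℤ (K0 (Db A))) ℤ K0Action).toRingHom

theorem T_smul_mk (j : ℤ) (X : Db A) :
    (LaurentPolynomial.T j : LaurentPolynomial ℤ) • K0.mk X = K0.mk (X.regrade (0, -j)) := by
  refine Eq.trans ?_ (K0Regrade_mk (0, -j) X)
  refine (DFunLike.congr_fun (AddMonoidAlgebra.lift_single K0Action j (1 : ℤ)) (K0.mk X)).trans ?_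
  rw [one_smul]
  rfl

end Db

open MvPolynomial in
/-- The monomials occurring in the image of a monomial under a derivation. -/
theorem coeff_mkDerivation_monomial {σ : Type} (f : σ → MvPolynomial σ (ZMod 2))
    (P : (σ →₀ ℕ) → Prop) (s : σ →₀ ℕ)
    (h : ∀ i t, s i ≠ 0 → (f i).coeff t ≠ 0 → P (s - Finsupp.single i 1 + t))
    (c : ZMod 2) (m : σ →₀ ℕ)
    (hm : (mkDerivation (ZMod 2) f (monomial s c)).coeff m ≠ 0) : P m := by
  classical
  rw [mkDerivation_monomial, coeff_smul] at hm
  have hm' := right_ne_zero_of_smul hm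
  rw [Finsupp.sum, coeff_sum] at hm'
  obtain ⟨i, hi, hne⟩ := Finset.exists_ne_zero_of_sum_ne_zero hm'
  rw [smul_eq_mul, coeff_mul] at hne
  obtain ⟨⟨a, b⟩, hab, hne'⟩ := Finset.exists_ne_zero_of_sum_ne_zero hne
  rw [Finset.HasAntidiagonal.mem_antidiagonal] at hab
  subst hab
  have h1 := left_ne_zero_of_mul hne'
  rw [coeff_monomial] at h1
  have h2 : s - Finsupp.single i 1 = a := by
    by_contra hc
    exact h1 (if_neg hc)
  simp only
  rw [← h2]
  exact h i b (Finsupp.mem_support_iff.1 hi) (right_ne_zero_of_mul hne')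

open MvPolynomial in
theorem coeff_mkDerivation {σ : Type} (f : σ → MvPolynomial σ (ZMod 2))
    (P Q : (σ →₀ ℕ) → Prop)
    (h : ∀ s i t, P s → s i ≠ 0 → (f i).coeff t ≠ 0 → Q (s - Finsupp.single i 1 + t))
    (p : MvPolynomial σ (ZMod 2)) (hp : ∀ m, p.coeff m ≠ 0 → P m) (m : σ →₀ ℕ)
    (hm : (mkDerivation (ZMod 2) f p).coeff m ≠ 0) : Q m := by
  rw [← p.support_sum_monomial_coeff, map_sum, coeff_sum] at hm
  obtain ⟨s, hs, hne⟩ := Finset.exists_ne_zero_of_sum_ne_zero hm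
  exact coeff_mkDerivation_monomial f Q s (fun i t => h s i t (hp s (mem_support_iff.1 hs))) _ m hne

namespace OSz

/-- The idempotent states: subsets of the `n + 1` regions `0, …, n`. The strand `i : Fin n`
separates the regions `i.castSucc` and `i.succ`. -/
abbrev State (n : ℕ) : Type := Finset (Fin (n + 1))

/-- The polynomial ring over `𝔽₂` in variables `Sum.inl i`, standing for `U_i^{1/2}`, and
`Sum.inr i`, standing for `C_i` with `i ∈ S`. -/
abbrev Poly (n : ℕ) (S : Finset (Fin n)) : Type :=
  MvPolynomial (Fin n ⊕ {i // i ∈ S}) (ZMod 2)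

variable {n : ℕ} {S : Finset (Fin n)}

/-- `v_i^x`, the number of occupied regions to the right of strand `i`. -/
def vee (x : State n) (i : Fin n) : ℕ := {r ∈ x | i.castSucc < r}.card

/-- `|v_i^x - v_i^y|`, twice the weight `w_i` of the generator from `x` to `y`. -/
def dist (x y : State n) (i : Fin n) : ℕ := ((vee x i : ℤ) - vee y i).natAbs

theorem dist_self (x : State n) (i : Fin n) : dist x x i = 0 := by simp [dist]

theorem exists_dist (x y z : State n) (i : Fin n) :
    ∃ k, dist x y i + dist y z i = dist x z i + 2 * k := by
  unfold dist
  refine ⟨(((vee x i : ℤ) - vee y i).natAbs + ((vee y i : ℤ) - vee z i).natAbs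
    - ((vee x i : ℤ) - vee z i).natAbs) / 2, ?_⟩
  omega

/-- The monomials that may occur in the entry at `(x, y)`: those in `𝔽₂[U, C]` times
`∏ i, U_i^{w_i}` with `w_i = |v_i^x - v_i^y| / 2`, if `x` and `y` have the same size. -/
def IsAllowed (x y : State n) (m : Fin n ⊕ {i // i ∈ S} →₀ ℕ) : Prop :=
  x.card = y.card ∧ ∀ i, ∃ k, m (Sum.inl i) = dist x y i + 2 * k

theorem IsAllowed.add {x y z : State n} {m m' : Fin n ⊕ {i // i ∈ S} →₀ ℕ}
    (h : IsAllowed x y m) (h' : IsAllowed y z m') : IsAllowed x z (m + m') := by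
  refine ⟨h.1.trans h'.1, fun i => ?_⟩
  obtain ⟨a, ha⟩ := h.2 i
  obtain ⟨b, hb⟩ := h'.2 i
  obtain ⟨c, hc⟩ := exists_dist x y z i
  exact ⟨a + b + c, by rw [Finsupp.add_apply]; omega⟩

variable (n S) in
/-- The algebra `B₀(n, S)` with `C_i` adjoined: the summand `I_x B₀ I_y` is the set of matrices
supported at `(x, y)`, and is free of rank one over `𝔽₂[U, C]` if `x` and `y` have the same size,
and zero otherwise. -/
def preAlgebra : Subalgebra (ZMod 2) (Matrix (State n) (State n) (Poly n S)) where
  carrier := {M | ∀ x y m, (M x y).coeff m ≠ 0 → IsAllowed x y m}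
  mul_mem' {M N} hM hN x z m h := by
    classical
    rw [Matrix.mul_apply, MvPolynomial.coeff_sum] at h
    obtain ⟨y, -, hy⟩ := Finset.exists_ne_zero_of_sum_ne_zero h
    rw [MvPolynomial.coeff_mul] at hy
    obtain ⟨⟨a, b⟩, hab, hne⟩ := Finset.exists_ne_zero_of_sum_ne_zero hy
    rw [Finset.HasAntidiagonal.mem_antidiagonal] at hab
    subst hab
    exact (hM x y a (left_ne_zero_of_mul hne)).add (hN y z b (right_ne_zero_of_mul hne))
  add_mem' {M N} hM hN x y m h := by
    rw [Matrix.add_apply, MvPolynomial.coeff_add] at h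
    by_cases h' : (M x y).coeff m = 0
    · rw [h', zero_add] at h; exact hN x y m h
    · exact hM x y m h'
  algebraMap_mem' c x y m h := by
    classical
    by_cases hxy : x = y
    · subst hxy
      rw [Matrix.algebraMap_matrix_apply, if_pos rfl, MvPolynomial.algebraMap_eq,
        MvPolynomial.coeff_C] at h
      have : 0 = m := by
        by_contra hc
        exact h (if_neg hc)
      subst this
      exact ⟨rfl, fun i => ⟨0, by simp [dist_self]⟩⟩
    · rw [Matrix.algebraMap_matrix_apply, if_neg hxy] at h
      exact absurd (MvPolynomial.coeff_zero m) h

/-- The bidegrees of the variables: the homological degree, and twice the intrinsic degree. -/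
def bideg : Fin n ⊕ {i // i ∈ S} → ℤ × ℤ
  | Sum.inl i => if i ∈ S then (1, -1) else (0, 1)
  | Sum.inr _ => (1, -2)

variable (n S) in
/-- The derivation with `U_i^{1/2} ↦ 0` and `C_i ↦ U_i`. -/
def polyD : Derivation (ZMod 2) (Poly n S) (Poly n S) :=
  MvPolynomial.mkDerivation (ZMod 2)
    (Sum.elim (fun _ => 0) fun i => MvPolynomial.X (Sum.inl i.1) ^ 2)

theorem polyD_polyD (p : Poly n S) : polyD n S (polyD n S p) = 0 := by
  induction p using MvPolynomial.induction_on with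
  | C a => simp [polyD]
  | add p q hp hq => simp [hp, hq]
  | mul_X p i hp =>
    have h : polyD n S (polyD n S (MvPolynomial.X i)) = 0 := by
      rcases i with i | i
      · simp [polyD]
      · rw [polyD, MvPolynomial.mkDerivation_X, Sum.elim_inr, Derivation.leibniz_pow,
          MvPolynomial.mkDerivation_X]
        simp
    have e (a b : Poly n S) : polyD n S (a * b) = a * polyD n S b + b * polyD n S a :=
      Derivation.leibniz _ a b
    rw [e, map_add, e, e, h, hp, mul_zero, mul_zero, zero_add, zero_add, mul_comm]
    exact ZModModule.add_self _

theorem coeff_polyD {P Q : (Fin n ⊕ {i // i ∈ S} →₀ ℕ) → Prop}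
    (h : ∀ s (i : {i // i ∈ S}), P s → s (Sum.inr i) ≠ 0 →
      Q (s - Finsupp.single (Sum.inr i) 1 + Finsupp.single (Sum.inl i.1) 2))
    (p : Poly n S) (hp : ∀ m, p.coeff m ≠ 0 → P m) (m) (hm : (polyD n S p).coeff m ≠ 0) : Q m := by
  classical
  refine coeff_mkDerivation _ P Q ?_ p hp m hm
  rintro s (i | i) t hs hi ht
  · simp at ht
  · rw [Sum.elim_inr, MvPolynomial.X_pow_eq_monomial, MvPolynomial.coeff_monomial] at ht
    have : Finsupp.single (Sum.inl i.1) 2 = t := by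
      by_contra hc
      exact ht (if_neg hc)
    subst this
    exact h s i hs hi

theorem polyD_homogeneous {p : ℤ × ℤ} {f : Poly n S}
    (hf : MvPolynomial.IsWeightedHomogeneous bideg f p) :
    MvPolynomial.IsWeightedHomogeneous bideg (polyD n S f) (p + (1, 0)) := by
  refine coeff_polyD (P := fun m => Finsupp.weight bideg m = p)
    (Q := fun m => Finsupp.weight bideg m = p + (1, 0)) ?_ f hf
  intro s i hs hi
  obtain ⟨t, rfl⟩ : ∃ t, s = t + Finsupp.single (Sum.inr i) 1 :=
    ⟨s - Finsupp.single (Sum.inr i) 1, (tsub_add_cancel_of_le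
      (Finsupp.single_le_iff.2 (Nat.one_le_iff_ne_zero.2 hi))).symm⟩
  rw [← hs]
  simp only [add_tsub_cancel_right, map_add, Finsupp.weight_single, bideg, i.2, if_true, add_assoc]
  simp

theorem pre_ext {a b : preAlgebra n S} (h : ∀ x y, a.1 x y = b.1 x y) : a = b :=
  Subtype.ext (Matrix.ext h)

/-- The differential on `B₀(n, S)` with `C_i` adjoined. -/
def preD : preAlgebra n S →ₗ[ZMod 2] preAlgebra n S where
  toFun a := ⟨a.1.map (polyD n S), fun x y m h => by
    refine coeff_polyD (P := IsAllowed x y) (Q := IsAllowed x y) ?_ (a.1 x y) (a.2 x y) m h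
    intro s i hs _
    refine ⟨hs.1, fun j => ?_⟩
    obtain ⟨k, hk⟩ := hs.2 j
    by_cases hj : i.1 = j
    · refine ⟨k + 1, ?_⟩
      subst hj
      simp [hk]; ring
    · refine ⟨k, ?_⟩
      simp [hk, hj]⟩
  map_add' a b := by
    exact pre_ext fun x y => map_add (polyD n S) _ _
  map_smul' c a := by
    exact pre_ext fun x y => Derivation.map_smul (polyD n S) c (a.1 x y)

theorem preD_preD (a : preAlgebra n S) : preD (preD a) = 0 := by
  exact pre_ext fun x y => polyD_polyD _

theorem preD_mul (a b : preAlgebra n S) : preD (a * b) = preD a * b + a * preD b := by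
  refine pre_ext fun x y => ?_
  refine Eq.trans (map_sum (polyD n S) _ _) ?_
  refine Eq.trans ?_ Finset.sum_add_distrib
  refine Finset.sum_congr rfl fun z _ => ?_
  rw [Derivation.leibniz, add_comm, smul_eq_mul, smul_eq_mul, mul_comm]
  rfl

/-- The elements all of whose entries are homogeneous of bidegree `p`. -/
def preGr (p : ℤ × ℤ) : Submodule (ZMod 2) (preAlgebra n S) where
  carrier := {a | ∀ x y, MvPolynomial.IsWeightedHomogeneous bideg (a.1 x y) p}
  add_mem' ha hb x y := (MvPolynomial.weightedHomogeneousSubmodule _ _ _).add_mem (ha x y) (hb x y)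
  zero_mem' _ _ := (MvPolynomial.weightedHomogeneousSubmodule (ZMod 2) bideg p).zero_mem
  smul_mem' c _ ha x y :=
    (MvPolynomial.weightedHomogeneousSubmodule _ _ _).smul_mem c (ha x y)

theorem preGr_mul {p q : ℤ × ℤ} {a b : preAlgebra n S} (ha : a ∈ preGr p) (hb : b ∈ preGr q) :
    a * b ∈ preGr (p + q) := fun x z =>
  (MvPolynomial.weightedHomogeneousSubmodule _ _ _).sum_mem fun y _ => (ha x y).mul (hb y z)

theorem preGr_d {p : ℤ × ℤ} {a : preAlgebra n S} (ha : a ∈ preGr p) :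
    preD a ∈ preGr (p + (1, 0)) := fun x y => polyD_homogeneous (ha x y)

/-- The projection to bidegree `p`. -/
def preProj (p : ℤ × ℤ) : preAlgebra n S →ₗ[ZMod 2] preAlgebra n S where
  toFun a := ⟨a.1.map (MvPolynomial.weightedHomogeneousComponent bideg p), fun x y m h => by
    classical
    refine a.2 x y m fun h' => h ?_
    rw [Matrix.map_apply, MvPolynomial.coeff_weightedHomogeneousComponent, h', ite_self]⟩
  map_add' a b := by
    exact pre_ext fun x y => map_add (MvPolynomial.weightedHomogeneousComponent bideg p) _ _
  map_smul' c a := by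
    exact pre_ext fun x y => map_smul (MvPolynomial.weightedHomogeneousComponent bideg p) c (a.1 x y)

theorem preProj_mem (p : ℤ × ℤ) (a : preAlgebra n S) : preProj p a ∈ preGr p := fun x y =>
  MvPolynomial.weightedHomogeneousComponent_isWeightedHomogeneous p (a.1 x y)

theorem preProj_same {p : ℤ × ℤ} {a : preAlgebra n S} (ha : a ∈ preGr p) : preProj p a = a := by
  refine pre_ext fun x y => ?_
  exact (ha x y).weightedHomogeneousComponent_same

theorem preProj_ne {p q : ℤ × ℤ} (hpq : p ≠ q) {a : preAlgebra n S} (ha : a ∈ preGr q) :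
    preProj p a = 0 := by
  refine pre_ext fun x y => ?_
  exact (ha x y).weightedHomogeneousComponent_ne p hpq

theorem exists_sum_preProj (a : preAlgebra n S) : ∃ s : Finset (ℤ × ℤ), a = ∑ p ∈ s, preProj p a := by
  classical
  refine ⟨Finset.univ.biUnion fun xy : State n × State n =>
    (a.1 xy.1 xy.2).support.image (Finsupp.weight bideg), ?_⟩
  apply Subtype.ext
  rw [AddSubmonoidClass.coe_finsetSum]
  ext x y m
  rw [Matrix.sum_apply, MvPolynomial.coeff_sum]
  simp only [preProj, LinearMap.coe_mk, AddHom.coe_mk, Matrix.map_apply,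
    MvPolynomial.coeff_weightedHomogeneousComponent]
  rw [Finset.sum_ite_eq]
  split_ifs with h
  · rfl
  · by_contra hc
    refine h (Finset.mem_biUnion.2 ⟨(x, y), Finset.mem_univ _, Finset.mem_image.2 ⟨m, ?_, rfl⟩⟩)
    exact MvPolynomial.mem_support_iff.2 hc

end OSz

namespace OSz
variable {n : ℕ} {S : Finset (Fin n)}

/-- The exponents of `∏ i, U_i^{w_i}` with `w_i = |v_i^x - v_i^y| / 2`. -/
def wexp (x y : State n) : Fin n ⊕ {i // i ∈ S} →₀ ℕ :=
  Finsupp.equivFunOnFinite.symm (Sum.elim (dist x y) 0)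

theorem wexp_inl (x y : State n) (i : Fin n) : wexp (S := S) x y (Sum.inl i) = dist x y i := rfl

theorem wexp_inr (x y : State n) (i : {i // i ∈ S}) : wexp x y (Sum.inr i) = 0 := rfl

/-- The generator `φ^{x,y}` of `I_x B₀ I_y`, and zero if `x` and `y` have different sizes. -/
def phi (x y : State n) : preAlgebra n S :=
  ⟨Matrix.single x y (if x.card = y.card then MvPolynomial.monomial (wexp x y) 1 else 0), by
    classical
    intro x' y' m hm
    rw [Matrix.single_apply] at hm
    split_ifs at hm with hxy hc
    · obtain ⟨rfl, rfl⟩ := hxy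
      refine ⟨hc, fun i => ⟨0, ?_⟩⟩
      rw [MvPolynomial.coeff_monomial] at hm
      have : wexp x y = m := by
        by_contra hc
        exact hm (if_neg hc)
      rw [← this, wexp_inl, mul_zero, add_zero]
    · exact absurd (MvPolynomial.coeff_zero m) hm
    · exact absurd (MvPolynomial.coeff_zero m) hm⟩

/-- The idempotent `I_x`. -/
def pidem (x : State n) : preAlgebra n S :=
  ⟨Matrix.single x x 1, by
    classical
    intro x' y' m hm
    rw [Matrix.single_apply] at hm
    split_ifs at hm with hxy
    · obtain ⟨rfl, rfl⟩ := hxy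
      refine ⟨rfl, fun i => ⟨0, ?_⟩⟩
      rw [MvPolynomial.coeff_one] at hm
      have : 0 = m := by
        by_contra hc
        exact hm (if_neg hc)
      rw [← this, dist_self]
      rfl
    · exact absurd (MvPolynomial.coeff_zero m) hm⟩

/-- The element acting as a monomial in the `U_i` and `C_i`. -/
def scal (e : Fin n ⊕ {i // i ∈ S} →₀ ℕ) (he : ∀ i, ∃ k, e (Sum.inl i) = 2 * k) :
    preAlgebra n S :=
  ⟨Matrix.diagonal fun _ => MvPolynomial.monomial e 1, by
    classical
    intro x y m hm
    rw [Matrix.diagonal_apply] at hm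
    split_ifs at hm with hxy
    · subst hxy
      rw [MvPolynomial.coeff_monomial] at hm
      have : e = m := by
        by_contra hc
        exact hm (if_neg hc)
      subst this
      refine ⟨rfl, fun i => ?_⟩
      simpa only [dist_self, zero_add] using he i
    · exact absurd (MvPolynomial.coeff_zero m) hm⟩

/-- The central element `U_i`. -/
def U (i : Fin n) : preAlgebra n S :=
  scal (Finsupp.single (Sum.inl i) 2) fun j => by
    classical
    by_cases h : i = j
    · exact ⟨1, by simp [h]⟩
    · exact ⟨0, by simp [h]⟩

/-- The central element `C_i`. -/
def C (i : {i // i ∈ S}) : preAlgebra n S :=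
  scal (Finsupp.single (Sum.inr i) 1) fun j => ⟨0, by simp⟩

/-- `R_i`, moving a coordinate across strand `i` to the right. -/
def R (i : Fin n) : preAlgebra n S :=
  ∑ x : State n with i.castSucc ∈ x ∧ i.succ ∉ x, phi x (insert i.succ (x.erase i.castSucc))

/-- `L_i`, moving a coordinate across strand `i` to the left. -/
def L (i : Fin n) : preAlgebra n S :=
  ∑ x : State n with i.succ ∈ x ∧ i.castSucc ∉ x, phi x (insert i.castSucc (x.erase i.succ))

variable (n S) in
/-- The relations of `B(n, S)`: `R_i R_{i+1} = 0`, `L_{i+1} L_i = 0`, `I_x U_i = 0` if neither of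
the regions adjacent to strand `i` is in `x`, and `C_i² = 0`. -/
def relations : Set (preAlgebra n S) :=
  {a | ∃ i j : Fin n, (i : ℕ) + 1 = j ∧ a = R i * R j} ∪
  {a | ∃ i j : Fin n, (i : ℕ) + 1 = j ∧ a = L j * L i} ∪
  {a | ∃ (x : State n) (i : Fin n), i.castSucc ∉ x ∧ i.succ ∉ x ∧ a = pidem x * U i} ∪
  {a | ∃ i : {i // i ∈ S}, a = C i * C i}

theorem vee_right (x : State n) (i j : Fin n) (h : i.castSucc ∈ x) (h' : i.succ ∉ x) :
    (vee (insert i.succ (x.erase i.castSucc)) j : ℤ) = vee x j + if i = j then 1 else 0 := by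
  have hn : i.succ ∉ x.erase i.castSucc := fun hc => h' (Finset.mem_of_mem_erase hc)
  have h1 := Finset.add_sum_erase x (fun r => if j.castSucc < r then (1 : ℤ) else 0) h
  unfold vee
  rw [Finset.card_filter, Finset.card_filter, Finset.sum_insert hn]
  push_cast
  rw [← h1]
  have h2 : (i.castSucc : Fin (n + 1)) = ⟨i, by omega⟩ := rfl
  have h3 : (j.castSucc : Fin (n + 1)) = ⟨j, by omega⟩ := rfl
  have h4 : (i.succ : Fin (n + 1)) = ⟨i + 1, by omega⟩ := rfl
  simp only [h2, h3, h4, Fin.mk_lt_mk, Fin.ext_iff]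
  split_ifs <;> omega

theorem vee_left (x : State n) (i j : Fin n) (h : i.succ ∈ x) (h' : i.castSucc ∉ x) :
    (vee (insert i.castSucc (x.erase i.succ)) j : ℤ) = vee x j - if i = j then 1 else 0 := by
  have hn : i.castSucc ∉ x.erase i.succ := fun hc => h' (Finset.mem_of_mem_erase hc)
  have h1 := Finset.add_sum_erase x (fun r => if j.castSucc < r then (1 : ℤ) else 0) h
  unfold vee
  rw [Finset.card_filter, Finset.card_filter, Finset.sum_insert hn]
  push_cast
  rw [← h1]
  have h2 : (i.castSucc : Fin (n + 1)) = ⟨i, by omega⟩ := rfl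
  have h3 : (j.castSucc : Fin (n + 1)) = ⟨j, by omega⟩ := rfl
  have h4 : (i.succ : Fin (n + 1)) = ⟨i + 1, by omega⟩ := rfl
  simp only [h2, h3, h4, Fin.mk_lt_mk, Fin.ext_iff]
  split_ifs <;> omega

theorem wexp_eq_single {x y : State n} {i : Fin n} {ε : ℤ} (hε : ε.natAbs = 1)
    (h : ∀ j, (vee y j : ℤ) = vee x j + if i = j then ε else 0) :
    wexp (S := S) x y = Finsupp.single (Sum.inl i) 1 := by
  classical
  ext (j | j)
  · rw [wexp_inl, dist, h j]
    by_cases hj : i = j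
    · subst hj
      rw [if_pos rfl, Finsupp.single_eq_same]
      omega
    · rw [if_neg hj, Finsupp.single_eq_of_ne (fun e => hj (Sum.inl_injective e).symm)]
      omega
  · simp [wexp_inr]

theorem preGr_single {p : ℤ × ℤ} (x y : State n) (f : Poly n S)
    (hf : MvPolynomial.IsWeightedHomogeneous bideg f p) (h) :
    (⟨Matrix.single x y f, h⟩ : preAlgebra n S) ∈ preGr p := by
  intro x' y'
  simp only [Matrix.single_apply]
  split_ifs
  · exact hf
  · exact MvPolynomial.isWeightedHomogeneous_zero _ _ _

theorem phi_mem (x y : State n) : phi (S := S) x y ∈ preGr (Finsupp.weight bideg (wexp (S := S) x y)) := by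
  refine preGr_single x y _ ?_ _
  split_ifs
  · exact MvPolynomial.isWeightedHomogeneous_monomial _ _ _ rfl
  · exact MvPolynomial.isWeightedHomogeneous_zero _ _ _

theorem R_mem (i : Fin n) : R (S := S) i ∈ preGr (bideg (S := S) (Sum.inl i)) := by
  refine Submodule.sum_mem _ fun x hx => ?_
  obtain ⟨h, h'⟩ := (Finset.mem_filter.1 hx).2
  have := phi_mem (S := S) x (insert i.succ (x.erase i.castSucc))
  rwa [wexp_eq_single (ε := 1) rfl fun j => vee_right x i j h h', Finsupp.weight_single,
    one_smul] at this

theorem L_mem (i : Fin n) : L (S := S) i ∈ preGr (bideg (S := S) (Sum.inl i)) := by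
  refine Submodule.sum_mem _ fun x hx => ?_
  obtain ⟨h, h'⟩ := (Finset.mem_filter.1 hx).2
  have := phi_mem (S := S) x (insert i.castSucc (x.erase i.succ))
  rwa [wexp_eq_single (i := i) (ε := -1) rfl fun j => by
    rw [vee_left x i j h h']; split_ifs <;> ring, Finsupp.weight_single, one_smul] at this

theorem pidem_mem (x : State n) : pidem (S := S) x ∈ preGr 0 :=
  preGr_single x x _ (MvPolynomial.isWeightedHomogeneous_one _ _) _

theorem scal_mem (e : Fin n ⊕ {i // i ∈ S} →₀ ℕ) (he) :
    scal e he ∈ preGr (Finsupp.weight bideg e) := by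
  intro x y
  simp only [scal, Matrix.diagonal_apply]
  split_ifs
  · exact MvPolynomial.isWeightedHomogeneous_monomial _ _ _ rfl
  · exact MvPolynomial.isWeightedHomogeneous_zero _ _ _

theorem polyD_monomial (e : Fin n ⊕ {i // i ∈ S} →₀ ℕ) (he : ∀ i, e (Sum.inr i) = 0) (c : ZMod 2) :
    polyD n S (MvPolynomial.monomial e c) = 0 := by
  rw [polyD, MvPolynomial.mkDerivation_monomial]
  refine (congrArg (c • ·) (Finset.sum_eq_zero ?_)).trans (smul_zero c)
  rintro (i | i) hi
  · exact smul_zero _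
  · exact absurd (he i) (Finsupp.mem_support_iff.1 hi)

theorem preD_single (x y : State n) (f : Poly n S) (hf : polyD n S f = 0) (h) :
    preD (⟨Matrix.single x y f, h⟩ : preAlgebra n S) = 0 := by
  refine pre_ext fun x' y' => ?_
  refine (congrArg (polyD n S) (Matrix.single_apply ..)).trans ?_
  split_ifs
  · exact hf
  · exact map_zero _

theorem preD_phi (x y : State n) : preD (phi (S := S) x y) = 0 := by
  refine preD_single x y _ ?_ _
  split_ifs
  · exact polyD_monomial _ (wexp_inr x y) 1
  · exact map_zero _

theorem preD_R (i : Fin n) : preD (R (S := S) i) = 0 := by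
  rw [R, map_sum]
  exact Finset.sum_eq_zero fun x _ => preD_phi _ _

theorem preD_L (i : Fin n) : preD (L (S := S) i) = 0 := by
  rw [L, map_sum]
  exact Finset.sum_eq_zero fun x _ => preD_phi _ _

theorem preD_pidem (x : State n) : preD (pidem (S := S) x) = 0 :=
  preD_single x x _ (Derivation.map_one_eq_zero _) _

theorem preD_U (i : Fin n) : preD (U (S := S) i) = 0 := by
  refine pre_ext fun x y => ?_
  refine (congrArg (polyD n S) (Matrix.diagonal_apply ..)).trans ?_
  split_ifs
  · exact polyD_monomial _ (fun j => by simp) 1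
  · exact map_zero _

theorem scal_comm (e : Fin n ⊕ {i // i ∈ S} →₀ ℕ) (he) (a : preAlgebra n S) :
    scal e he * a = a * scal e he := by
  refine pre_ext fun x y => ?_
  have h1 : (scal e he * a).1 x y = MvPolynomial.monomial e 1 * a.1 x y :=
    Matrix.diagonal_mul (fun _ => MvPolynomial.monomial e 1) a.1 x y
  have h2 : (a * scal e he).1 x y = a.1 x y * MvPolynomial.monomial e 1 :=
    Matrix.mul_diagonal (fun _ => MvPolynomial.monomial e 1) a.1 x y
  rw [h1, h2, mul_comm]

theorem preD_CC (i : {i // i ∈ S}) : preD (C i * C i) = 0 := by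
  rw [preD_mul, C, ← scal_comm]
  exact ZModModule.add_self _

theorem relations_spec {a : preAlgebra n S} (ha : a ∈ relations n S) :
    preD a = 0 ∧ ∃ p, a ∈ preGr p := by
  rcases ha with ((⟨i, j, -, rfl⟩ | ⟨i, j, -, rfl⟩) | ⟨x, i, -, -, rfl⟩) | ⟨i, rfl⟩
  · exact ⟨by rw [preD_mul, preD_R, preD_R, zero_mul, mul_zero, add_zero],
      _, preGr_mul (R_mem i) (R_mem j)⟩
  · exact ⟨by rw [preD_mul, preD_L, preD_L, zero_mul, mul_zero, add_zero],
      _, preGr_mul (L_mem j) (L_mem i)⟩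
  · exact ⟨by rw [preD_mul, preD_pidem, preD_U, zero_mul, mul_zero, add_zero],
      _, preGr_mul (pidem_mem x) (scal_mem _ _)⟩
  · exact ⟨preD_CC i, _, preGr_mul (scal_mem _ _) (scal_mem _ _)⟩

variable (n S) in
/-- The two-sided ideal generated by the relations. -/
def relIdeal : TwoSidedIdeal (preAlgebra n S) := TwoSidedIdeal.span (relations n S)

theorem preD_mem_relIdeal {a : preAlgebra n S} (ha : a ∈ relIdeal n S) :
    preD a ∈ relIdeal n S := by
  unfold relIdeal at ha ⊢
  induction ha using TwoSidedIdeal.span_induction with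
  | mem a h => rw [(relations_spec h).1]; exact zero_mem _
  | zero => rw [map_zero]; exact zero_mem _
  | add a b _ _ ha hb => rw [map_add]; exact add_mem ha hb
  | neg a _ ha => rw [map_neg]; exact neg_mem ha
  | left_absorb a b hb h =>
    rw [preD_mul]
    exact add_mem (TwoSidedIdeal.mul_mem_left _ _ _ hb) (TwoSidedIdeal.mul_mem_left _ _ _ h)
  | right_absorb a b hb h =>
    rw [preD_mul]
    exact add_mem (TwoSidedIdeal.mul_mem_right _ _ _ h) (TwoSidedIdeal.mul_mem_right _ _ _ hb)

theorem preProj_mul_mem {I : TwoSidedIdeal (preAlgebra n S)} (a b : preAlgebra n S)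
    (h : ∀ p q, preProj p a * preProj q b ∈ I) (p : ℤ × ℤ) : preProj p (a * b) ∈ I := by
  obtain ⟨s, hs⟩ := exists_sum_preProj a
  obtain ⟨t, ht⟩ := exists_sum_preProj b
  rw [hs, ht, Finset.sum_mul_sum, map_sum]
  refine sum_mem fun q _ => ?_
  rw [map_sum]
  refine sum_mem fun r _ => ?_
  have hm := preGr_mul (preProj_mem q a) (preProj_mem r b)
  by_cases e : p = q + r
  · subst e; rw [preProj_same hm]; exact h q r
  · rw [preProj_ne e hm]; exact zero_mem _

theorem preProj_mem_relIdeal {a : preAlgebra n S} (ha : a ∈ relIdeal n S) :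
    ∀ p, preProj p a ∈ relIdeal n S := by
  unfold relIdeal at ha ⊢
  induction ha using TwoSidedIdeal.span_induction with
  | mem a h =>
    intro p
    obtain ⟨q, hq⟩ := (relations_spec h).2
    by_cases e : p = q
    · subst e; rw [preProj_same hq]; exact TwoSidedIdeal.subset_span h
    · rw [preProj_ne e hq]; exact zero_mem _
  | zero => intro p; rw [map_zero]; exact zero_mem _
  | add a b _ _ ha hb => intro p; rw [map_add]; exact add_mem (ha p) (hb p)
  | neg a _ ha => intro p; rw [map_neg]; exact neg_mem (ha p)
  | left_absorb a b hb h =>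
    exact preProj_mul_mem a b fun p q => TwoSidedIdeal.mul_mem_left _ _ _ (h q)
  | right_absorb a b hb h =>
    exact preProj_mul_mem b a fun p q => TwoSidedIdeal.mul_mem_right _ _ _ (h p)

variable (n S) in
/-- The algebra underlying `B(n, S)`. -/
abbrev Carrier : Type := (relIdeal n S).ringCon.Quotient

variable (n S) in
/-- The quotient map. -/
def toB : preAlgebra n S →ₐ[ZMod 2] Carrier n S := RingCon.mkₐ (ZMod 2) (relIdeal n S).ringCon

theorem toB_surjective : Function.Surjective (toB n S) := Quotient.mk_surjective

theorem toB_eq_iff {a b : preAlgebra n S} : toB n S a = toB n S b ↔ a - b ∈ relIdeal n S :=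
  ((relIdeal n S).ringCon.eq).trans ((relIdeal n S).rel_iff a b)

/-- The map induced on the quotient. -/
def descend (f : preAlgebra n S →ₗ[ZMod 2] preAlgebra n S)
    (hf : ∀ a ∈ relIdeal n S, f a ∈ relIdeal n S) : Carrier n S →ₗ[ZMod 2] Carrier n S :=
  AddMonoidHom.toZModLinearMap 2
    { toFun := Quotient.lift (fun a => toB n S (f a)) fun a b h => toB_eq_iff.2 (by
        rw [← map_sub]; exact hf _ (((relIdeal n S).rel_iff a b).1 h))
      map_zero' := (congrArg (toB n S) (map_zero f)).trans (map_zero _)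
      map_add' := fun a b => by
        obtain ⟨a, rfl⟩ := toB_surjective a
        obtain ⟨b, rfl⟩ := toB_surjective b
        exact (congrArg (toB n S) (map_add f a b)).trans (map_add _ _ _) }

theorem descend_toB (f : preAlgebra n S →ₗ[ZMod 2] preAlgebra n S) (hf) (a : preAlgebra n S) :
    descend f hf (toB n S a) = toB n S (f a) := rfl

theorem sum_pidem : ∑ x, pidem (S := S) x = 1 := by
  refine Subtype.ext ?_
  rw [AddSubmonoidClass.coe_finsetSum]
  exact Matrix.sum_single_one

theorem pidem_mul_self (x : State n) : pidem (S := S) x * pidem x = pidem x :=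
  Subtype.ext ((Matrix.single_mul_single_same ..).trans (by rw [one_mul]; rfl))

theorem pidem_mul_of_ne {x y : State n} (h : x ≠ y) : pidem (S := S) x * pidem y = 0 :=
  Subtype.ext (Matrix.single_mul_single_of_ne _ _ _ _ h _)

theorem gr_isInternal : DirectSum.IsInternal
    fun p => (preGr (n := n) (S := S) p).map (toB n S).toLinearMap := by
  refine BigradedDGAlgebra.isInternal_of_proj _
    (fun p => descend (preProj p) fun a ha => preProj_mem_relIdeal ha p) ?_ ?_ ?_ ?_
  · intro p a
    obtain ⟨a, rfl⟩ := toB_surjective a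
    exact ⟨_, preProj_mem p a, rfl⟩
  · rintro p _ ⟨a, ha, rfl⟩
    exact congrArg (toB n S) (preProj_same ha)
  · rintro p q _ hpq ⟨a, ha, rfl⟩
    exact (congrArg (toB n S) (preProj_ne hpq ha)).trans (map_zero _)
  · intro a
    obtain ⟨a, rfl⟩ := toB_surjective a
    obtain ⟨s, hs⟩ := exists_sum_preProj a
    refine ⟨s, ?_⟩
    conv_lhs => rw [hs, map_sum]
    rfl

variable (n S) in
/-- The bigraded dg algebra `B(n, S)`. -/
def algB : BigradedDGAlgebra where
  carrier := Carrier n S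
  Idx := State n
  idem x := toB n S (pidem x)
  complete_orthogonal := ⟨⟨fun x => by
      rw [IsIdempotentElem, ← map_mul, pidem_mul_self], fun x y h => by
      exact (map_mul (toB n S) _ _).symm.trans
        ((congrArg (toB n S) (pidem_mul_of_ne h)).trans (map_zero _))⟩, by rw [← map_sum, sum_pidem, map_one]⟩
  gr p := (preGr p).map (toB n S).toLinearMap
  isInternal := gr_isInternal
  idem_mem x := ⟨_, pidem_mem x, rfl⟩
  mul_mem := by
    rintro p q _ _ ⟨a, ha, rfl⟩ ⟨b, hb, rfl⟩
    exact ⟨a * b, preGr_mul ha hb, map_mul (toB n S) a b⟩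
  d := descend preD fun _ ha => preD_mem_relIdeal ha
  d_mem := by
    rintro p _ ⟨a, ha, rfl⟩
    exact ⟨preD a, preGr_d ha, rfl⟩
  d_d a := by
    obtain ⟨a, rfl⟩ := toB_surjective a
    exact (congrArg (toB n S) (preD_preD a)).trans (map_zero _)
  d_mul a b := by
    obtain ⟨a, rfl⟩ := toB_surjective a
    obtain ⟨b, rfl⟩ := toB_surjective b
    refine (congrArg (toB n S) (preD_mul a b)).trans ((map_add _ _ _).trans ?_)
    rw [map_mul, map_mul]
    rfl
  d_idem x := (congrArg (toB n S) (preD_pidem x)).trans (map_zero _)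

end OSz

/-- `C_r(n, S)`: the truncation of `B(n, S)` to the states `x` with `0 ∉ x`. -/
def Cr (n : ℕ) (S : Finset (Fin n)) : BigradedDGAlgebra :=
  (OSz.algB n S).truncate fun x : OSz.State n => 0 ∉ x

/-- `C_l(n, S)`: the truncation of `B(n, S)` to the states `x` with `n ∉ x`. -/
def Cl (n : ℕ) (S : Finset (Fin n)) : BigradedDGAlgebra :=
  (OSz.algB n S).truncate fun x : OSz.State n => Fin.last n ∉ x

/-- The elementary projective `Q_{I_x}`: one generator with idempotent `I_x` and bidegree zero, and
`δ¹ = 0`. -/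
def elemProj (A : BigradedDGAlgebra) (x : A.Idx) : Db A where
  gen := Unit
  idem _ := x
  deg _ := 0
  δ := 0
  δ_mem _ _ := zero_mem _
  δ_δ := by ext; simp
  bounded := ⟨0, by ext; simp [TypeD.iterate]⟩

end BorderedK0

end

/-! Both halves of the statement hold for any bigraded dg algebra `A` with an augmentation, a
multiplicative map to the ring spanned by the idempotents that kills boundaries and every nonzero
bidegree.

Linear independence comes from a graded Euler characteristic. To a Type D structure attach the sum
of its generators, each counted in the coordinate of its idempotent as a sign times a power of `T`.
This is visibly additive on cones, so it descends to `K0` once it is invariant under isomorphism in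
the homotopy category. The cone of an isomorphism is contractible, hence it is enough that a
contractible structure has Euler characteristic zero (`euler_eq_zero`). The augmentation turns the
operation and the contraction into matrices `D` and `H` over `ZMod 2` with `D * D = 0` and `D * H +
H * D = 1`. Then `D + H * D * H` is its own inverse, and its nonzero entries only join generators of
opposite class. A nonzero term of its determinant is a permutation matching generators to generators
of opposite class, so twice the Euler characteristic vanishes (`sum_eq_zero_of_det_ne_zero`). The
value on `elemProj A x` is the basis vector at `x`, which gives a left inverse to the linear
combination map.

Generation comes from operational boundedness. If no nonzero `ZMod 2`-combination of generators were
killed by the operation, linear functionals could be chosen one tensor factor at a time to detect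
every iterate, and none would vanish (`exists_evalList_iterate_ne_zero`). So some nonzero
combination is killed, and it can be taken homogeneous (`exists_homogeneous`). Exchanging it for one
of the generators presents the structure as the cone of a map from a structure with one generator
fewer to a one-generator object with zero operation (`Splitting.isoCone`). Induction on the number
of generators concludes.

For the algebra at hand, the augmentation takes the constant terms of the diagonal entries. It is
multiplicative because off-diagonal entries have no constant term, and it descends to the quotient
because every relation has a factor of nonzero bidegree. It restricts to both truncations. -/

noncomputable section

open CategoryTheory CategoryTheory.Limits CategoryTheory.Pretriangulated Matrix

namespace BorderedK0

open BigradedDGAlgebra TypeD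

/-! ### Augmentations of bigraded dg algebras. -/

namespace BigradedDGAlgebra

/-- An augmentation: a multiplicative map to the ring spanned by the idempotents, vanishing on
boundaries and outside of bidegree zero. -/
structure Augmentation (A : BigradedDGAlgebra) where
  toHom : A.carrier →ₙ+* (A.Idx → ZMod 2)
  map_idem_self : ∀ x, toHom (A.idem x) x = 1
  map_idem_ne : ∀ x y, x ≠ y → toHom (A.idem x) y = 0
  map_d : ∀ a, toHom (A.d a) = 0
  map_gr : ∀ p a, p ≠ 0 → a ∈ A.gr p → toHom a = 0

variable {A : BigradedDGAlgebra}

/-- The restriction of an augmentation to a truncation. -/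
def Augmentation.truncate (ε : A.Augmentation) (P : A.Idx → Prop) :
    (A.truncate P).Augmentation where
  toHom :=
    { toFun := fun a x => ε.toHom (cornerVal (A.idemSum_idem P) a) x.1
      map_mul' := fun a b => by
        funext x
        exact congrFun (map_mul ε.toHom (cornerVal _ a) (cornerVal _ b)) x.1
      map_zero' := by
        funext x
        exact congrFun (map_zero ε.toHom) x.1
      map_add' := fun a b => by
        funext x
        exact congrFun (map_add ε.toHom (cornerVal _ a) (cornerVal _ b)) x.1 }
  map_idem_self x := ε.map_idem_self x.1
  map_idem_ne x y h := ε.map_idem_ne x.1 y.1 fun e => h (Subtype.ext e)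
  map_d a := funext fun x => congrFun (ε.map_d (cornerVal (A.idemSum_idem P) a)) x.1
  map_gr p a hp ha := funext fun x => congrFun (ε.map_gr p (cornerVal _ a) hp ha) x.1

/-- The element absorbs its left and right idempotents, whose images are supported at one index
each, and nonzero bidegrees are killed. Every comparison of generators through a nonzero reduced
entry rests on this. -/
theorem Augmentation.eq_and_eq_zero_of_ne_zero (ε : A.Augmentation) {x y : A.Idx} {p : ℤ × ℤ}
    {a : A.carrier} (ha : a ∈ A.hom x y p) {z : A.Idx} (h : ε.toHom a z ≠ 0) :
    z = x ∧ z = y ∧ p = 0 := by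
  refine ⟨?_, ?_, ?_⟩
  · by_contra hz
    refine h ?_
    rw [← ha.2.1, map_mul, Pi.mul_apply, ε.map_idem_ne x z (Ne.symm hz), zero_mul]
  · by_contra hz
    refine h ?_
    rw [← ha.2.2, map_mul, Pi.mul_apply, ε.map_idem_ne y z (Ne.symm hz), mul_zero]
  · by_contra hp
    exact h (congrFun (ε.map_gr p a hp ha.1) z)

end BigradedDGAlgebra

/-! ### Reduction modulo the augmentation and the Euler characteristic. -/

namespace TypeD
variable {A : BigradedDGAlgebra}

/-- The reduction of a matrix of morphisms along an augmentation. -/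
def reduce (ε : A.Augmentation) (X : TypeD A) {G : Type} (f : Matrix X.gen G A.carrier) :
    Matrix X.gen G (ZMod 2) :=
  Matrix.of fun x y => ε.toHom (f x y) (X.idem x)

theorem reduce_add (ε : A.Augmentation) (X : TypeD A) {G : Type}
    (f g : Matrix X.gen G A.carrier) : reduce ε X (f + g) = reduce ε X f + reduce ε X g := by
  ext x y
  simp [reduce]

theorem reduce_map_d (ε : A.Augmentation) (X : TypeD A) {G : Type}
    (f : Matrix X.gen G A.carrier) : reduce ε X (f.map A.d) = 0 := by
  ext x y
  simp [reduce, ε.map_d]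

/-- The two reductions on the right read off coordinates at possibly different idempotents, that of
`x` and that of `y`. Where the first factor is nonzero these idempotents coincide, so the mismatch
is harmless. -/
theorem reduce_mul (ε : A.Augmentation) {X Y : TypeD A} {k : ℤ} {G : Type}
    {f : Matrix X.gen Y.gen A.carrier} (hf : f ∈ homSub X Y k) (g : Matrix Y.gen G A.carrier) :
    reduce ε X (f * g) = reduce ε X f * reduce ε Y g := by
  ext x z
  simp only [reduce, Matrix.of_apply, Matrix.mul_apply, map_sum, Finset.sum_apply, map_mul,
    Pi.mul_apply]
  refine Finset.sum_congr rfl fun y _ => ?_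
  by_cases h : ε.toHom (f x y) (X.idem x) = 0
  · rw [h, zero_mul, zero_mul]
  · rw [(ε.eq_and_eq_zero_of_ne_zero (hf x y) h).2.1]

theorem reduce_idm (ε : A.Augmentation) (X : TypeD A) [DecidableEq X.gen] :
    reduce ε X X.idm = 1 := by
  ext x y
  by_cases h : x = y
  · subst h
    simp [reduce, idm_self, ε.map_idem_self]
  · simp [reduce, idm_ne X h, h]

/-- The sign and the power of `T = t^{1/2}` of a bidegree. -/
def weight (p : ℤ × ℤ) : LaurentPolynomial ℤ :=
  ((Int.negOnePow p.1 : ℤˣ) : ℤ) • LaurentPolynomial.T p.2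

theorem weight_add_one (p : ℤ × ℤ) : weight (p + (1, 0)) = -weight p := by
  simp [weight, Int.negOnePow_succ]

theorem weight_sub_one (p : ℤ × ℤ) : weight (p - (1, 0)) = -weight p := by
  simp [weight, Int.negOnePow_sub, Int.negOnePow_one]

/-- The class of a generator in the Euler characteristic. -/
def genClass (X : TypeD A) (x : X.gen) : A.Idx →₀ LaurentPolynomial ℤ :=
  Finsupp.single (X.idem x) (weight (X.deg x))

/-- The graded Euler characteristic: the signed count of the generators, for each idempotent. -/
def euler (X : TypeD A) : A.Idx →₀ LaurentPolynomial ℤ := ∑ x, X.genClass x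

/-- An invertible matrix over a field with nonzero entries only between indices of opposite value
forces the sum of the values to vanish. -/
theorem sum_eq_zero_of_det_ne_zero {G K N : Type*} [Fintype G] [DecidableEq G] [Field K]
    [AddCommGroup N] (hN : ∀ v : N, v + v = 0 → v = 0) (M : Matrix G G K) (hM : M.det ≠ 0)
    (s : G → N)
    (hs : ∀ g g', M g g' ≠ 0 → s g + s g' = 0) : ∑ g, s g = 0 := by
  rw [Matrix.det_apply] at hM
  -- A nonzero term of the permutation expansion of the determinant gives a permutation along which
  -- every entry is nonzero.
  obtain ⟨σ, -, hσ⟩ := Finset.exists_ne_zero_of_sum_ne_zero hM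
  have hprod : ∏ i, M (σ i) i ≠ 0 := fun h => hσ (by rw [h, smul_zero])
  have h1 : ∀ g, s (σ g) + s g = 0 := fun g =>
    hs _ _ (Finset.prod_ne_zero_iff.1 hprod g (Finset.mem_univ g))
  have h2 : ∑ g, s (σ g) + ∑ g, s g = 0 := by
    rw [← Finset.sum_add_distrib]
    exact Finset.sum_eq_zero fun g _ => h1 g
  -- Reindexing along the permutation makes the two sums equal, so twice the sum is zero.
  rw [Equiv.sum_comp σ s] at h2
  exact hN _ h2

/-- A nonzero reduced entry has bidegree zero in the algebra, so the two generators share their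
idempotent and intrinsic degree while their homological degrees differ by one. Their signs are
therefore opposite. -/
theorem genClass_add_eq_zero (ε : A.Augmentation) {X : TypeD A} {k : ℤ} (hk : k = 1 ∨ k = -1)
    {f : Matrix X.gen X.gen A.carrier} (hf : f ∈ homSub X X k) {x y : X.gen}
    (h : reduce ε X f x y ≠ 0) : X.genClass x + X.genClass y = 0 := by
  obtain ⟨-, h1, h2⟩ := ε.eq_and_eq_zero_of_ne_zero (hf x y) h
  have h3 : X.deg y = X.deg x + (k, 0) := (sub_eq_zero.1 h2).symm
  have h4 : weight (X.deg y) = -weight (X.deg x) := by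
    rcases hk with rfl | rfl
    · rw [h3, weight_add_one]
    · rw [h3, ← weight_sub_one, sub_eq_add_neg]
      simp
  rw [genClass, genClass, ← h1, ← Finsupp.single_add, h4, add_neg_cancel, Finsupp.single_zero]

/-- Reduction leaves an acyclic complex over a field. Rather than splitting it into kernels and
images, the proof produces an invertible matrix that only joins adjacent homological degrees and
reads a matching of generators off its determinant. -/
theorem euler_eq_zero (ε : A.Augmentation) (X : TypeD A) {h : Matrix X.gen X.gen A.carrier}
    (hh : h ∈ homSub X X (-1)) (hd : diff X X h = X.idm) : X.euler = 0 := by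
  classical
  have hδ := X.δ_mem_homSub
  have hδδ : reduce ε X X.δ * reduce ε X X.δ = 0 := by
    have h0 := congrArg (reduce ε X) X.δ_δ
    rw [reduce_add, reduce_map_d, zero_add, reduce_mul ε hδ] at h0
    rw [h0]
    ext x y
    simp [reduce]
  have h1 : reduce ε X X.δ * reduce ε X h + reduce ε X h * reduce ε X X.δ = 1 := by
    have h0 := congrArg (reduce ε X) hd
    rwa [diff_apply, reduce_add, reduce_add, reduce_map_d, zero_add, reduce_mul ε hδ,
      reduce_mul ε hh, reduce_idm] at h0
  -- The contraction need not square to zero after reduction. Its replacement `h * X.δ * h` has the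
  -- same degree, and its reduction does square to zero.
  have hmem : h * X.δ * h ∈ homSub X X (-1) :=
    homSub_mul (homSub_mul hh hδ (neg_add_cancel 1)) hh (zero_add _)
  have hH : reduce ε X (h * X.δ * h) = reduce ε X h * reduce ε X X.δ * reduce ε X h := by
    rw [reduce_mul ε (homSub_mul hh hδ (neg_add_cancel 1)), reduce_mul ε hh]
  set D := reduce ε X X.δ with hD
  set H := reduce ε X h
  -- Multiply the contraction identity by `D` on the left and use `D * D = 0`.
  have hDHD : D * H * D = D := by
    have := congrArg (D * ·) h1
    simp only [mul_add, ← mul_assoc, hδδ, zero_mul, zero_add, mul_one] at this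
    exact this
  have hsq : (D + H * D * H) * (D + H * D * H) = 1 := by
    have e1 : D * (H * D * H) = D * H := by rw [← mul_assoc, ← mul_assoc, hDHD]
    have e2 : H * D * H * D = H * D := by rw [mul_assoc, mul_assoc, ← mul_assoc D, hDHD]
    have e3 : H * D * H * (H * D * H) = 0 := by
      -- Substituting `1 + H * D` for `D * H` twice leaves `H * D` counted twice and a term with the
      -- factor `D * D`.
      have e4 : D * H * H * D = 0 := by
        have e5 : D * H = 1 + H * D := by
          rw [← h1, add_assoc, ZModModule.add_self, add_zero]
        rw [e5, add_mul, add_mul, one_mul, mul_assoc H D H, e5, mul_add, add_mul, mul_one,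
          ← add_assoc, ZModModule.add_self, zero_add, mul_assoc, mul_assoc, hδδ, mul_zero,
          mul_zero]
      calc H * D * H * (H * D * H) = H * (D * H * H * D) * H := by simp only [mul_assoc]
        _ = 0 := by rw [e4, mul_zero, zero_mul]
    rw [add_mul, mul_add, mul_add, hδδ, e1, e2, e3, zero_add, add_zero, h1]
  refine sum_eq_zero_of_det_ne_zero (fun v hv => ?_) (D + H * D * H) ?_ _ fun x y hxy => ?_
  · ext1 x
    -- Integer Laurent polynomials have no 2-torsion, which permits halving the doubled sum.
    have : CharZero (LaurentPolynomial ℤ) :=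
      charZero_of_injective_ringHom (f := Polynomial.toLaurent.comp Polynomial.C)
        (Polynomial.toLaurent_injective.comp Polynomial.C_injective)
    exact add_self_eq_zero.1 (DFunLike.congr_fun hv x)
  · intro h0
    have := congrArg Matrix.det hsq
    rw [Matrix.det_mul, h0, mul_zero, Matrix.det_one] at this
    exact zero_ne_one this
  -- A nonzero entry of the sum comes from `D`, of degree `1`, or else from the reduction of `h *
  -- X.δ * h`, of degree `-1`.
  · by_cases hx : D x y = 0
    · rw [Matrix.add_apply, hx, zero_add, ← hH] at hxy
      exact genClass_add_eq_zero ε (Or.inr rfl) hmem hxy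
    · exact genClass_add_eq_zero ε (Or.inl rfl) hδ hx

theorem euler_cone {X Y : TypeD A} (f : Matrix X.gen Y.gen A.carrier) (hf : f ∈ cycles X Y) :
    (cone f hf).euler = Y.euler - X.euler := by
  unfold euler
  rw [Fintype.sum_sum_type, sub_eq_neg_add, ← Finset.sum_neg_distrib]
  congr 1
  refine Finset.sum_congr rfl fun x _ => ?_
  simp only [genClass, Sum.elim_inl, weight_sub_one, Finsupp.single_neg]

end TypeD

/-! ### The Euler characteristic on the Grothendieck group and linear independence. -/

namespace Db
variable {A : BigradedDGAlgebra}

/-- The cone of a representing cycle is a zero object, hence contractible, and its Euler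
characteristic is the difference of the two sides. -/
theorem euler_eq_of_iso (ε : A.Augmentation) {X Y : Db A} (e : X ≅ Y) :
    X.toTypeD.euler = Y.toTypeD.euler := by
  obtain ⟨f, hf, he⟩ := Db.exists_mor e.hom
  have hT : standardTriangle f hf ∈ distTriang (Db A) := ⟨X, Y, f, hf, ⟨Iso.refl _⟩⟩
  have hz : IsZero (cone f hf) := Triangle.isZero₃_of_isIso₁ _ hT (by
    change IsIso (mor f hf)
    rw [← he]
    infer_instance)
  -- The vanishing of the identity in the homotopy category is exactly a contracting homotopy of the
  -- cone.
  obtain ⟨h, hh, hd⟩ := mor_eq_iff.1 ((mor_idm _).trans ((IsZero.iff_id_eq_zero _).1 hz))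
  have h0 := TypeD.euler_eq_zero ε (cone f hf).toTypeD hh (hd.trans (add_zero _))
  rw [TypeD.euler_cone f hf] at h0
  exact (sub_eq_zero.1 h0).symm

/-- The graded Euler characteristic on `K₀`. -/
def K0Euler (ε : A.Augmentation) : K0 (Db A) →+ (A.Idx →₀ LaurentPolynomial ℤ) :=
  K0.lift (fun X => X.toTypeD.euler) (fun e => euler_eq_of_iso ε e) (by
    rintro T ⟨X, Y, f, hf, ⟨e⟩⟩
    have h1 := euler_eq_of_iso ε (Triangle.π₁.mapIso e)
    have h2 := euler_eq_of_iso ε (Triangle.π₂.mapIso e)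
    have h3 := euler_eq_of_iso ε (Triangle.π₃.mapIso e)
    refine (congrArg₂ (· + ·) h1 h3).trans (Eq.trans ?_ h2.symm)
    refine (congrArg (X.toTypeD.euler + ·) (TypeD.euler_cone f hf)).trans ?_
    exact add_sub_cancel _ _)

theorem K0Euler_mk (ε : A.Augmentation) (X : Db A) :
    K0Euler ε (K0.mk X) = X.toTypeD.euler :=
  K0.lift_mk _ _ _ X

theorem K0Euler_T_smul (ε : A.Augmentation) (x : A.Idx) (j : ℤ) :
    K0Euler ε ((LaurentPolynomial.T j : LaurentPolynomial ℤ) • K0.mk (elemProj A x)) =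
      Finsupp.single x (LaurentPolynomial.T j) := by
  rw [T_smul_mk, K0Euler_mk]
  refine (Fintype.sum_unique (ι := Unit) _).trans ?_
  have h : weight ((0 : ℤ × ℤ) - (0, -j)) = LaurentPolynomial.T j := by
    simp [weight]
  exact congrArg (Finsupp.single x) h

/-- The Euler characteristic is a left inverse. As `K0Euler` is only an additive map here, the
composite is compared with the identity on integer multiples of powers of `T`, which generate
additively. -/
theorem linearCombination_elemProj_injective (ε : A.Augmentation) :
    Function.Injective (Finsupp.linearCombination (LaurentPolynomial ℤ)
      fun x => K0.mk (elemProj A x)) := by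
  have h : (K0Euler ε).comp (Finsupp.linearCombination (LaurentPolynomial ℤ)
      fun x => K0.mk (elemProj A x)).toAddMonoidHom = AddMonoidHom.id _ := by
    refine Finsupp.addHom_ext fun x p => ?_
    induction p using LaurentPolynomial.induction_on' with
    | add p q hp hq => rw [Finsupp.single_add, map_add, map_add, hp, hq]
    | C_mul_T j a =>
      have h2 : (LaurentPolynomial.C a * LaurentPolynomial.T j : LaurentPolynomial ℤ) =
          a • LaurentPolynomial.T j := by
        rw [zsmul_eq_mul]; simp
      rw [h2, ← Finsupp.smul_single, map_zsmul, map_zsmul]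
      congr 1
      refine Eq.trans ?_ (K0Euler_T_smul ε x j)
      exact congrArg (K0Euler ε) (Finsupp.linearCombination_single ..)
  exact Function.LeftInverse.injective (g := K0Euler ε) fun v => DFunLike.congr_fun h v

end Db

/-! ### The augmentation of `B(n, S)`. -/

namespace OSz
variable {n : ℕ} {S : Finset (Fin n)}

/-- A subset is determined by how many of its elements are at least `k`, for each `k`: consecutive
counts differ by the indicator of `k`. The cardinality gives the count at `k = 0`, the strands give
those at `1, …, n`, and the count at `n + 1` is zero. -/
theorem eq_of_dist_eq_zero {x y : State n} (h : x.card = y.card) (hd : ∀ i, dist x y i = 0) :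
    x = y := by
  have hv : ∀ k : ℕ, k ≤ n + 1 → (x.filter fun r : Fin (n + 1) => k ≤ r.1).card =
      (y.filter fun r : Fin (n + 1) => k ≤ r.1).card := by
    intro k hk
    rcases k with _ | k
    · simpa using h
    · by_cases hk' : k < n
      · have := hd ⟨k, hk'⟩
        unfold dist vee at this
        simp only [Fin.lt_def, Fin.val_castSucc] at this
        simp only [Nat.succ_le_iff]
        omega
      · have hz : ∀ z : State n, z.filter (fun r : Fin (n + 1) => k + 1 ≤ r.1) = ∅ := fun z =>
          Finset.filter_eq_empty_iff.2 fun r _ => by omega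
        rw [hz, hz]
  have hm : ∀ (z : State n) (r : Fin (n + 1)),
      (z.filter fun s : Fin (n + 1) => r.1 ≤ s.1).card =
        (z.filter fun s : Fin (n + 1) => r.1 + 1 ≤ s.1).card + if r ∈ z then 1 else 0 := by
    intro z r
    rw [Finset.card_filter, Finset.card_filter, ← Finset.sum_ite_eq' z r fun _ => 1,
      ← Finset.sum_add_distrib]
    refine Finset.sum_congr rfl fun s _ => ?_
    simp only [Fin.ext_iff]
    split_ifs <;> omega
  ext r
  have h1 := hm x r
  rw [hv _ (by omega), hv _ (by omega), hm y r] at h1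
  by_cases hx : r ∈ x <;> by_cases hy : r ∈ y <;> simp_all

/-- Distinct states of the same size have positive weight at some strand, so a positive power of
that half variable divides every allowed monomial. -/
theorem coeff_zero_eq_zero (a : preAlgebra n S) {x y : State n} (h : x ≠ y) :
    MvPolynomial.constantCoeff (a.1 x y) = 0 := by
  by_contra hc
  obtain ⟨h1, h2⟩ := a.2 x y 0 hc
  refine h (eq_of_dist_eq_zero h1 fun i => ?_)
  obtain ⟨k, hk⟩ := h2 i
  simp only [Finsupp.coe_zero, Pi.zero_apply] at hk
  omega

/-- The constant terms of the diagonal entries. -/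
def preAug : preAlgebra n S →+* (State n → ZMod 2) where
  toFun a x := MvPolynomial.constantCoeff (a.1 x x)
  map_one' := by
    funext x
    exact (congrArg MvPolynomial.constantCoeff (Matrix.one_apply_eq x)).trans (map_one _)
  map_mul' a b := by
    funext x
    refine (congrArg MvPolynomial.constantCoeff (Matrix.mul_apply (M := a.1) (N := b.1))).trans ?_
    -- Paths through a different middle state contribute nothing, because off-diagonal entries have
    -- zero constant term.
    rw [map_sum, Finset.sum_eq_single x]
    · exact map_mul _ _ _
    · intro y _ hy
      rw [map_mul, coeff_zero_eq_zero a hy.symm, zero_mul]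
    · exact fun h => absurd (Finset.mem_univ x) h
  map_zero' := by
    funext x
    exact map_zero MvPolynomial.constantCoeff
  map_add' a b := by
    funext x
    exact map_add MvPolynomial.constantCoeff (a.1 x x) (b.1 x x)

theorem preAug_preGr {p : ℤ × ℤ} (hp : p ≠ 0) {a : preAlgebra n S} (ha : a ∈ preGr p) :
    preAug a = 0 := by
  funext x
  by_contra h
  -- A nonzero constant term is the coefficient of the empty monomial, which has weight zero, and
  -- this forces `p = 0`.
  exact hp ((ha x x h).symm.trans (map_zero _))

/-- Differentiation replaces a factor `C_i` by `U_i`, the square of the half variable, so every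
monomial that occurs is nonconstant. -/
theorem constantCoeff_polyD (p : Poly n S) : MvPolynomial.constantCoeff (polyD n S p) = 0 := by
  by_contra h
  refine coeff_polyD (P := fun _ => True) (Q := fun m => m ≠ 0) (fun s i _ _ h0 => ?_) p
    (fun _ _ => trivial) 0 h rfl
  have := DFunLike.congr_fun h0 (Sum.inl i.1)
  simp at this

theorem bideg_ne_zero (i : Fin n ⊕ {i // i ∈ S}) : bideg i ≠ 0 := by
  rcases i with i | i
  · by_cases h : i ∈ S <;> simp [bideg, h]
  · simp [bideg]

theorem preAug_scal_single (i : Fin n ⊕ {i // i ∈ S}) {k : ℕ} (hk : k ≠ 0) (h) :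
    preAug (scal (Finsupp.single i k) h) = 0 := by
  refine preAug_preGr ?_ (scal_mem _ h)
  rw [Finsupp.weight_single]
  exact smul_ne_zero hk (bideg_ne_zero i)

/-- Each relation is a product with a factor `R_i`, `L_j`, `U_i` or `C_i`, and all of these lie in
nonzero bidegrees. -/
theorem preAug_relations {a : preAlgebra n S} (ha : a ∈ relations n S) : preAug a = 0 := by
  rcases ha with ((⟨i, j, -, rfl⟩ | ⟨i, j, -, rfl⟩) | ⟨x, i, -, -, rfl⟩) | ⟨i, rfl⟩
  · rw [map_mul, preAug_preGr (bideg_ne_zero _) (R_mem i), zero_mul]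
  · rw [map_mul, preAug_preGr (bideg_ne_zero _) (L_mem j), zero_mul]
  · rw [map_mul, U, preAug_scal_single _ two_ne_zero, mul_zero]
  · rw [map_mul, C, preAug_scal_single _ one_ne_zero, mul_zero]

theorem preAug_relIdeal {a : preAlgebra n S} (ha : a ∈ relIdeal n S) : preAug a = 0 := by
  unfold relIdeal at ha
  induction ha using TwoSidedIdeal.span_induction with
  | mem a h => exact preAug_relations h
  | zero => exact map_zero _
  | add a b _ _ ha hb => rw [map_add, ha, hb, add_zero]
  | neg a _ ha => rw [map_neg, ha, neg_zero]
  | left_absorb a b _ h => rw [map_mul, h, mul_zero]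
  | right_absorb a b _ h => rw [map_mul, h, zero_mul]

/-- The ring homomorphism from `B(n, S)` to the ring spanned by the idempotents. -/
def augHom : Carrier n S →+* (State n → ZMod 2) :=
  (relIdeal n S).ringCon.lift preAug fun {a b} h => by
    have := preAug_relIdeal (((relIdeal n S).rel_iff a b).1 h)
    rw [map_sub] at this
    exact sub_eq_zero.1 this

theorem preAug_pidem (x y : State n) :
    preAug (pidem (S := S) x) y = if x = y then 1 else 0 := by
  refine (congrArg MvPolynomial.constantCoeff (Matrix.single_apply ..)).trans ?_
  split_ifs with h h' h'
  · exact map_one _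
  · exact absurd h.1 h'
  · exact absurd ⟨h', h'⟩ h
  · exact map_zero _

variable (n S) in
/-- The augmentation of `B(n, S)`. -/
def augmentation : (algB n S).Augmentation where
  toHom := (augHom : Carrier n S →+* (State n → ZMod 2)).toNonUnitalRingHom
  map_idem_self x := (preAug_pidem (S := S) x x).trans (if_pos rfl)
  map_idem_ne x y h := (preAug_pidem (S := S) x y).trans (if_neg h)
  map_d a := by
    obtain ⟨a, rfl⟩ := toB_surjective a
    funext x
    exact constantCoeff_polyD (a.1 x x)
  map_gr p a hp ha := by
    obtain ⟨a, ha, rfl⟩ := ha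
    exact preAug_preGr hp ha

end OSz

/-! ### Detecting iterated operations by lists of functionals. -/

section
variable {R : Type} [Ring R] [Algebra (ZMod 2) R]

/-- The action of the tensor algebra on functions of lists of functionals: a vector evaluates the
first functional of the list. -/
def listAction : TensorAlgebra (ZMod 2) R →ₐ[ZMod 2]
    Module.End (ZMod 2) (List (R →ₗ[ZMod 2] ZMod 2) → ZMod 2) :=
  TensorAlgebra.lift (ZMod 2)
    (LinearMap.mk₂ (ZMod 2)
      (fun (a : R) (g : List (R →ₗ[ZMod 2] ZMod 2) → ZMod 2) l =>
        match l with
        | [] => 0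
        | φ :: l => φ a * g l)
      (fun a b g => by funext l; rcases l with _ | ⟨φ, l⟩ <;> simp [add_mul])
      (fun c a g => by funext l; rcases l with _ | ⟨φ, l⟩ <;> simp [mul_assoc])
      (fun a g g' => by funext l; rcases l with _ | ⟨φ, l⟩ <;> simp [mul_add])
      (fun c a g => by funext l; rcases l with _ | ⟨φ, l⟩ <;> simp [mul_left_comm]))

/-- The evaluation of a tensor at a list of functionals. -/
def evalList (l : List (R →ₗ[ZMod 2] ZMod 2)) : TensorAlgebra (ZMod 2) R →ₗ[ZMod 2] ZMod 2 :=
  -- The constant function `1` is the value left once all tensor factors are consumed, so the unit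
  -- tensor evaluates to `1` at every list.
  LinearMap.proj l ∘ₗ LinearMap.applyₗ (fun _ => 1) ∘ₗ listAction.toLinearMap

theorem evalList_cons_ι_mul (φ : R →ₗ[ZMod 2] ZMod 2) (l : List (R →ₗ[ZMod 2] ZMod 2)) (a : R)
    (t : TensorAlgebra (ZMod 2) R) :
    evalList (φ :: l) (TensorAlgebra.ι (ZMod 2) a * t) = φ a * evalList l t := by
  simp [evalList, listAction]

theorem evalList_singleton_ι (φ : R →ₗ[ZMod 2] ZMod 2) (a : R) :
    evalList [φ] (TensorAlgebra.ι (ZMod 2) a) = φ a := by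
  have h := evalList_cons_ι_mul φ [] a 1
  rw [mul_one] at h
  rw [h]
  simp [evalList]

variable {G : Type} [Fintype G]

/-- If no nonzero combination of generators is killed, a functional on the first tensor factor sends
the combination `c` to another nonzero combination. Repeating this once per factor detects each
iterate. -/
theorem exists_evalList_iterate_ne_zero {δ : Matrix G G R}
    (hδ : ∀ c : G → ZMod 2, c ≠ 0 → ∃ z, ∑ y, c y • δ y z ≠ 0) (k : ℕ) (c : G → ZMod 2)
    (hc : c ≠ 0) : ∃ l z, ∑ y, c y * evalList l (iterate δ k y z) ≠ 0 := by
  have key : ∀ c : G → ZMod 2, c ≠ 0 →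
      ∃ (φ : R →ₗ[ZMod 2] ZMod 2) (z : G), ∑ y, c y * φ (δ y z) ≠ 0 := by
    intro c hc
    obtain ⟨z, hz⟩ := hδ c hc
    by_contra! h
    -- Over a field, functionals separate a nonzero vector from zero.
    refine hz ((Module.forall_dual_apply_eq_zero_iff (ZMod 2) _).1 fun φ => ?_)
    rw [map_sum, ← h φ z]
    exact Finset.sum_congr rfl fun y _ => by rw [map_smul, smul_eq_mul]
  induction k generalizing c with
  | zero =>
    obtain ⟨φ, z, h⟩ := key c hc
    refine ⟨[φ], z, ?_⟩
    simpa only [iterate, Matrix.map_apply, evalList_singleton_ι] using h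
  | succ k ih =>
    obtain ⟨φ, z, h⟩ := key c hc
    -- The induction continues with the combination left after `φ` has evaluated the first factor;
    -- it is nonzero at `z`.
    obtain ⟨l, w, h'⟩ := ih (fun z => ∑ y, c y * φ (δ y z)) fun e => h (congrFun e z)
    refine ⟨φ :: l, w, ?_⟩
    simp only [iterate, Matrix.mul_apply, Matrix.map_apply, map_sum, evalList_cons_ι_mul,
      Finset.mul_sum]
    rw [Finset.sum_comm]
    simpa only [Finset.sum_mul, mul_assoc] using h'

/-- If the iterates of `δ` vanish eventually, some nonzero combination of generators is killed. -/
theorem exists_sum_smul_eq_zero [Nonempty G] {δ : Matrix G G R} {k : ℕ} (hk : iterate δ k = 0) :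
    ∃ c : G → ZMod 2, c ≠ 0 ∧ ∀ z, ∑ y, c y • δ y z = 0 := by
  classical
  by_contra! h
  obtain ⟨g⟩ := ‹Nonempty G›
  obtain ⟨l, z, h'⟩ := exists_evalList_iterate_ne_zero h k (Pi.single g 1) (by simp)
  simp [hk] at h'

/-! ### Change of generators by matrices over `𝔽₂`. -/

variable (R) in
/-- A matrix over `𝔽₂` as a matrix over `R`. -/
abbrev scalarMat {G H : Type*} (P : Matrix G H (ZMod 2)) : Matrix G H R :=
  P.map (algebraMap (ZMod 2) R)

theorem scalarMat_mul {G H K : Type*} [Fintype H] (P : Matrix G H (ZMod 2))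
    (Q : Matrix H K (ZMod 2)) : scalarMat R (P * Q) = scalarMat R P * scalarMat R Q :=
  Matrix.map_mul

theorem scalarMat_add {G H : Type*} (P Q : Matrix G H (ZMod 2)) :
    scalarMat R (P + Q) = scalarMat R P + scalarMat R Q :=
  Matrix.map_add _ (map_add _) P Q

theorem scalarMat_one {G : Type*} [DecidableEq G] :
    scalarMat R (1 : Matrix G G (ZMod 2)) = 1 :=
  Matrix.map_one _ (map_zero _) (map_one _)

theorem scalarMat_mul_apply {G H K : Type*} [Fintype H] (P : Matrix G H (ZMod 2))
    (f : Matrix H K R) (x : G) (z : K) : (scalarMat R P * f) x z = ∑ y, P x y • f y z := by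
  simp [Matrix.mul_apply, Algebra.smul_def]

theorem mul_scalarMat_apply {G H K : Type*} [Fintype H] (f : Matrix G H R)
    (P : Matrix H K (ZMod 2)) (x : G) (z : K) : (f * scalarMat R P) x z = ∑ y, P y z • f x y := by
  simp [Matrix.mul_apply, Algebra.smul_def, Algebra.commutes]

theorem scalarMat_mul_map {G H K : Type*} {B : Type} [Fintype H] [Ring B] [Algebra (ZMod 2) B]
    (φ : R →ₗ[ZMod 2] B) (P : Matrix G H (ZMod 2)) (f : Matrix H K R) :
    (scalarMat R P * f).map φ = scalarMat B P * f.map φ := by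
  ext x z
  rw [Matrix.map_apply, scalarMat_mul_apply, scalarMat_mul_apply, map_sum]
  exact Finset.sum_congr rfl fun y _ => map_smul φ _ _

theorem mul_scalarMat_map {G H K : Type*} {B : Type} [Fintype H] [Ring B] [Algebra (ZMod 2) B]
    (φ : R →ₗ[ZMod 2] B) (f : Matrix G H R) (P : Matrix H K (ZMod 2)) :
    (f * scalarMat R P).map φ = f.map φ * scalarMat B P := by
  ext x z
  rw [Matrix.map_apply, mul_scalarMat_apply, mul_scalarMat_apply, map_sum]
  exact Finset.sum_congr rfl fun y _ => map_smul φ _ _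

/-- Between consecutive factors of the conjugated iterate stands `p * e`, which is absorbed by the
next `δ` under the hypothesis. No invertibility of `e` or `p` is needed, so the lemma applies to a
quotient with fewer generators. -/
theorem iterate_scalarMat_conj {H : Type} [Fintype H] (e : Matrix H G (ZMod 2))
    (p : Matrix G H (ZMod 2)) {δ : Matrix G G R} (h : scalarMat R (p * e) * δ = δ) (k : ℕ) :
    iterate (scalarMat R e * δ * scalarMat R p) k =
      scalarMat (TensorAlgebra (ZMod 2) R) e * iterate δ k *
        scalarMat (TensorAlgebra (ZMod 2) R) p := by
  have h' : scalarMat (TensorAlgebra (ZMod 2) R) p * scalarMat (TensorAlgebra (ZMod 2) R) e *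
      δ.map (TensorAlgebra.ι (ZMod 2)) = δ.map (TensorAlgebra.ι (ZMod 2)) := by
    conv_rhs => rw [← h]
    rw [scalarMat_mul_map, scalarMat_mul]
  have h1 : (scalarMat R e * δ * scalarMat R p).map (TensorAlgebra.ι (ZMod 2)) =
      scalarMat (TensorAlgebra (ZMod 2) R) e * δ.map (TensorAlgebra.ι (ZMod 2)) *
        scalarMat (TensorAlgebra (ZMod 2) R) p := by
    rw [mul_scalarMat_map, scalarMat_mul_map]
  have h2 : ∀ k, scalarMat (TensorAlgebra (ZMod 2) R) p *
      scalarMat (TensorAlgebra (ZMod 2) R) e * iterate δ k = iterate δ k := by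
    intro k
    cases k with
    | zero => exact h'
    | succ k => rw [iterate, ← Matrix.mul_assoc, h']
  induction k with
  | zero => exact h1
  | succ k ih =>
    rw [iterate, iterate, ih, h1]
    conv_rhs => rw [← h2 k]
    simp only [Matrix.mul_assoc]

end

/-! ### Homogeneous elements killed by the operation, and isomorphisms over `𝔽₂`. -/

namespace BigradedDGAlgebra
variable (A : BigradedDGAlgebra)

theorem exists_proj (p : ℤ × ℤ) : ∃ π : A.carrier →+ A.carrier,
    (∀ a ∈ A.gr p, π a = a) ∧ ∀ q, q ≠ p → ∀ a ∈ A.gr q, π a = 0 := by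
  classical
  let : DirectSum.Decomposition A.gr := A.isInternal.chooseDecomposition
  let : GradedRing A.gr :=
    { one_mem := A.one_mem
      mul_mem := fun _ _ _ _ ha hb => A.mul_mem ha hb }
  exact ⟨GradedRing.proj A.gr p, fun a ha => DirectSum.decompose_of_mem_same A.gr ha,
    fun q hq a ha => DirectSum.decompose_of_mem_ne A.gr ha hq⟩

end BigradedDGAlgebra

namespace TypeD
variable {A : BigradedDGAlgebra}

/-- A nonzero homogeneous combination of generators killed by `δ¹`. -/
theorem exists_homogeneous (X : TypeD A) [Nonempty X.gen] (hX : X.IsOperationallyBounded) :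
    ∃ (x₀ : X.gen) (c : X.gen → ZMod 2), c x₀ = 1 ∧
      (∀ y, c y ≠ 0 → X.idem y = X.idem x₀ ∧ X.deg y = X.deg x₀) ∧
      ∀ z, ∑ y, c y • X.δ y z = 0 := by
  classical
  obtain ⟨k, hk⟩ := hX
  obtain ⟨c, hc, hδ⟩ := exists_sum_smul_eq_zero hk
  obtain ⟨x₀, hx₀⟩ := Function.ne_iff.1 hc
  -- The component of the killed combination in the idempotent and bidegree of a generator `x₀` that
  -- occurs in it.
  obtain ⟨c', hc'⟩ : ∃ c' : X.gen → ZMod 2, ∀ y, c' y =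
      if X.idem y = X.idem x₀ ∧ X.deg y = X.deg x₀ then c y else 0 := ⟨_, fun _ => rfl⟩
  refine ⟨x₀, c', ?_, ?_, ?_⟩
  · rw [hc', if_pos ⟨rfl, rfl⟩]
    exact (by decide : ∀ r : ZMod 2, r ≠ 0 → r = 1) _ hx₀
  · intro y hy
    by_contra h
    exact hy ((hc' y).trans (if_neg h))
  · intro z
    obtain ⟨π, hπ, hπ'⟩ := A.exists_proj (X.deg x₀ + (1, 0) - X.deg z)
    -- Multiplying by the idempotent of `x₀` and projecting to the bidegree expected for `x₀` keeps
    -- exactly the summands selected by `c'` and kills the others.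
    have h := congrArg (fun a => π (A.idem (X.idem x₀) * a)) (hδ z)
    simp only [mul_zero, map_zero, Finset.mul_sum, map_sum] at h
    rw [← h]
    refine Finset.sum_congr rfl fun y _ => ?_
    have hm := (X.δ_mem y z)
    rw [hc']
    by_cases h1 : X.idem y = X.idem x₀
    · have h3 : A.idem (X.idem x₀) * X.δ y z = X.δ y z := h1 ▸ hm.2.1
      rw [mul_smul_comm, h3]
      by_cases h2 : X.deg y = X.deg x₀
      · rw [if_pos ⟨h1, h2⟩, hπ _ (h2 ▸ Submodule.smul_mem _ _ hm.1)]
      · rw [if_neg fun h => h2 h.2, zero_smul]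
        refine (hπ' _ (fun e => h2 ?_) _ (Submodule.smul_mem _ _ hm.1)).symm
        exact add_right_cancel (sub_left_inj.1 e)
    · rw [if_neg fun h => h1 h.1, zero_smul, mul_smul_comm, ← hm.2.1, ← mul_assoc,
        A.complete_orthogonal.ortho (Ne.symm h1), zero_mul, smul_zero, map_zero]

theorem scalarMat_mul_mem {G H K : Type} [Fintype H] {i : G → A.Idx} {i' : H → A.Idx}
    {j : K → A.Idx} {s : G → ℤ × ℤ} {s' : H → ℤ × ℤ} {t : K → ℤ × ℤ} {k : ℤ × ℤ}
    {P : Matrix G H (ZMod 2)} (hP : ∀ x y, P x y ≠ 0 → i x = i' y ∧ s x = s' y)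
    {f : Matrix H K A.carrier} (hf : ∀ y z, f y z ∈ A.hom (i' y) (j z) (s' y + k - t z)) (x z) :
    (scalarMat A.carrier P * f) x z ∈ A.hom (i x) (j z) (s x + k - t z) := by
  rw [scalarMat_mul_apply]
  refine Submodule.sum_mem _ fun y _ => ?_
  by_cases h : P x y = 0
  · rw [h, zero_smul]
    exact zero_mem _
  · obtain ⟨h1, h2⟩ := hP x y h
    rw [h1, h2]
    exact Submodule.smul_mem _ _ (hf y z)

theorem mul_scalarMat_mem {G H K : Type} [Fintype H] {i : G → A.Idx} {i' : H → A.Idx}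
    {j : K → A.Idx} {s : G → ℤ × ℤ} {s' : H → ℤ × ℤ} {t : K → ℤ × ℤ} {k : ℤ × ℤ}
    {P : Matrix H K (ZMod 2)} (hP : ∀ y z, P y z ≠ 0 → i' y = j z ∧ s' y = t z)
    {f : Matrix G H A.carrier} (hf : ∀ x y, f x y ∈ A.hom (i x) (i' y) (s x + k - s' y)) (x z) :
    (f * scalarMat A.carrier P) x z ∈ A.hom (i x) (j z) (s x + k - t z) := by
  rw [mul_scalarMat_apply]
  refine Submodule.sum_mem _ fun y _ => ?_
  by_cases h : P y z = 0
  · rw [h, zero_smul]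
    exact zero_mem _
  · obtain ⟨h1, h2⟩ := hP y z h
    rw [← h1, ← h2]
    exact Submodule.smul_mem _ _ (hf x y)

/-- A matrix over `𝔽₂` that respects bidegrees, idempotents and operations is a homomorphism. -/
theorem scalarMat_mul_idm_mem_cycles {X Z : TypeD A} {P : Matrix X.gen Z.gen (ZMod 2)}
    (hP : ∀ x z, P x z ≠ 0 → X.idem x = Z.idem z ∧ X.deg x = Z.deg z)
    (h : X.δ * scalarMat A.carrier P = scalarMat A.carrier P * Z.δ) :
    scalarMat A.carrier P * Z.idm ∈ cycles X Z := by
  refine mem_cycles_iff.2 ⟨scalarMat_mul_mem hP Z.idm_mem_homSub, ?_⟩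
  rw [diff_apply, scalarMat_mul_map, idm_map_d, Matrix.mul_zero, zero_add, ← Matrix.mul_assoc, h,
    Matrix.mul_assoc, mul_idm Z.δ_mem_homSub, Matrix.mul_assoc, idm_mul Z.δ_mem_homSub]
  exact ZModModule.add_self _

end TypeD

namespace Db
variable {A : BigradedDGAlgebra}

/-- An isomorphism given by a change of generators over `𝔽₂`. -/
def isoOfScalar {X Z : Db A} [DecidableEq X.gen] [DecidableEq Z.gen]
    (P : Matrix X.gen Z.gen (ZMod 2)) (Q : Matrix Z.gen X.gen (ZMod 2))
    (hPQ : P * Q = 1) (hQP : Q * P = 1)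
    (hP : ∀ x z, P x z ≠ 0 → X.idem x = Z.idem z ∧ X.deg x = Z.deg z)
    (hQ : ∀ z x, Q z x ≠ 0 → Z.idem z = X.idem x ∧ Z.deg z = X.deg x)
    (h : X.δ * scalarMat A.carrier P = scalarMat A.carrier P * Z.δ) : X ≅ Z :=
  have h' : Z.δ * scalarMat A.carrier Q = scalarMat A.carrier Q * X.δ := by
    -- Intertwining for the inverse matrix follows by conjugating the given relation with `Q`.
    have h1 : scalarMat A.carrier Q * (X.δ * scalarMat A.carrier P) = Z.δ := by
      rw [h, ← Matrix.mul_assoc, ← scalarMat_mul, hQP, scalarMat_one, Matrix.one_mul]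
    rw [← h1, Matrix.mul_assoc, Matrix.mul_assoc, ← scalarMat_mul, hPQ, scalarMat_one,
      Matrix.mul_one]
  { hom := mor _ (scalarMat_mul_idm_mem_cycles hP h)
    inv := mor _ (scalarMat_mul_idm_mem_cycles hQ h')
    hom_inv_id := mor_congr (by
      rw [Matrix.mul_assoc, idm_mul (scalarMat_mul_idm_mem_cycles hQ h').1, ← Matrix.mul_assoc,
        ← scalarMat_mul, hPQ, scalarMat_one, Matrix.one_mul])
    inv_hom_id := mor_congr (by
      rw [Matrix.mul_assoc, idm_mul (scalarMat_mul_idm_mem_cycles hP h).1, ← Matrix.mul_assoc,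
        ← scalarMat_mul, hQP, scalarMat_one, Matrix.one_mul]) }

end Db

/-! ### Splitting off a generator killed by the operation. -/

/-- The object with one generator, of given idempotent and bidegree, and `δ¹ = 0`. -/
def unitObj (A : BigradedDGAlgebra) (x : A.Idx) (p : ℤ × ℤ) : Db A where
  gen := Unit
  idem _ := x
  deg _ := p
  δ := 0
  δ_mem _ _ := zero_mem _
  δ_δ := by ext; simp
  bounded := ⟨0, by ext; simp [TypeD.iterate]⟩

/-- A change of basis over `𝔽₂` of the generators of `X` to a family indexed by `H` and one more
generator killed by `δ¹`. -/
structure Splitting {A : BigradedDGAlgebra} (X : Db A) [DecidableEq X.gen] where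
  H : Type
  [fintype : Fintype H]
  [decEq : DecidableEq H]
  incl : H → X.gen
  base : X.gen
  e : Matrix H X.gen (ZMod 2)
  p : Matrix X.gen H (ZMod 2)
  u : Matrix X.gen Unit (ZMod 2)
  c : Matrix Unit X.gen (ZMod 2)
  e_mul_p : e * p = 1
  e_mul_u : e * u = 0
  c_mul_p : c * p = 0
  c_mul_u : c * u = 1
  p_mul_e : p * e + u * c = 1
  e_deg : ∀ y x, e y x ≠ 0 → X.idem (incl y) = X.idem x ∧ X.deg (incl y) = X.deg x
  p_deg : ∀ x y, p x y ≠ 0 → X.idem x = X.idem (incl y) ∧ X.deg x = X.deg (incl y)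
  u_deg : ∀ x z, u x z ≠ 0 → X.idem x = X.idem base ∧ X.deg x = X.deg base
  c_deg : ∀ z x, c z x ≠ 0 → X.idem base = X.idem x ∧ X.deg base = X.deg x
  c_mul_δ : scalarMat A.carrier c * X.δ = 0

namespace Splitting
attribute [instance] Splitting.fintype Splitting.decEq

variable {A : BigradedDGAlgebra} {X : Db A} [DecidableEq X.gen] (s : Splitting X)

/-- The complementary projection `s.u * s.c` factors through the distinguished generator, on which
the operation vanishes. -/
theorem p_e_mul_δ : scalarMat A.carrier (s.p * s.e) * X.δ = X.δ := by
  have h : scalarMat A.carrier (s.p * s.e + s.u * s.c) * X.δ = X.δ := by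
    rw [s.p_mul_e, scalarMat_one, Matrix.one_mul]
  rwa [scalarMat_add, Matrix.add_mul, scalarMat_mul s.u, Matrix.mul_assoc _ _ X.δ, s.c_mul_δ,
    Matrix.mul_zero, add_zero] at h

theorem conj_mul_conj {K : Type} (M : Matrix X.gen K (ZMod 2)) :
    scalarMat A.carrier s.e * X.δ * scalarMat A.carrier s.p *
      (scalarMat A.carrier s.e * X.δ * scalarMat A.carrier M) =
      scalarMat A.carrier s.e * (X.δ * X.δ) * scalarMat A.carrier M := by
  have h := s.p_e_mul_δ
  rw [scalarMat_mul] at h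
  calc _ = scalarMat A.carrier s.e * X.δ *
        (scalarMat A.carrier s.p * scalarMat A.carrier s.e * X.δ) * scalarMat A.carrier M := by
        simp only [Matrix.mul_assoc]
    _ = _ := by rw [h]; simp only [Matrix.mul_assoc]

/-- The structure equation of `X` is conjugated by scalar matrices, which commute with the
differential. Taking `M = s.p` gives the structure equation of the quotient, and `M = s.u` gives
closedness of the connecting map. -/
theorem conj_map_d {K : Type} (M : Matrix X.gen K (ZMod 2)) :
    (scalarMat A.carrier s.e * X.δ * scalarMat A.carrier M).map A.d +
      scalarMat A.carrier s.e * X.δ * scalarMat A.carrier s.p *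
      (scalarMat A.carrier s.e * X.δ * scalarMat A.carrier M) = 0 := by
  rw [s.conj_mul_conj, mul_scalarMat_map, scalarMat_mul_map, ← Matrix.add_mul, ← Matrix.mul_add,
    X.δ_δ, Matrix.mul_zero, Matrix.zero_mul]

/-- The quotient of `X` by the generator killed by `δ¹`. -/
def quot : Db A where
  gen := s.H
  idem y := X.idem (s.incl y)
  deg y := X.deg (s.incl y)
  δ := scalarMat A.carrier s.e * X.δ * scalarMat A.carrier s.p
  δ_mem := mul_scalarMat_mem s.p_deg (scalarMat_mul_mem s.e_deg X.δ_mem)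
  δ_δ := s.conj_map_d s.p
  bounded := by
    obtain ⟨k, hk⟩ := X.bounded
    refine ⟨k, ?_⟩
    rw [iterate_scalarMat_conj _ _ s.p_e_mul_δ, hk, Matrix.mul_zero, Matrix.zero_mul]

/-- The component of `δ¹` from the quotient to the generator killed by `δ¹`. -/
def conn : Matrix s.H Unit A.carrier := scalarMat A.carrier s.e * X.δ * scalarMat A.carrier s.u

theorem conn_mem : s.conn ∈ cycles (s.quot.regrade (-1, 0)).toTypeD
    (unitObj A (X.idem s.base) (X.deg s.base)).toTypeD := by
  -- As part of the operation the connecting map has homological degree one; raising the degrees of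
  -- its source by one makes it a map of degree zero.
  refine mem_cycles_iff.2 ⟨homSub_regrade_left (k := 0) (l := -1) (Z := s.quot.toTypeD) ?_, ?_⟩
  · exact mul_scalarMat_mem (t := fun _ => X.deg s.base) s.u_deg
      (scalarMat_mul_mem s.e_deg X.δ_mem)
  · refine Eq.trans (congrArg (_ + ·) (Matrix.mul_zero s.conn)) ((add_zero _).trans ?_)
    exact s.conj_map_d s.u

theorem fromRows_mul_fromCols_eq_one : fromRows s.e s.c * fromCols s.p s.u = 1 := by
  rw [fromRows_mul_fromCols, s.e_mul_p, s.e_mul_u, s.c_mul_p, s.c_mul_u, fromBlocks_one]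

/-- `X` is the cone of the connecting map. -/
def isoCone : X ≅ Db.cone (X := s.quot.regrade (-1, 0))
    (Y := unitObj A (X.idem s.base) (X.deg s.base))
    s.conn s.conn_mem :=
  letI : DecidableEq (Db.cone (X := s.quot.regrade (-1, 0))
      (Y := unitObj A (X.idem s.base) (X.deg s.base))
    s.conn s.conn_mem).gen :=
    inferInstanceAs (DecidableEq (s.H ⊕ Unit))
  -- The shift of the source cancels the shift built into the cone, so degrees agree with those in
  -- `X`.
  have hdeg : ∀ d : ℤ × ℤ, d = d - (-1, 0) - (1, 0) := fun d => Prod.ext (by simp) (by simp)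
  Db.isoOfScalar (fromCols s.p s.u) (fromRows s.e s.c)
    ((fromCols_mul_fromRows ..).trans s.p_mul_e)
    s.fromRows_mul_fromCols_eq_one
    (by
      rintro x (y | y) h
      · exact ⟨(s.p_deg x y h).1, (s.p_deg x y h).2.trans (hdeg _)⟩
      · exact s.u_deg x y h)
    (by
      rintro (y | y) x h
      · exact ⟨(s.e_deg y x h).1, (hdeg _).symm.trans (s.e_deg y x h).2⟩
      · exact s.c_deg y x h)
    (by
      have h1 : ∀ {K : Type} (M : Matrix X.gen K (ZMod 2)),
          scalarMat A.carrier s.p * (scalarMat A.carrier s.e * X.δ * scalarMat A.carrier M) =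
            X.δ * scalarMat A.carrier M := fun M => by
        rw [← Matrix.mul_assoc, ← Matrix.mul_assoc, ← scalarMat_mul, s.p_e_mul_δ]
      have h2 : scalarMat A.carrier (fromCols s.p s.u) =
          fromCols (scalarMat A.carrier s.p) (scalarMat A.carrier s.u) := by
        ext x (y | y) <;> rfl
      refine (congrArg (X.δ * ·) h2).trans (Eq.trans ?_ (congrArg (· * _) h2.symm))
      refine (mul_fromCols ..).trans (Eq.trans ?_ (fromCols_mul_fromBlocks ..).symm)
      refine congrArg₂ fromCols ?_ ?_
      · exact (h1 s.p).symm.trans ((add_zero _).symm.trans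
          (congrArg (_ + ·) (Matrix.mul_zero _).symm))
      · exact (h1 s.u).symm.trans ((add_zero _).symm.trans
          (congrArg (_ + ·) (Matrix.mul_zero _).symm)))

theorem mk_add_mk : K0.mk (s.quot.regrade (-1, 0)) + K0.mk X =
    K0.mk (unitObj A (X.idem s.base) (X.deg s.base)) := by
  rw [K0.mk_eq_of_iso s.isoCone]
  exact Db.K0_mk_cone s.conn_mem

end Splitting

/-! ### Generation by the elementary projectives and the basis. -/

namespace Db
open ZeroObject
variable {A : BigradedDGAlgebra}

/-- An exchange argument: the coefficient of `x₀` in the killed combination is `1`, so that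
combination can replace `x₀` among the generators. -/
theorem exists_splitting (X : Db A) [Nonempty X.gen] [DecidableEq X.gen] :
    ∃ s : Splitting X, Fintype.card s.H < Fintype.card X.gen := by
  obtain ⟨x₀, c, hc₀, hc, hδ⟩ := X.toTypeD.exists_homogeneous X.bounded
  have hep : (1 : Matrix X.gen X.gen (ZMod 2)).submatrix (Subtype.val : {y // y ≠ x₀} → X.gen) id *
      Matrix.of (fun x (y : {y // y ≠ x₀}) =>
        (if x = y.1 then 1 else 0) + if x = x₀ then c y.1 else 0) = 1 := by
    ext y z
    simp [Matrix.mul_apply, Matrix.one_apply, y.2, Subtype.ext_iff]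
  let s : Splitting X :=
    { H := {y // y ≠ x₀}
      incl := Subtype.val
      base := x₀
      e := (1 : Matrix X.gen X.gen (ZMod 2)).submatrix Subtype.val id
      -- In characteristic two, `x₀` is the killed combination plus the sum of `c y` times `y` over
      -- the other generators. The matrices `p` and `u` record these coordinates, and the other
      -- generators are unchanged.
      p := Matrix.of fun x y => (if x = y.1 then 1 else 0) + if x = x₀ then c y.1 else 0
      u := Matrix.of fun x _ => if x = x₀ then 1 else 0
      c := Matrix.of fun _ x => c x
      e_mul_p := hep
      e_mul_u := by
        ext y z
        simp [Matrix.mul_apply, Matrix.one_apply, y.2]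
      c_mul_p := by
        ext y z
        simp [Matrix.mul_apply, mul_add, Finset.sum_add_distrib, hc₀, ZModModule.add_self]
      c_mul_u := by
        ext y z
        simp [Matrix.mul_apply, hc₀]
      p_mul_e := by
        ext x z
        simp only [Matrix.add_apply, Matrix.mul_apply, Matrix.of_apply, Matrix.submatrix_apply,
          Matrix.one_apply, id, mul_ite, mul_one, mul_zero, Finset.univ_unique,
          Finset.sum_singleton, ite_mul, one_mul, zero_mul]
        by_cases hz : z = x₀
        · subst hz
          rw [Finset.sum_eq_zero fun y _ => if_neg y.2, zero_add, hc₀]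
        · rw [Finset.sum_eq_single ⟨z, hz⟩ (fun y _ hy => if_neg fun e => hy (Subtype.ext e))
            (fun h => absurd (Finset.mem_univ _) h), if_pos rfl, add_assoc, ZModModule.add_self,
            add_zero]
      e_deg := fun y x h => by
        have : y.1 = x := by
          by_contra hn
          exact h (Matrix.one_apply_ne hn)
        subst this
        exact ⟨rfl, rfl⟩
      p_deg := fun x y h => by
        by_cases h1 : x = y.1
        · subst h1
          exact ⟨rfl, rfl⟩
        · by_cases h2 : x = x₀
          · subst h2
            have := hc y.1 fun h3 => h (by simp [h1, h3])
            exact ⟨this.1.symm, this.2.symm⟩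
          · exact absurd (by simp [h1, h2]) h
      u_deg := fun x z h => by
        have : x = x₀ := by
          by_contra hn
          exact h (if_neg hn)
        subst this
        exact ⟨rfl, rfl⟩
      c_deg := fun z x h => ⟨(hc x h).1.symm, (hc x h).2.symm⟩
      c_mul_δ := by
        ext y z
        rw [scalarMat_mul_apply]
        exact hδ z }
  exact ⟨s, Fintype.card_subtype_lt (x := x₀) fun h => h rfl⟩

theorem K0_mk_eq_zero_of_isZero {X : Db A} (h : IsZero X) : K0.mk X = 0 := by
  have h1 := K0.mk_triangle (Pretriangulated.contractible_distinguished X)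
  have h2 : K0.mk X + K0.mk (0 : Db A) = K0.mk X := h1
  rw [K0.mk_eq_of_iso (h.iso (Limits.isZero_zero (Db A)))]
  simpa using h2

/-- Rotating the contractible triangle on `X` gives a distinguished triangle `X → 0 → X[1]`. -/
theorem K0_mk_regrade_one (X : Db A) : K0.mk (X.regrade (1, 0)) = -K0.mk X := by
  have h3 := K0.mk_triangle (rot_of_distTriang _ (Pretriangulated.contractible_distinguished X))
  have h4 : K0.mk X + K0.mk (X.regrade (1, 0)) = K0.mk (0 : Db A) := h3
  rw [K0_mk_eq_zero_of_isZero (Limits.isZero_zero (Db A))] at h4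
  exact (neg_eq_of_add_eq_zero_right h4).symm

/-- Intrinsic shifts act by powers of `T`, and homological shifts only change the sign of the class,
so the homological degree can be moved to zero by induction in both directions. -/
theorem K0_mk_unitObj_mem (x : A.Idx) (p : ℤ × ℤ) : K0.mk (unitObj A x p) ∈
    Submodule.span (LaurentPolynomial ℤ) (Set.range fun x => K0.mk (elemProj A x)) := by
  obtain ⟨h, j⟩ := p
  have key : ∀ h : ℤ, K0.mk (unitObj A x (h - 1, j)) = -K0.mk (unitObj A x (h, j)) := by
    intro h
    rw [← K0_mk_regrade_one]
    have : ((h - 1, j) : ℤ × ℤ) = (h, j) - (1, 0) := by simp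
    rw [this]
    rfl
  have h0 : K0.mk (unitObj A x (0, j)) ∈
      Submodule.span (LaurentPolynomial ℤ) (Set.range fun x => K0.mk (elemProj A x)) := by
    have h1 : K0.mk (unitObj A x (0, j)) =
        (LaurentPolynomial.T j : LaurentPolynomial ℤ) • K0.mk (elemProj A x) := by
      rw [T_smul_mk]
      have : ((0, j) : ℤ × ℤ) = 0 - (0, -j) := by simp
      rw [this]
      rfl
    rw [h1]
    exact Submodule.smul_mem _ _ (Submodule.subset_span ⟨x, rfl⟩)
  induction h using Int.induction_on with
  | zero => exact h0
  | succ i ih =>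
    have := key (i + 1)
    rw [add_sub_cancel_right] at this
    rw [this] at ih
    exact neg_mem_iff.1 ih
  | pred i ih =>
    rw [key]
    exact neg_mem ih

theorem K0_mk_mem_span (X : Db A) : K0.mk X ∈
    Submodule.span (LaurentPolynomial ℤ) (Set.range fun x => K0.mk (elemProj A x)) := by
  induction h : Fintype.card X.gen using Nat.strong_induction_on generalizing X with
  | _ m ih =>
    rcases isEmpty_or_nonempty X.gen with h0 | h0
    · rw [K0_mk_eq_zero_of_isZero ((IsZero.iff_id_eq_zero X).2
        (mor_congr (by ext x; exact h0.elim x)))]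
      exact zero_mem _
    · classical
      obtain ⟨s, hs⟩ := X.exists_splitting
      have h1 := ih _ (h ▸ hs) (s.quot.regrade (-1, 0)) rfl
      -- In the cone relation, the quotient class is in the span by induction and the one-generator
      -- class by the previous lemma, hence so is the class of `X`.
      exact (Submodule.add_mem_iff_right _ h1).1 (s.mk_add_mk ▸ K0_mk_unitObj_mem _ _)

theorem span_elemProj : Submodule.span (LaurentPolynomial ℤ)
    (Set.range fun x => K0.mk (elemProj A x)) = ⊤ := by
  -- Classes of objects generate `K0` additively, so the projection modulo the span is zero as soon
  -- as it kills them.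
  have h : (QuotientAddGroup.mk' (Submodule.span (LaurentPolynomial ℤ)
      (Set.range fun x => K0.mk (elemProj A x))).toAddSubgroup) = 0 :=
    K0.hom_ext fun X => (QuotientAddGroup.eq_zero_iff _).2 (K0_mk_mem_span X)
  exact eq_top_iff.2 fun a _ => (QuotientAddGroup.eq_zero_iff a).1 (DFunLike.congr_fun h a)

/-- The basis of `K₀` of an augmented algebra by the elementary projectives. -/
theorem exists_basis (ε : A.Augmentation) :
    ∃ b : Module.Basis A.Idx (LaurentPolynomial ℤ) (K0 (Db A)),
      ∀ x, b x = K0.mk (elemProj A x) :=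
  ⟨Module.Basis.mk (linearCombination_elemProj_injective ε) span_elemProj.ge,
    fun x => Module.Basis.mk_apply _ _ x⟩

end Db

theorem card_finset_not_mem {n : ℕ} (a : Fin (n + 1)) :
    Nat.card {x : Finset (Fin (n + 1)) // a ∉ x} = 2 ^ n := by
  have h : ∀ x : Finset (Fin (n + 1)), a ∉ x ↔ x ∈ (Finset.univ.erase a).powerset := fun x => by
    rw [Finset.mem_powerset, Finset.subset_erase]
    simp
  rw [Nat.card_congr (Equiv.subtypeEquivRight h), Nat.card_eq_fintype_card, Fintype.card_coe,
    Finset.card_powerset, Finset.card_erase_of_mem (Finset.mem_univ a), Finset.card_univ,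
    Fintype.card_fin, Nat.add_sub_cancel]

end BorderedK0

end

theorem mainTheorem2 (n : ℕ) (S : Finset (Fin n)) :
    (Nat.card {x : Finset (Fin (n + 1)) // 0 ∉ x} = 2 ^ n ∧
      ∃ b : Module.Basis {x : Finset (Fin (n + 1)) // 0 ∉ x} (LaurentPolynomial ℤ)
          (BorderedK0.K0 (BorderedK0.Db (BorderedK0.Cr n S))),
        ∀ x, b x = BorderedK0.K0.mk (BorderedK0.elemProj (BorderedK0.Cr n S) x)) ∧
    (Nat.card {x : Finset (Fin (n + 1)) // Fin.last n ∉ x} = 2 ^ n ∧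
      ∃ b : Module.Basis {x : Finset (Fin (n + 1)) // Fin.last n ∉ x} (LaurentPolynomial ℤ)
          (BorderedK0.K0 (BorderedK0.Db (BorderedK0.Cl n S))),
        ∀ x, b x = BorderedK0.K0.mk (BorderedK0.elemProj (BorderedK0.Cl n S) x)) :=
  ⟨⟨BorderedK0.card_finset_not_mem 0, BorderedK0.Db.exists_basis
      ((BorderedK0.OSz.augmentation n S).truncate fun x : BorderedK0.OSz.State n => 0 ∉ x)⟩,
    ⟨BorderedK0.card_finset_not_mem (Fin.last n), BorderedK0.Db.exists_basis
      ((BorderedK0.OSz.augmentation n S).truncate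
        fun x : BorderedK0.OSz.State n => Fin.last n ∉ x)⟩⟩
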